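/- **Setting.** Let $G$ be a compact Lie group, $K\subset H\subset G$ closed Lie subgroups with $G/K$ and $H/K$ connected and $G/K$ effective ($K$ contains no nontrivial normal subgroup of $G$). Let $\mathfrak k,\mathfrak h,\mathfrak g$ be the Lie algebras, $B$ the Killing form of $\mathfrak g$, and suppose that the $B$-orthogonal complement $\mathfrak p$ of $\mathfrak k$ splits as $\mathfrak g=\mathfrak k\oplus\mathfrak p$, $\mathfrak p=\mathfrak p_1\oplus\mathfrak p_2$, with $\mathfrak p_1,\mathfrak p_2$ irreducible and inequivalent under $\mathrm{Ad}_K$, and $\mathfrak h=\mathfrak k\oplus\mathfrak p_1$. Let $Q$ be an $\mathrm{Ad}_K$-invariant scalar product on $\mathfrak p$ with $-B|_{\mathfrak p_i}=b_iQ|_{\mathfrak p_i}$, $b_i>0$. The $G$-invariant Riemannian metrics on $G/K$ are $g=x_1Q|_{\mathfrak p_1}\oplus x_2Q|_{\mathfrak p_2}$ with $x_1,x_2>0$; put $y=x_1/x_2$. Let $d_i=\dim\mathfrak p_i$ and $[ijk]=\sum Q([e_\alpha,e_\beta],e_\gamma)^2$, summed over $Q$-orthonormal bases $e_\alpha,e_\beta,e_\gamma$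 of $\mathfrak p_i,\mathfrak p_j,\mathfrak p_k$ (only the $\mathfrak p$-component of the bracket counts). Assume $$[122]>0,\qquad C:=b_1-\frac{[111]}{2d_1}-\frac{[122]}{d_1}>0 .$$ The homogeneous Ricci flow is $\partial_t g(t)=-2\,\mathrm{Ric}(g(t))$ for $g(t)=x_1(t)Q|_{\mathfrak p_1}\oplus x_2(t)Q|_{\mathfrak p_2}$, $x_1(t),x_2(t)>0$. Suppose that $G/K$ carries exactly one $G$-invariant Einstein metric up to scaling: there is $\bar y>0$ such that $(x_1,x_2)$ is Einstein if and only if $x_1/x_2=\bar y$. Let $(x_1(0),x_2(0))$ be an initial metric, with $y(0)=x_1(0)/x_2(0)$. **Theorem.** 1. If $y(0)<\bar y$, there is $0<T<\infty$ and a unique solution of the flow with this initial metric on the maximal time interval $(-\infty,T)$ (every solution on an interval containing $0$ with the same initial metric is a restriction of it, and $|\mathrm{Rm}(g(t))|_{g(t)}$ is unbounded as $t\to T$). It is an ancient solution of type I: $\lim_{t\to-\infty}|t|\,\sup_{G/K}|\mathrm{Rm}(g(t))|_{g(t)}$ exists and is finite. As $t\to T$, the fibre $H/K$ of $H/K\to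 G/K\to G/H$ shrinks to a point ($x_1(t)\to0$, and $H/K$ with the metric $x_1(t)Q|_{\mathfrak p_1}$ converges to a point in the Hausdorff-Gromov sense), $x_2(t)$ has a limit $\ell\in(0,\infty)$, and $(G/K,g(t))$ converges in the Hausdorff-Gromov sense to $G/H$ with the metric $\ell\,Q|_{\mathfrak p_2}$. Moreover $y(t)\to\bar y$ as $t\to-\infty$. 2. If $y(0)>\bar y$, there is $0<T<\infty$ and a unique solution with this initial metric on the maximal forward time interval $[0,T)$ (every solution on an interval in $[0,\infty)$ containing $0$ with the same initial metric is a restriction of it, and the curvature is unbounded as $t\to T$). As $t\to T$, $G/K$ shrinks to a point ($x_1(t),x_2(t)\to0$, and $(G/K,g(t))$ converges to a point in the Hausdorff-Gromov sense), and $y(t)\to\bar y$. There is no ancient solution with this initial metric, i.e. no solution on any interval $(-\infty,T')$, $T'>0$. -/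

import Mathlib

open Set Filter Topology Manifold
open scoped ContDiff

noncomputable section

namespace HomogeneousRicci

/-! ### Lie groups, Lie subgroups, the adjoint action -/

section LieGroups

variable {E : Type*} [NormedAddCommGroup E] [NormedSpace ℝ E]
  {G : Type*} [TopologicalSpace G] [ChartedSpace E G] [Group G]

/-- A smooth Lie group has the regularity under which Mathlib makes its tangent space at the
identity a Lie algebra. -/
instance lieGroup_minSmoothness [LieGroup 𝓘(ℝ, E) ∞ G] :
    LieGroup 𝓘(ℝ, E) (minSmoothness ℝ 3) G :=
  LieGroup.of_le (n := ∞) (by simpa using (mod_cast le_top : ((3 : ℕ∞) : ℕ∞ω) ≤ ∞))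

variable (E G) in
/-- The Lie algebra of `G`: the tangent space at `1` with the bracket of left-invariant fields. -/
abbrev LieAlg : Type _ := GroupLieAlgebra 𝓘(ℝ, E) G

variable (E) in
/-- The adjoint action `Ad g`: the differential at `1` of the conjugation `x ↦ g x g⁻¹`
(which fixes `1`). -/
def Ad (g : G) (X : LieAlg E G) : LieAlg E G :=
  (mfderiv 𝓘(ℝ, E) 𝓘(ℝ, E) (fun x : G => g * x * g⁻¹) 1 : E →L[ℝ] E) X

variable (E) (F : Type*) [NormedAddCommGroup F] [NormedSpace ℝ F]

/-- The differential at `1` of the inclusion of a subgroup carrying a manifold structure. -/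
def inclDeriv (L : Subgroup G) [ChartedSpace F L] : LieAlg F L →ₗ[ℝ] LieAlg E G :=
  (show F →L[ℝ] E from mfderiv 𝓘(ℝ, F) 𝓘(ℝ, E) (Subtype.val : L → G) 1).toLinearMap

/-- `L` is a closed Lie subgroup of `G`: it is closed, and its inclusion is a smooth immersion
(the differential being injective at `1` it is injective everywhere, by translation). -/
structure IsClosedLieSubgroup (L : Subgroup G) [ChartedSpace F L] : Prop where
  isClosed : IsClosed (L : Set G)
  smooth : ContMDiff 𝓘(ℝ, F) 𝓘(ℝ, E) ∞ (Subtype.val : L → G)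
  injective : Function.Injective (inclDeriv E F L)

/-- The Lie algebra of a Lie subgroup, as a subspace of the Lie algebra of `G`. -/
def subLieAlg (L : Subgroup G) [ChartedSpace F L] : Submodule ℝ (LieAlg E G) :=
  LinearMap.range (inclDeriv E F L)

/-- `W` is an `Ad_L`-invariant subspace. -/
def AdInvariant (L : Subgroup G) (W : Submodule ℝ (LieAlg E G)) : Prop :=
  ∀ k ∈ L, ∀ X ∈ W, Ad E k X ∈ W

/-- `W` is a (nonzero) irreducible `Ad_L`-invariant subspace. -/
structure AdIrreducible (L : Subgroup G) (W : Submodule ℝ (LieAlg E G)) : Prop where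
  invariant : AdInvariant E L W
  ne_bot : W ≠ ⊥
  eq_bot_or_eq : ∀ V : Submodule ℝ (LieAlg E G), V ≤ W → AdInvariant E L V → V = ⊥ ∨ V = W

/-- `W` and `V` are equivalent representations of `L`. -/
def AdEquivalent (L : Subgroup G) (W V : Submodule ℝ (LieAlg E G)) : Prop :=
  ∃ φ : W ≃ₗ[ℝ] V, ∀ k ∈ L, ∀ X Y : W, (Y : LieAlg E G) = Ad E k X →
    (φ Y : LieAlg E G) = Ad E k (φ X)

/-! ### Distances on coset spaces -/

/-- For a nonnegative homogeneous function `N` on the Lie algebra, the infimum over the `C¹` paths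
`γ` in `G` from `a` to `b` of the integral of `N (γ⁻¹ γ')`. -/
def leftEDist (N : LieAlg E G → ℝ) (a b : G) : ENNReal :=
  letI : ∀ x : G, ENorm (TangentSpace 𝓘(ℝ, E) x) := fun x =>
    ⟨fun v => ENNReal.ofReal
      (N ((mfderiv 𝓘(ℝ, E) 𝓘(ℝ, E) (fun z : G => x⁻¹ * z) x : E →L[ℝ] E) v))⟩
  riemannianEDist 𝓘(ℝ, E) a b

/-- The Riemannian distance on `G ⧸ L`. Here `N X` is the length, for a `G`-invariant Riemannian
metric on `G ⧸ L`, of the tangent vector at the base point that `X` represents. Every `C¹` curve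
in `G ⧸ L` lifts to a `C¹` curve `γ` in `G`, and its speed is `N (γ⁻¹ γ')`; so the Riemannian
distance is the infimum of `∫ N (γ⁻¹ γ')` over the curves in `G` between the two cosets. -/
def cosetDist (L : Subgroup G) (N : LieAlg E G → ℝ) (p q : G ⧸ L) : ℝ :=
  (⨅ (a : G) (b : G) (_ : (a : G ⧸ L) = p) (_ : (b : G ⧸ L) = q), leftEDist E N a b).toReal

end LieGroups

/-! ### Hausdorff-Gromov distance -/

/-- `S` is an `ε`-approximation between `(A, dA)` and `(B, dB)`. -/
structure IsApproximation {A B : Type*} (dA : A → A → ℝ) (dB : B → B → ℝ) (ε : ℝ)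
    (S : Set (A × B)) : Prop where
  fst_onto : ∀ a, ∃ b, (a, b) ∈ S
  snd_onto : ∀ b, ∃ a, (a, b) ∈ S
  close : ∀ p ∈ S, ∀ q ∈ S, |dA p.1 q.1 - dB p.2 q.2| < ε

/-- The Hausdorff-Gromov distance, `∞` if there is no approximation. -/
def hgDist {A B : Type*} (dA : A → A → ℝ) (dB : B → B → ℝ) : ENNReal :=
  ⨅ (ε : ℝ) (_ : ∃ S : Set (A × B), IsApproximation dA dB ε S), ENNReal.ofReal ε

/-- The distance of the one-point space. -/
def pointDist : Unit → Unit → ℝ := fun _ _ => 0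

/-! ### The class of homogeneous spaces -/

/-- The isotropy representation of `G ⧸ K` splits into two inequivalent irreducible summands
`𝔭₁`, `𝔭₂`, where `𝔨 ⊕ 𝔭₁` is the Lie algebra of the intermediate group `H`. The complement
`𝔭 = 𝔭₁ ⊕ 𝔭₂` of `𝔨` is the orthogonal one for the Killing form `B`, the background metric is
`Q = -B / bᵢ` on `𝔭ᵢ`, and `eᵢ` is a `Q`-orthonormal basis of `𝔭ᵢ`. -/
structure TwoSummands (E : Type*) [NormedAddCommGroup E] [NormedSpace ℝ E]
    {G : Type*} [TopologicalSpace G] [ChartedSpace E G] [Group G] [LieGroup 𝓘(ℝ, E) ∞ G]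
    [CompleteSpace E]
    (EK : Type*) [NormedAddCommGroup EK] [NormedSpace ℝ EK]
    (EH : Type*) [NormedAddCommGroup EH] [NormedSpace ℝ EH]
    (K H : Subgroup G) [ChartedSpace EK K] [ChartedSpace EH H] where
  /-- the first summand, tangent to the fibre `H ⧸ K` -/
  p₁ : Submodule ℝ (LieAlg E G)
  /-- the second summand, tangent to the base `G ⧸ H` -/
  p₂ : Submodule ℝ (LieAlg E G)
  isCompl_k : IsCompl (subLieAlg E EK K) (p₁ ⊔ p₂)
  isCompl_p₁ : IsCompl p₁ (subLieAlg E EK K ⊔ p₂)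
  isCompl_p₂ : IsCompl p₂ (subLieAlg E EK K ⊔ p₁)
  irreducible_p₁ : AdIrreducible E K p₁
  irreducible_p₂ : AdIrreducible E K p₂
  inequivalent : ¬ AdEquivalent E K p₁ p₂
  lieAlg_H : subLieAlg E EH H = subLieAlg E EK K ⊔ p₁
  killing_orthogonal : ∀ X ∈ subLieAlg E EK K, ∀ Y ∈ p₁ ⊔ p₂, killingForm ℝ (LieAlg E G) X Y = 0
  /-- the scale of the background metric on `𝔭₁` -/
  b₁ : ℝ
  /-- the scale of the background metric on `𝔭₂` -/
  b₂ : ℝ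
  b₁_pos : 0 < b₁
  b₂_pos : 0 < b₂
  /-- the dimension of `𝔭₁` -/
  d₁ : ℕ
  /-- the dimension of `𝔭₂` -/
  d₂ : ℕ
  /-- a basis of `𝔭₁` -/
  e₁ : Module.Basis (Fin d₁) ℝ p₁
  /-- a basis of `𝔭₂` -/
  e₂ : Module.Basis (Fin d₂) ℝ p₂
  orthonormal_e₁ : ∀ i j, -(killingForm ℝ (LieAlg E G) (e₁ i) (e₁ j)) = b₁ * if i = j then 1 else 0
  orthonormal_e₂ : ∀ i j, -(killingForm ℝ (LieAlg E G) (e₂ i) (e₂ j)) = b₂ * if i = j then 1 else 0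

namespace TwoSummands

variable {E : Type*} [NormedAddCommGroup E] [NormedSpace ℝ E]
  {G : Type*} [TopologicalSpace G] [ChartedSpace E G] [Group G] [LieGroup 𝓘(ℝ, E) ∞ G]
  [CompleteSpace E]
  {EK : Type*} [NormedAddCommGroup EK] [NormedSpace ℝ EK]
  {EH : Type*} [NormedAddCommGroup EH] [NormedSpace ℝ EH]
  {K H : Subgroup G} [ChartedSpace EK K] [ChartedSpace EH H]
  (D : TwoSummands E EK EH K H)

/-- The `𝔨`-component in `𝔤 = 𝔨 ⊕ 𝔭₁ ⊕ 𝔭₂`. -/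
def prK : LieAlg E G →ₗ[ℝ] LieAlg E G := Submodule.projection _ _ D.isCompl_k

/-- The `𝔭₁`-component. -/
def pr₁ : LieAlg E G →ₗ[ℝ] LieAlg E G := Submodule.projection _ _ D.isCompl_p₁

/-- The `𝔭₂`-component. -/
def pr₂ : LieAlg E G →ₗ[ℝ] LieAlg E G := Submodule.projection _ _ D.isCompl_p₂

/-- The `𝔭`-component. -/
def prP (X : LieAlg E G) : LieAlg E G := D.pr₁ X + D.pr₂ X

/-- The background metric on `𝔭₁`, applied to the `𝔭₁`-components. -/
def Q₁ (X Y : LieAlg E G) : ℝ := -(killingForm ℝ (LieAlg E G) (D.pr₁ X) (D.pr₁ Y)) / D.b₁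

/-- The background metric on `𝔭₂`, applied to the `𝔭₂`-components. -/
def Q₂ (X Y : LieAlg E G) : ℝ := -(killingForm ℝ (LieAlg E G) (D.pr₂ X) (D.pr₂ Y)) / D.b₂

/-- The structure constant `[111]`. -/
def c111 : ℝ := ∑ i, ∑ j, ∑ k,
  D.Q₁ ⁅(D.e₁ i : LieAlg E G), (D.e₁ j : LieAlg E G)⁆ (D.e₁ k) ^ 2

/-- The structure constant `[122]`. -/
def c122 : ℝ := ∑ i, ∑ j, ∑ k,
  D.Q₂ ⁅(D.e₁ i : LieAlg E G), (D.e₂ j : LieAlg E G)⁆ (D.e₂ k) ^ 2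

/-- The constant `C = b₁ - [111] / (2 d₁) - [122] / d₁`. -/
def constC : ℝ := D.b₁ - D.c111 / (2 * D.d₁) - D.c122 / D.d₁

/-- The invariant metric `g = x₁ Q|𝔭₁ ⊕ x₂ Q|𝔭₂`, applied to the `𝔭`-components. -/
def metric (x₁ x₂ : ℝ) (X Y : LieAlg E G) : ℝ := x₁ * D.Q₁ X Y + x₂ * D.Q₂ X Y

/-- The `Q`-orthonormal basis `e₁ ∪ e₂` of `𝔭`. -/
def basis : Fin D.d₁ ⊕ Fin D.d₂ → LieAlg E G :=
  Sum.elim (fun i => (D.e₁ i : LieAlg E G)) (fun i => (D.e₂ i : LieAlg E G))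

/-- The squared length of the vectors of `basis` for the metric `(x₁, x₂)`; so the vectors
`basis a / √(weight a)` are a `g`-orthonormal basis of `𝔭`. -/
def weight (x₁ x₂ : ℝ) : Fin D.d₁ ⊕ Fin D.d₂ → ℝ :=
  Sum.elim (fun _ => x₁) (fun _ => x₂)

/-! #### Levi-Civita connection and curvature of the homogeneous metric

At the base point, with `T(G/K) = 𝔭`, the Levi-Civita connection of the invariant metric is the
linear map `Λ : 𝔭 → 𝔰𝔬(𝔭, g)` with `Λ(X)Y - Λ(Y)X = [X, Y]_𝔭`, and the curvature tensor is
`R(X, Y)Z = Λ(X)Λ(Y)Z - Λ(Y)Λ(X)Z - Λ([X, Y]_𝔭)Z - [[X, Y]_𝔨, Z]`. -/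

/-- The Koszul formula for `g(Λ(X)Y, Z)`. -/
def koszul (x₁ x₂ : ℝ) (X Y Z : LieAlg E G) : ℝ :=
  (D.metric x₁ x₂ ⁅X, Y⁆ Z + D.metric x₁ x₂ ⁅Z, X⁆ Y + D.metric x₁ x₂ X ⁅Z, Y⁆) / 2

/-- `Λ(X)Y`, expanded in the `g`-orthonormal basis. -/
def nabla (x₁ x₂ : ℝ) (X Y : LieAlg E G) : LieAlg E G :=
  ∑ a, (D.koszul x₁ x₂ X Y (D.basis a) / D.weight x₁ x₂ a) • D.basis a

/-- The curvature operator `R(X, Y)Z`. -/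
def curv (x₁ x₂ : ℝ) (X Y Z : LieAlg E G) : LieAlg E G :=
  D.nabla x₁ x₂ X (D.nabla x₁ x₂ Y Z) - D.nabla x₁ x₂ Y (D.nabla x₁ x₂ X Z)
    - D.nabla x₁ x₂ (D.prP ⁅X, Y⁆) Z - ⁅D.prK ⁅X, Y⁆, Z⁆

/-- The Ricci tensor `Ric(X, Y) = tr (Z ↦ R(Z, X)Y)`. -/
def ric (x₁ x₂ : ℝ) (X Y : LieAlg E G) : ℝ :=
  ∑ a, D.metric x₁ x₂ (D.curv x₁ x₂ (D.basis a) X Y) (D.basis a) / D.weight x₁ x₂ a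

/-- The norm `|Rm(g)|_g` of the curvature tensor; it is the same at all points of `G ⧸ K`, since
`G` acts transitively by isometries. -/
def rmNorm (x₁ x₂ : ℝ) : ℝ :=
  √(∑ a, ∑ b, ∑ c, ∑ d,
    D.metric x₁ x₂ (D.curv x₁ x₂ (D.basis a) (D.basis b) (D.basis c)) (D.basis d) ^ 2 /
      (D.weight x₁ x₂ a * D.weight x₁ x₂ b * D.weight x₁ x₂ c * D.weight x₁ x₂ d))

/-- The invariant metric `(x₁, x₂)` is Einstein. -/
def IsEinstein (x₁ x₂ : ℝ) : Prop :=
  ∃ c : ℝ, ∀ X ∈ D.p₁ ⊔ D.p₂, ∀ Y ∈ D.p₁ ⊔ D.p₂,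
    D.ric x₁ x₂ X Y = c * D.metric x₁ x₂ X Y

/-! #### The homogeneous Ricci flow -/

/-- `g(t) = (x₁ t, x₂ t)` is a family of Riemannian metrics with `∂g/∂t = -2 Ric(g)` for `t` in the
interval `J` (with one-sided derivatives at the end points that belong to `J`). -/
def IsRicciFlowOn (x₁ x₂ : ℝ → ℝ) (J : Set ℝ) : Prop :=
  ∀ t ∈ J, 0 < x₁ t ∧ 0 < x₂ t ∧
    ∀ X ∈ D.p₁ ⊔ D.p₂, ∀ Y ∈ D.p₁ ⊔ D.p₂,
      HasDerivWithinAt (fun s => D.metric (x₁ s) (x₂ s) X Y)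
        (-2 * D.ric (x₁ t) (x₂ t) X Y) J t

/-- Among the Ricci flows on intervals in the time range `S` (all times, or `t ≥ 0`) whose metric
at time `0` is `(a₁, a₂)`, the flow `(x₁, x₂)` on `J` is the unique maximal one. -/
structure IsUniqueMaximalFlow (S : Set ℝ) (a₁ a₂ : ℝ) (x₁ x₂ : ℝ → ℝ) (J : Set ℝ) : Prop where
  subset : J ⊆ S
  ordConnected : J.OrdConnected
  zero_mem : (0 : ℝ) ∈ J
  flow : D.IsRicciFlowOn x₁ x₂ J
  initial₁ : x₁ 0 = a₁
  initial₂ : x₂ 0 = a₂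
  unique : ∀ (z₁ z₂ : ℝ → ℝ) (J' : Set ℝ), J' ⊆ S → J'.OrdConnected → (0 : ℝ) ∈ J' →
    D.IsRicciFlowOn z₁ z₂ J' → z₁ 0 = a₁ → z₂ 0 = a₂ →
      J' ⊆ J ∧ EqOn z₁ x₁ J' ∧ EqOn z₂ x₂ J'

/-- The norm of the curvature tensor is unbounded as `t → T` from below. -/
def CurvatureUnbounded (x₁ x₂ : ℝ → ℝ) (T : ℝ) : Prop :=
  ∀ M : ℝ, ∃ᶠ t in 𝓝[<] T, M < D.rmNorm (x₁ t) (x₂ t)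

/-- The type I condition for an ancient solution: `lim_{t → -∞} |t| sup |Rm(g(t))|` is finite. -/
def IsTypeIAncient (x₁ x₂ : ℝ → ℝ) : Prop :=
  ∃ L : ℝ, Tendsto (fun t => |t| * D.rmNorm (x₁ t) (x₂ t)) atBot (𝓝 L)

/-! #### Distances on total space, base and fibre -/

/-- The Riemannian distance of `G ⧸ K` with the metric `x₁ Q|𝔭₁ ⊕ x₂ Q|𝔭₂`. -/
def totalDist (x₁ x₂ : ℝ) : G ⧸ K → G ⧸ K → ℝ :=
  cosetDist E K (fun X => √(D.metric x₁ x₂ X X))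

/-- The Riemannian distance of `G ⧸ H` with the metric `x₂ Q|𝔭₂`. -/
def baseDist (x₂ : ℝ) : G ⧸ H → G ⧸ H → ℝ :=
  cosetDist E H (fun X => √(x₂ * D.Q₂ X X))

/-- The Riemannian distance of `H ⧸ K` with the metric `x₁ Q|𝔭₁`. -/
def fibreDist (x₁ : ℝ) : H ⧸ K.subgroupOf H → H ⧸ K.subgroupOf H → ℝ :=
  cosetDist EH (K.subgroupOf H)
    (fun X : LieAlg EH H => √(x₁ * D.Q₁ (inclDeriv E EH H X) (inclDeriv E EH H X)))

end TwoSummands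

end HomogeneousRicci

end

/-! By Schur's lemma and the subalgebra `𝔥`, the Ricci tensor is diagonal. With `y = x₁/x₂` it
equals `(α + β y²) Q` on `𝔭₁` and `(γ - δ y) Q` on `𝔭₂`, where `β, δ > 0` because `[122] > 0`, and
`α = C/2 > 0` (`exists_ric_eq`). The Einstein ratios are the positive roots of `(β+δ) y² - γ y + α`.
The product of the roots is `α/(β+δ) > 0`, so a single positive root `r` must be double: `α = (β+δ)
r²` and `γ = 2(β+δ) r` (`exists_ric_eq_of_einstein`). Consequently `y' = -2(β+δ)(y - r)²/x₂`.

This system can be integrated. The parameter `u = 1/(r - y)` satisfies `u' = -2(β+δ)/x₂` and `dx₂/du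
= x₂ (μ + ν/u)`, with `ν = δ/(β+δ)` and `μ = (2β+δ) r/(β+δ)`. So `x₂ = c |u|^ν exp(μ u)`, and time
is a decreasing affine function of the primitive `F` of `|u|^ν exp(μ u)`. Below the Einstein ratio
one has `u > 1/r`. Forwards, `u` reaches `1/r` in finite time; there `x₁ = (r - 1/u) x₂` vanishes
and `x₂` does not. Backwards, `F` is unbounded at `+∞`, so the flow is ancient and `y → r`. Above
the Einstein ratio `u` is negative and decreases to `-∞`, where the profile decays exponentially and
`F` is bounded below; hence the time is finite, both functions tend to `0` and again `y → r`. No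
solution with `y(0) > r` is ancient: in the past `x₂` would stay bounded, so `1/(y - r)`, which is
positive, would decrease backwards at a rate bounded away from zero (`IsReducedFlow.not_ancient`).

Curvature: `α ≤ Ric(e, e) ≤ (d₁ + d₂) |Rm| x₁` for the unit vectors `e` of `𝔭₁`, so `x₁ → 0` forces
blow-up. By scaling `|Rm|` is `1/x₂` times a continuous function of `y`; as `x₂` grows linearly at
`-∞`, the ancient solution is of type I.

The Ricci formula rests on the `ad`-invariance of `-B`: in a basis diagonalizing the metric, the
Koszul formula is a multiple of one structure constant (`IsEigen.koszul`, `ric_eq_sum`). The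
inclusions `[𝔨, 𝔭ᵢ] ⊆ 𝔭ᵢ` and `[𝔥, 𝔥] ⊆ 𝔥` come from invariance under the groups, by differentiating
`Ad` along curves in the chart at the identity (`tendsto_slope_conj`).

For the Hausdorff-Gromov limits, distances are infima of lengths of curves in `G`. Fibres have
diameter `O(√x₁)`. The projection to the base is Lipschitz with constant tending to `1`; conversely,
a nearly minimal curve for the base has length in the total space exceeding its base length by an
error that tends to `0`, and compactness of `G` makes the estimate uniform
(`eventually_toCosetEDist_total_le`). -/

noncomputable section

namespace HomogeneousRicci

/-! ### The reduced flow of two functions -/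

/-- A positive solution of the system to which the homogeneous Ricci flow reduces when the
ratio `x₁ / x₂ = r` is the only Einstein one. -/
def IsReducedFlow (β δ r : ℝ) (x₁ x₂ : ℝ → ℝ) (J : Set ℝ) : Prop :=
  ∀ t ∈ J, 0 < x₁ t ∧ 0 < x₂ t ∧
    HasDerivWithinAt x₁ (-2 * ((β + δ) * r ^ 2 + β * (x₁ t / x₂ t) ^ 2)) J t ∧
    HasDerivWithinAt x₂ (-2 * (2 * (β + δ) * r - δ * (x₁ t / x₂ t))) J t

/-- The profile `|s|^ν exp (μ s)` of the second function, in the parameter `1 / (r - x₁ / x₂)`. -/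
def profile (ν μ s : ℝ) : ℝ := |s| ^ ν * Real.exp (μ * s)

/-- The primitive of `profile`, an affine function of the time. -/
def profilePrim (ν μ u : ℝ) : ℝ := ∫ s in (0 : ℝ)..u, profile ν μ s

/-! ### The profile, its primitive, and the inverse of the primitive. -/

section Profile

variable {ν μ : ℝ}

lemma continuous_profile (hν : 0 < ν) : Continuous (profile ν μ) := by
  unfold profile
  exact (continuous_abs.rpow_const fun _ => Or.inr hν.le).mul (by fun_prop)

lemma profile_nonneg (s : ℝ) : 0 ≤ profile ν μ s := by
  unfold profile; positivity

lemma profile_pos {s : ℝ} (hs : s ≠ 0) : 0 < profile ν μ s :=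
  mul_pos (Real.rpow_pos_of_pos (abs_pos.2 hs) _) (Real.exp_pos _)

/-- `Real.log` is even, so one formula serves both signs of `s`, and one derivative serves initial
ratios on both sides of the Einstein one. -/
lemma profile_eq_exp {s : ℝ} (hs : s ≠ 0) : profile ν μ s = Real.exp (ν * Real.log s + μ * s) := by
  rw [profile, Real.rpow_def_of_pos (abs_pos.2 hs), Real.log_abs, Real.exp_add, mul_comm ν]

lemma hasDerivAt_profile {s : ℝ} (hs : s ≠ 0) :
    HasDerivAt (profile ν μ) (profile ν μ s * (μ + ν / s)) s := by
  have h : HasDerivAt (fun s => Real.exp (ν * Real.log s + μ * s))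
      (Real.exp (ν * Real.log s + μ * s) * (ν * s⁻¹ + μ * 1)) s :=
    (((Real.hasDerivAt_log hs).const_mul ν).add ((hasDerivAt_id s).const_mul μ)).exp
  rw [profile_eq_exp hs]
  refine (h.congr_deriv (by ring)).congr_of_eventuallyEq ?_
  filter_upwards [isOpen_ne.mem_nhds hs] with u hu using profile_eq_exp hu

lemma hasDerivAt_profilePrim (hν : 0 < ν) (u : ℝ) :
    HasDerivAt (profilePrim ν μ) (profile ν μ u) u :=
  intervalIntegral.integral_hasDerivAt_right ((continuous_profile hν).intervalIntegrable _ _)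
    ((continuous_profile hν).stronglyMeasurableAtFilter _ _) (continuous_profile hν).continuousAt

lemma continuous_profilePrim (hν : 0 < ν) : Continuous (profilePrim ν μ) :=
  continuous_iff_continuousAt.2 fun u => (hasDerivAt_profilePrim hν u).continuousAt

lemma strictMono_profilePrim (hν : 0 < ν) : StrictMono (profilePrim ν μ) := by
  intro a b hab
  have hi := fun a b => (continuous_profile (μ := μ) hν).intervalIntegrable (μ := MeasureTheory.volume) a b
  have h : profilePrim ν μ b - profilePrim ν μ a = ∫ s in a..b, profile ν μ s :=
    intervalIntegral.integral_interval_sub_left (hi _ _) (hi _ _)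
  have : 0 < ∫ s in a..b, profile ν μ s := by
    refine intervalIntegral.integral_pos hab (continuous_profile hν).continuousOn
      (fun x _ => profile_nonneg x) ?_
    -- The profile vanishes only at `0`, so at least one end point of the interval carries a
    -- positive value.
    by_cases ha : a = 0
    · exact ⟨b, ⟨hab.le, le_rfl⟩, profile_pos (by linarith)⟩
    · exact ⟨a, ⟨le_rfl, hab.le⟩, profile_pos ha⟩
  linarith

lemma ordConnected_range_profilePrim (hν : 0 < ν) : (range (profilePrim ν μ)).OrdConnected :=
  (isPreconnected_range (continuous_profilePrim hν)).ordConnected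

/-- A continuous strictly increasing function on the line is a homeomorphism onto an open interval.
This gives continuity of the inverse at every value, including the one where the derivative of the
primitive vanishes. -/
lemma isOpenEmbedding_profilePrim (hν : 0 < ν) : IsOpenEmbedding (profilePrim ν μ) := by
  refine ⟨(strictMono_profilePrim hν).isEmbedding_of_ordConnected
    (ordConnected_range_profilePrim hν), isOpen_iff_mem_nhds.2 ?_⟩
  rintro _ ⟨u, rfl⟩
  refine mem_of_superset (Icc_mem_nhds (strictMono_profilePrim hν (sub_one_lt u))
    (strictMono_profilePrim hν (lt_add_one u))) ?_
  exact (ordConnected_range_profilePrim hν).out ⟨_, rfl⟩ ⟨_, rfl⟩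

/-- The inverse of `profilePrim`. -/
def profileInv (ν μ : ℝ) : ℝ → ℝ := Function.invFun (profilePrim ν μ)

lemma profileInv_profilePrim (hν : 0 < ν) (u : ℝ) : profileInv ν μ (profilePrim ν μ u) = u :=
  Function.leftInverse_invFun (strictMono_profilePrim hν).injective u

lemma continuousAt_profileInv (hν : 0 < ν) (u : ℝ) :
    ContinuousAt (profileInv ν μ) (profilePrim ν μ u) := by
  rw [← (isOpenEmbedding_profilePrim hν).continuousAt_iff]
  exact continuousAt_id.congr (Eventually.of_forall fun u => (profileInv_profilePrim hν u).symm)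

lemma hasDerivAt_profileInv (hν : 0 < ν) {u : ℝ} (hu : u ≠ 0) :
    HasDerivAt (profileInv ν μ) (profile ν μ u)⁻¹ (profilePrim ν μ u) := by
  refine HasDerivAt.of_local_left_inverse (f := profilePrim ν μ) (continuousAt_profileInv hν u) ?_
    (profile_pos hu).ne' ?_
  · rw [profileInv_profilePrim hν]; exact hasDerivAt_profilePrim hν u
  · filter_upwards [(isOpenEmbedding_profilePrim (μ := μ) hν).isOpen_range.mem_nhds ⟨u, rfl⟩]
    rintro _ ⟨v, rfl⟩
    rw [profileInv_profilePrim hν]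

/-- The profile is at least `1` on `[1, ∞)`. This is why flows starting below the Einstein ratio
exist for all negative times. -/
lemma tendsto_profilePrim_atTop (hν : 0 < ν) (hμ : 0 < μ) :
    Tendsto (profilePrim ν μ) atTop atTop := by
  have h : Tendsto (fun u : ℝ => profilePrim ν μ 1 + (u - 1)) atTop atTop :=
    tendsto_atTop_add_const_left _ _ (tendsto_atTop_add_const_right _ _ tendsto_id)
  refine tendsto_atTop_mono' _ ?_ h
  filter_upwards [eventually_ge_atTop 1] with u hu
  have hi := fun a b => (continuous_profile (μ := μ) hν).intervalIntegrable (μ := MeasureTheory.volume) a b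
  have h : profilePrim ν μ u - profilePrim ν μ 1 = ∫ s in (1 : ℝ)..u, profile ν μ s :=
    intervalIntegral.integral_interval_sub_left (hi _ _) (hi _ _)
  have h1 : ∫ s in (1 : ℝ)..u, (1 : ℝ) ≤ ∫ s in (1 : ℝ)..u, profile ν μ s := by
    refine intervalIntegral.integral_mono_on hu (by simp) (hi _ _) fun s hs => ?_
    have h1 : (1 : ℝ) ≤ |s| ^ ν :=
      Real.one_le_rpow (by rw [abs_of_nonneg (by linarith [hs.1])]; exact hs.1) hν.le
    have h2 : (1 : ℝ) ≤ Real.exp (μ * s) := Real.one_le_exp (by nlinarith [hs.1])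
    unfold profile
    nlinarith
  simp only [intervalIntegral.integral_const, smul_eq_mul, mul_one] at h1
  linarith

lemma tendsto_profile_atBot (hμ : 0 < μ) : Tendsto (profile ν μ) atBot (𝓝 0) := by
  have h := (tendsto_rpow_mul_exp_neg_mul_atTop_nhds_zero ν μ hμ).comp tendsto_neg_atBot_atTop
  refine h.congr' ?_
  filter_upwards [eventually_lt_atBot 0] with s hs
  simp [profile, abs_of_neg hs]

end Profile

/-! ### Explicit solutions of the reduced flow. -/

section Flow

variable {β δ r : ℝ}

/-- The exponent of `profile` for the reduced flow. -/
def flowExp (β δ : ℝ) : ℝ := δ / (β + δ)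

/-- The rate of `profile` for the reduced flow. -/
def flowRate (β δ r : ℝ) : ℝ := (2 * β + δ) * r / (β + δ)

/-- The time dependence of the parameter `1 / (r - x₁ / x₂)` of the reduced flow. -/
def flowParam (β δ r c u₀ t : ℝ) : ℝ :=
  profileInv (flowExp β δ) (flowRate β δ r)
    (profilePrim (flowExp β δ) (flowRate β δ r) u₀ - 2 * (β + δ) / c * t)

/-- The second function of the reduced flow. -/
def flowSnd (β δ r c u₀ t : ℝ) : ℝ :=
  c * profile (flowExp β δ) (flowRate β δ r) (flowParam β δ r c u₀ t)

/-- The first function of the reduced flow. -/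
def flowFst (β δ r c u₀ t : ℝ) : ℝ :=
  (r - (flowParam β δ r c u₀ t)⁻¹) * flowSnd β δ r c u₀ t

lemma flowExp_pos (hβ : 0 < β) (hδ : 0 < δ) : 0 < flowExp β δ := by unfold flowExp; positivity

lemma flowRate_pos (hβ : 0 < β) (hδ : 0 < δ) (hr : 0 < r) : 0 < flowRate β δ r := by
  unfold flowRate; positivity

variable {c u₀ t v : ℝ}

/-- The value of `flowParam` is meaningful only when its argument lies in the range of the
primitive; the explicit preimage `v` records this here and in the lemmas that follow. -/
lemma flowParam_eq (hβ : 0 < β) (hδ : 0 < δ)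
    (h : profilePrim (flowExp β δ) (flowRate β δ r) v =
      profilePrim (flowExp β δ) (flowRate β δ r) u₀ - 2 * (β + δ) / c * t) :
    flowParam β δ r c u₀ t = v := by
  rw [flowParam, ← h, profileInv_profilePrim (flowExp_pos hβ hδ)]

lemma continuousAt_flowParam (hβ : 0 < β) (hδ : 0 < δ)
    (h : profilePrim (flowExp β δ) (flowRate β δ r) v =
      profilePrim (flowExp β δ) (flowRate β δ r) u₀ - 2 * (β + δ) / c * t) :
    ContinuousAt (flowParam β δ r c u₀) t := by
  have h1 := continuousAt_profileInv (μ := flowRate β δ r) (flowExp_pos hβ hδ) v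
  rw [h] at h1
  exact ContinuousAt.comp (f := fun t => profilePrim (flowExp β δ) (flowRate β δ r) u₀ -
    2 * (β + δ) / c * t) h1 (by fun_prop)

lemma hasDerivAt_flowParam (hβ : 0 < β) (hδ : 0 < δ) (hv : v ≠ 0)
    (h : profilePrim (flowExp β δ) (flowRate β δ r) v =
      profilePrim (flowExp β δ) (flowRate β δ r) u₀ - 2 * (β + δ) / c * t) :
    HasDerivAt (flowParam β δ r c u₀)
      ((profile (flowExp β δ) (flowRate β δ r) v)⁻¹ * -(2 * (β + δ) / c)) t := by
  have h1 := hasDerivAt_profileInv (μ := flowRate β δ r) (flowExp_pos hβ hδ) hv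
  rw [h] at h1
  have h2 : HasDerivAt (fun t => profilePrim (flowExp β δ) (flowRate β δ r) u₀ -
      2 * (β + δ) / c * t) (-(2 * (β + δ) / c)) t := by
    simpa using ((hasDerivAt_id t).const_mul (2 * (β + δ) / c)).const_sub _
  exact h1.comp t h2

/-- The ratio of the two functions is `r - v⁻¹`, so `v⁻¹ < r` is positivity of the first one. The
equations are the chain rule for `du/dt = -2(β+δ)/x₂` and `dx₂/du = x₂ (μ + ν/u)`. -/
lemma flow_hasDerivAt (hβ : 0 < β) (hδ : 0 < δ) (hc : 0 < c) (hv : v ≠ 0) (hv' : v⁻¹ < r)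
    (h : profilePrim (flowExp β δ) (flowRate β δ r) v =
      profilePrim (flowExp β δ) (flowRate β δ r) u₀ - 2 * (β + δ) / c * t) :
    0 < flowFst β δ r c u₀ t ∧ 0 < flowSnd β δ r c u₀ t ∧
    HasDerivAt (flowFst β δ r c u₀) (-2 * ((β + δ) * r ^ 2 +
      β * (flowFst β δ r c u₀ t / flowSnd β δ r c u₀ t) ^ 2)) t ∧
    HasDerivAt (flowSnd β δ r c u₀) (-2 * (2 * (β + δ) * r -
      δ * (flowFst β δ r c u₀ t / flowSnd β δ r c u₀ t))) t := by
  have hu := hasDerivAt_flowParam hβ hδ hv h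
  have huv := flowParam_eq hβ hδ h
  have hp := profile_pos (ν := flowExp β δ) (μ := flowRate β δ r) hv
  have hκ : 0 < β + δ := by positivity
  have h2 : 0 < flowSnd β δ r c u₀ t := by rw [flowSnd, huv]; positivity
  have h1 : 0 < flowFst β δ r c u₀ t := by
    rw [flowFst, huv]; exact mul_pos (by linarith) h2
  have hq : flowFst β δ r c u₀ t / flowSnd β δ r c u₀ t = r - v⁻¹ := by
    rw [flowFst, huv]; field_simp
  have hd2 : HasDerivAt (flowSnd β δ r c u₀) (-2 * (2 * (β + δ) * r - δ * (r - v⁻¹))) t := by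
    have hp' := hasDerivAt_profile (ν := flowExp β δ) (μ := flowRate β δ r) hv
    rw [← huv] at hp'
    have := (hp'.comp t hu).const_mul c
    refine this.congr_deriv ?_
    rw [huv]
    generalize profile (flowExp β δ) (flowRate β δ r) v = q at hp
    rw [flowRate, flowExp]
    field_simp
    ring
  refine ⟨h1, h2, ?_, hq ▸ hd2⟩
  rw [hq]
  have := ((hu.inv (by rwa [huv])).const_sub r).mul hd2
  refine this.congr_deriv ?_
  rw [Pi.inv_apply, huv, flowSnd, huv]
  field_simp
  ring

/-- The two integration constants: `u₀` is fixed by the initial ratio, and then `c` by the initial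
value of the second function. -/
lemma flow_zero (hβ : 0 < β) (hδ : 0 < δ) {a₁ a₂ : ℝ} (ha₂ : 0 < a₂) (h : r - a₁ / a₂ ≠ 0) :
    flowFst β δ r (a₂ / profile (flowExp β δ) (flowRate β δ r) (r - a₁ / a₂)⁻¹)
      (r - a₁ / a₂)⁻¹ 0 = a₁ ∧
    flowSnd β δ r (a₂ / profile (flowExp β δ) (flowRate β δ r) (r - a₁ / a₂)⁻¹)
      (r - a₁ / a₂)⁻¹ 0 = a₂ := by
  set u₀ := (r - a₁ / a₂)⁻¹
  set c := a₂ / profile (flowExp β δ) (flowRate β δ r) u₀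
  have huv : flowParam β δ r c u₀ 0 = u₀ := flowParam_eq hβ hδ (by simp)
  have hp := profile_pos (ν := flowExp β δ) (μ := flowRate β δ r) (inv_ne_zero h)
  have h2 : flowSnd β δ r c u₀ 0 = a₂ := by
    rw [flowSnd, huv]; exact div_mul_cancel₀ _ hp.ne'
  refine ⟨?_, h2⟩
  rw [flowFst, huv, h2]
  simp only [u₀, inv_inv]
  field_simp
  ring

/-- A reduced flow which starts below the Einstein ratio. -/
theorem exists_reducedFlow_of_lt (hβ : 0 < β) (hδ : 0 < δ) (hr : 0 < r) {a₁ a₂ : ℝ}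
    (ha₁ : 0 < a₁) (ha₂ : 0 < a₂) (h : a₁ / a₂ < r) :
    ∃ T : ℝ, 0 < T ∧ ∃ x₁ x₂ : ℝ → ℝ, IsReducedFlow β δ r x₁ x₂ (Iio T) ∧ x₁ 0 = a₁ ∧ x₂ 0 = a₂ ∧
      Tendsto x₁ (𝓝[<] T) (𝓝 0) ∧ (∃ l : ℝ, 0 < l ∧ Tendsto x₂ (𝓝[<] T) (𝓝 l)) ∧
      Tendsto (fun t => x₁ t / x₂ t) atBot (𝓝 r) := by
  have hν := flowExp_pos hβ hδ
  have hμ := flowRate_pos hβ hδ hr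
  have hy : 0 < r - a₁ / a₂ := sub_pos.2 h
  have h0 := flow_zero (r := r) hβ hδ ha₂ hy.ne'
  set u₀ := (r - a₁ / a₂)⁻¹
  set c := a₂ / profile (flowExp β δ) (flowRate β δ r) u₀
  have hc : 0 < c := div_pos ha₂ (profile_pos (inv_ne_zero hy.ne'))
  have hu₀ : r⁻¹ < u₀ := (inv_lt_inv₀ hr hy).2 (by linarith [div_pos ha₁ ha₂])
  set F := profilePrim (flowExp β δ) (flowRate β δ r) with hF
  have hFm : StrictMono F := strictMono_profilePrim hν
  have hκ : 0 < β + δ := by positivity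
  -- The time at which the parameter has come down to `r⁻¹`, that is, at which the ratio `r - 1/u`
  -- is zero.
  set T := (F u₀ - F r⁻¹) * c / (2 * (β + δ)) with hT
  have hT0 : 0 < T := by
    have := sub_pos.2 (hFm hu₀)
    positivity
  have hTe : F r⁻¹ = F u₀ - 2 * (β + δ) / c * T := by rw [hT]; field_simp; ring
  -- No lower bound on `t` is needed because `F` tends to `+∞`.
  have hex : ∀ t ≤ T, ∃ v, F v = F u₀ - 2 * (β + δ) / c * t := fun t ht => by
    have h1 : 2 * (β + δ) / c * t ≤ 2 * (β + δ) / c * T := by gcongr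
    refine mem_range_of_exists_le_of_exists_ge (continuous_profilePrim hν)
      ⟨r⁻¹, by change F _ ≤ _; linarith⟩ ?_
    exact ((tendsto_profilePrim_atTop hν hμ).eventually_ge_atTop _).exists
  have hval : ∀ t < T, ∃ v, F v = F u₀ - 2 * (β + δ) / c * t ∧ r⁻¹ < v := fun t ht => by
    obtain ⟨v, hv⟩ := hex t ht.le
    have h1 : 2 * (β + δ) / c * t < 2 * (β + δ) / c * T := by gcongr
    exact ⟨v, hv, hFm.lt_iff_lt.1 (by linarith)⟩
  have hflow : ∀ t < T, 0 < flowFst β δ r c u₀ t ∧ 0 < flowSnd β δ r c u₀ t ∧ _ ∧ _ := fun t ht => by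
    obtain ⟨v, hv, hvr⟩ := hval t ht
    have hv0 : 0 < v := (inv_pos.2 hr).trans hvr
    exact flow_hasDerivAt hβ hδ hc hv0.ne' ((inv_lt_comm₀ hr hv0).1 hvr) hv
  -- The formulas remain continuous at `T`, where the parameter is `r⁻¹ ≠ 0`; the one-sided limits
  -- are therefore the values at `T`.
  have hparam := continuousAt_flowParam hβ hδ hTe
  have hparamT := flowParam_eq hβ hδ hTe
  have hsnd : ContinuousAt (flowSnd β δ r c u₀) T :=
    continuousAt_const.mul ((continuous_profile hν).continuousAt.comp hparam)
  have hfst : ContinuousAt (flowFst β δ r c u₀) T :=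
    (continuousAt_const.sub (hparam.inv₀ (by rw [hparamT]; positivity))).mul hsnd
  refine ⟨T, hT0, flowFst β δ r c u₀, flowSnd β δ r c u₀, fun t ht => ?_, h0.1, h0.2, ?_, ?_, ?_⟩
  · obtain ⟨h1, h2, h3, h4⟩ := hflow t ht
    exact ⟨h1, h2, h3.hasDerivWithinAt, h4.hasDerivWithinAt⟩
  · have h1 : flowFst β δ r c u₀ T = 0 := by simp [flowFst, hparamT]
    exact h1 ▸ hfst.tendsto.mono_left nhdsWithin_le_nhds
  · refine ⟨flowSnd β δ r c u₀ T, ?_, hsnd.tendsto.mono_left nhdsWithin_le_nhds⟩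
    rw [flowSnd, hparamT]
    exact mul_pos hc (profile_pos (inv_ne_zero hr.ne'))
  · have hlim : Tendsto (flowParam β δ r c u₀) atBot atTop := by
      refine tendsto_atTop.2 fun M => ?_
      filter_upwards [eventually_lt_atBot T,
        eventually_le_atBot ((F u₀ - F M) * c / (2 * (β + δ)))] with t ht htM
      obtain ⟨v, hv, -⟩ := hval t ht
      rw [flowParam_eq hβ hδ hv, ← hFm.le_iff_le, hv]
      have h1 : 2 * (β + δ) / c * t ≤ 2 * (β + δ) / c * ((F u₀ - F M) * c / (2 * (β + δ))) := by
        gcongr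
      have h2 : 2 * (β + δ) / c * ((F u₀ - F M) * c / (2 * (β + δ))) = F u₀ - F M := by field_simp
      linarith
    have h1 : Tendsto (fun t => r - (flowParam β δ r c u₀ t)⁻¹) atBot (𝓝 (r - 0)) :=
      tendsto_const_nhds.sub (tendsto_inv_atTop_zero.comp hlim)
    rw [sub_zero] at h1
    refine h1.congr' ?_
    filter_upwards [eventually_lt_atBot T] with t ht
    rw [flowFst, mul_div_assoc, div_self (hflow t ht).2.1.ne', mul_one]

/-- The first function decreases at least at the rate `2(β+δ) r²`, so it cannot stay positive for
long, and up to constants `F` measures the remaining time. In the parameter this compares `F` with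
`(r - 1/u) p(u)`, and no estimate of the integral is needed. -/
lemma bddBelow_range_profilePrim (hβ : 0 < β) (hδ : 0 < δ) (hr : 0 < r) :
    BddBelow (range (profilePrim (flowExp β δ) (flowRate β δ r))) := by
  have hν := flowExp_pos hβ hδ
  have hκ : 0 < β + δ := by positivity
  set F := profilePrim (flowExp β δ) (flowRate β δ r) with hF
  set p := profile (flowExp β δ) (flowRate β δ r) with hp
  -- The subtracted term is `x₁ / (c r²)`. Its derivative is the profile times `1 + β y² / ((β+δ)
  -- r²)`, which exceeds `F'`. The cut at `-1` only keeps `u` away from `0`.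
  have hanti : AntitoneOn (fun u => F u - (r - u⁻¹) * p u / r ^ 2) (Iic (-1)) := by
    have hd : ∀ u ∈ Iic (-1 : ℝ), HasDerivAt (fun u => F u - (r - u⁻¹) * p u / r ^ 2)
        (-(β * (r - u⁻¹) ^ 2 / (β + δ) * p u / r ^ 2)) u := fun u hu => by
      have hu0 : u ≠ 0 := by rintro rfl; norm_num at hu
      have h1 := (hasDerivAt_profilePrim (μ := flowRate β δ r) hν u).sub
        ((((hasDerivAt_inv hu0).const_sub r).mul
          (hasDerivAt_profile (ν := flowExp β δ) (μ := flowRate β δ r) hu0)).div_const (r ^ 2))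
      refine h1.congr_deriv ?_
      rw [← hp]
      generalize p u = q
      rw [flowRate, flowExp]
      field_simp
      ring
    refine antitoneOn_of_deriv_nonpos (convex_Iic _)
      (fun u hu => (hd u hu).continuousAt.continuousWithinAt)
      (fun u hu => (hd u (interior_subset hu)).differentiableAt.differentiableWithinAt)
      fun u hu => ?_
    rw [(hd u (interior_subset hu)).deriv]
    have : 0 ≤ p u := profile_nonneg u
    have : 0 ≤ β * (r - u⁻¹) ^ 2 / (β + δ) * p u / r ^ 2 := by positivity
    linarith
  refine ⟨F (-1) - (r - (-1)⁻¹) * p (-1) / r ^ 2, ?_⟩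
  rintro _ ⟨u, rfl⟩
  rcases le_total u (-1) with hu | hu
  · have h1 := hanti (a := u) hu (mem_Iic.2 le_rfl) hu
    have h2 : 0 ≤ (r - u⁻¹) * p u / r ^ 2 := by
      have : 0 ≤ p u := profile_nonneg u
      have : u⁻¹ ≤ 0 := inv_nonpos.2 (by linarith)
      have : 0 ≤ r - u⁻¹ := by linarith
      positivity
    simp only at h1
    linarith
  · have h1 : F (-1) ≤ F u := (strictMono_profilePrim hν).monotone hu
    have h2 : 0 ≤ (r - (-1)⁻¹) * p (-1) / r ^ 2 := by
      have : 0 ≤ p (-1) := profile_nonneg _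
      have : 0 ≤ r - (-1)⁻¹ := by norm_num; linarith
      positivity
    linarith

/-- A reduced flow which starts above the Einstein ratio. -/
theorem exists_reducedFlow_of_gt (hβ : 0 < β) (hδ : 0 < δ) (hr : 0 < r) {a₁ a₂ : ℝ}
    (ha₂ : 0 < a₂) (h : r < a₁ / a₂) :
    ∃ T : ℝ, 0 < T ∧ ∃ x₁ x₂ : ℝ → ℝ, IsReducedFlow β δ r x₁ x₂ (Ico 0 T) ∧ x₁ 0 = a₁ ∧
      x₂ 0 = a₂ ∧ Tendsto x₁ (𝓝[<] T) (𝓝 0) ∧ Tendsto x₂ (𝓝[<] T) (𝓝 0) ∧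
      Tendsto (fun t => x₁ t / x₂ t) (𝓝[<] T) (𝓝 r) := by
  have hν := flowExp_pos hβ hδ
  have hμ := flowRate_pos hβ hδ hr
  have hy : r - a₁ / a₂ < 0 := sub_neg.2 h
  have h0 := flow_zero (r := r) hβ hδ ha₂ hy.ne
  have hu₀ : (r - a₁ / a₂)⁻¹ < 0 := inv_lt_zero.2 hy
  set u₀ := (r - a₁ / a₂)⁻¹
  set c := a₂ / profile (flowExp β δ) (flowRate β δ r) u₀
  have hc : 0 < c := div_pos ha₂ (profile_pos hu₀.ne)
  set F := profilePrim (flowExp β δ) (flowRate β δ r) with hF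
  have hFm : StrictMono F := strictMono_profilePrim hν
  have hFb : BddBelow (range F) := bddBelow_range_profilePrim hβ hδ hr
  have hinf : ∀ u, ⨅ s, F s < F u := fun u =>
    (ciInf_le hFb (u - 1)).trans_lt (hFm (sub_one_lt u))
  have hκ : 0 < β + δ := by positivity
  -- The time needed to exhaust the range of `F` below `F u₀`. The infimum is not attained, so the
  -- parameter is defined for every earlier time and tends to `-∞` at `T`.
  set T := (F u₀ - ⨅ s, F s) * c / (2 * (β + δ)) with hT
  have hT0 : 0 < T := by
    have := sub_pos.2 (hinf u₀)
    positivity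
  have hTe : ⨅ s, F s = F u₀ - 2 * (β + δ) / c * T := by rw [hT]; field_simp; ring
  have hval : ∀ t, 0 ≤ t → t < T → ∃ v, F v = F u₀ - 2 * (β + δ) / c * t ∧ v < 0 :=
    fun t ht0 ht => by
      have h1 : 2 * (β + δ) / c * t < 2 * (β + δ) / c * T := by gcongr
      have h2 : 0 ≤ 2 * (β + δ) / c * t := by positivity
      obtain ⟨a, ha⟩ := exists_lt_of_ciInf_lt
        (show ⨅ s, F s < F u₀ - 2 * (β + δ) / c * t by linarith)
      obtain ⟨v, hv⟩ := mem_range_of_exists_le_of_exists_ge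
        (c := F u₀ - 2 * (β + δ) / c * t) (continuous_profilePrim hν)
        ⟨a, ha.le⟩ ⟨u₀, by change _ ≤ F u₀; linarith⟩
      exact ⟨v, hv, lt_of_le_of_lt (hFm.le_iff_le.1 (by change F v = _ at hv; linarith)) hu₀⟩
  have hflow : ∀ t, 0 ≤ t → t < T →
      0 < flowFst β δ r c u₀ t ∧ 0 < flowSnd β δ r c u₀ t ∧ _ ∧ _ := fun t ht0 ht => by
    obtain ⟨v, hv, hvr⟩ := hval t ht0 ht
    exact flow_hasDerivAt hβ hδ hc hvr.ne ((inv_lt_zero.2 hvr).trans hr) hv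
  have hnear : ∀ᶠ t in 𝓝[<] T, 0 ≤ t ∧ t < T := by
    filter_upwards [Ioo_mem_nhdsLT hT0] with t ht using ⟨ht.1.le, ht.2⟩
  have hlim : Tendsto (flowParam β δ r c u₀) (𝓝[<] T) atBot := by
    refine tendsto_atBot.2 fun M => ?_
    have hM : (F u₀ - F M) * c / (2 * (β + δ)) < T := by
      rw [hT]
      have := hinf M
      gcongr
    filter_upwards [hnear, Ioo_mem_nhdsLT hM] with t ht htM
    obtain ⟨v, hv, -⟩ := hval t ht.1 ht.2
    rw [flowParam_eq hβ hδ hv, ← hFm.le_iff_le, hv]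
    have h1 : 2 * (β + δ) / c * ((F u₀ - F M) * c / (2 * (β + δ))) ≤ 2 * (β + δ) / c * t := by
      have := htM.1.le
      gcongr
    have h2 : 2 * (β + δ) / c * ((F u₀ - F M) * c / (2 * (β + δ))) = F u₀ - F M := by field_simp
    linarith
  have hinv : Tendsto (fun t => r - (flowParam β δ r c u₀ t)⁻¹) (𝓝[<] T) (𝓝 r) := by
    simpa using (tendsto_const_nhds (x := r)).sub (tendsto_inv_atBot_zero.comp hlim)
  have hsnd : Tendsto (flowSnd β δ r c u₀) (𝓝[<] T) (𝓝 0) := by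
    have h1 := ((tendsto_profile_atBot (ν := flowExp β δ) hμ).comp hlim).const_mul c
    rwa [mul_zero] at h1
  refine ⟨T, hT0, flowFst β δ r c u₀, flowSnd β δ r c u₀, fun t ht => ?_, h0.1, h0.2, ?_, hsnd, ?_⟩
  · obtain ⟨h1, h2, h3, h4⟩ := hflow t ht.1 ht.2
    exact ⟨h1, h2, h3.hasDerivWithinAt, h4.hasDerivWithinAt⟩
  · have h1 := hinv.mul hsnd
    rwa [mul_zero] at h1
  · refine hinv.congr' ?_
    filter_upwards [hnear] with t ht
    rw [flowFst, mul_div_assoc, div_self (hflow t ht.1 ht.2).2.1.ne', mul_one]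

end Flow

/-! ### Uniqueness and maximality of reduced flows. -/

section Uniqueness

variable {β δ r : ℝ} {x₁ x₂ z₁ z₂ : ℝ → ℝ} {J J' : Set ℝ}

/-- The vector field of the reduced flow. -/
def reducedField (β δ r : ℝ) (p : ℝ × ℝ) : ℝ × ℝ :=
  (-2 * ((β + δ) * r ^ 2 + β * (p.1 / p.2) ^ 2), -2 * (2 * (β + δ) * r - δ * (p.1 / p.2)))

lemma IsReducedFlow.mono (h : IsReducedFlow β δ r x₁ x₂ J) (hJ : J' ⊆ J) :
    IsReducedFlow β δ r x₁ x₂ J' := fun t ht =>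
  let ⟨h1, h2, h3, h4⟩ := h t (hJ ht)
  ⟨h1, h2, h3.mono hJ, h4.mono hJ⟩

lemma IsReducedFlow.hasDerivWithinAt (h : IsReducedFlow β δ r x₁ x₂ J) {t : ℝ} (ht : t ∈ J) :
    HasDerivWithinAt (fun t => (x₁ t, x₂ t)) (reducedField β δ r (x₁ t, x₂ t)) J t :=
  (h t ht).2.2.1.prodMk (h t ht).2.2.2

lemma IsReducedFlow.continuousOn (h : IsReducedFlow β δ r x₁ x₂ J) :
    ContinuousOn (fun t => (x₁ t, x₂ t)) J :=
  fun _ ht => (h.hasDerivWithinAt ht).continuousWithinAt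

/-- The field is smooth where the second coordinate is nonzero, and local Lipschitz bounds on a
compact set combine into a global one without convexity. So `S` may be a union of two trajectories.
-/
lemma exists_lipschitzOnWith_reducedField {S : Set (ℝ × ℝ)} (hS : IsCompact S)
    (h : ∀ p ∈ S, 0 < p.2) : ∃ L, LipschitzOnWith L (reducedField β δ r) S := by
  refine LocallyLipschitzOn.exists_lipschitzOnWith_of_compact hS fun p hp => ?_
  have hp2 := (h p hp).ne'
  have : ContDiffAt ℝ 1 (reducedField β δ r) p := by
    unfold reducedField
    have : ContDiffAt ℝ 1 (fun p : ℝ × ℝ => p.1 / p.2) p :=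
      contDiffAt_fst.div contDiffAt_snd hp2
    fun_prop
  obtain ⟨L, t, ht, hL⟩ := this.exists_lipschitzOnWith
  exact ⟨L, t, mem_nhdsWithin_of_mem_nhds ht, hL⟩

/-- Grönwall on the union of the two compact trajectories. The common time `c` may be either end
point, because flows have to be compared forwards and backwards from time `0`. -/
lemma IsReducedFlow.eqOn_Icc {a b c : ℝ} (hx : IsReducedFlow β δ r x₁ x₂ (Icc a b))
    (hz : IsReducedFlow β δ r z₁ z₂ (Icc a b)) (hc : c = a ∨ c = b)
    (h₁ : x₁ c = z₁ c) (h₂ : x₂ c = z₂ c) :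
    EqOn (fun t => (x₁ t, x₂ t)) (fun t => (z₁ t, z₂ t)) (Icc a b) := by
  set S := (fun t => (x₁ t, x₂ t)) '' Icc a b ∪ (fun t => (z₁ t, z₂ t)) '' Icc a b
  have hS : IsCompact S := (isCompact_Icc.image_of_continuousOn hx.continuousOn).union
    (isCompact_Icc.image_of_continuousOn hz.continuousOn)
  obtain ⟨L, hL⟩ := exists_lipschitzOnWith_reducedField (β := β) (δ := δ) (r := r) hS (by
    rintro _ (⟨t, ht, rfl⟩ | ⟨t, ht, rfl⟩)
    exacts [(hx t ht).2.1, (hz t ht).2.1])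
  have hxS : ∀ t ∈ Icc a b, (x₁ t, x₂ t) ∈ S := fun t ht => Or.inl ⟨t, ht, rfl⟩
  have hzS : ∀ t ∈ Icc a b, (z₁ t, z₂ t) ∈ S := fun t ht => Or.inr ⟨t, ht, rfl⟩
  have hcc : (x₁ c, x₂ c) = (z₁ c, z₂ c) := by rw [h₁, h₂]
  rcases hc with rfl | rfl
  · have hI : ∀ t ∈ Ico c b, Icc c b ∈ 𝓝[≥] t := fun t ht =>
      mem_of_superset (Icc_mem_nhdsGE ht.2) (Icc_subset_Icc_left ht.1)
    exact ODE_solution_unique_of_mem_Icc_right (v := fun _ => reducedField β δ r)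
      (s := fun _ => S) (fun _ _ => hL) hx.continuousOn
      (fun t ht => (hx.hasDerivWithinAt (Ico_subset_Icc_self ht)).mono_of_mem_nhdsWithin (hI t ht))
      (fun t ht => hxS t (Ico_subset_Icc_self ht)) hz.continuousOn
      (fun t ht => (hz.hasDerivWithinAt (Ico_subset_Icc_self ht)).mono_of_mem_nhdsWithin (hI t ht))
      (fun t ht => hzS t (Ico_subset_Icc_self ht)) hcc
  · have hI : ∀ t ∈ Ioc a c, Icc a c ∈ 𝓝[≤] t := fun t ht =>
      mem_of_superset (Icc_mem_nhdsLE ht.1) (Icc_subset_Icc_right ht.2)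
    exact ODE_solution_unique_of_mem_Icc_left (v := fun _ => reducedField β δ r)
      (s := fun _ => S) (fun _ _ => hL) hx.continuousOn
      (fun t ht => (hx.hasDerivWithinAt (Ioc_subset_Icc_self ht)).mono_of_mem_nhdsWithin (hI t ht))
      (fun t ht => hxS t (Ioc_subset_Icc_self ht)) hz.continuousOn
      (fun t ht => (hz.hasDerivWithinAt (Ioc_subset_Icc_self ht)).mono_of_mem_nhdsWithin (hI t ht))
      (fun t ht => hzS t (Ioc_subset_Icc_self ht)) hcc

/-- Reduced flows with the same value at time `0` agree. -/
lemma IsReducedFlow.eqOn (hx : IsReducedFlow β δ r x₁ x₂ J) (hz : IsReducedFlow β δ r z₁ z₂ J)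
    (hJ : J.OrdConnected) (h0 : (0 : ℝ) ∈ J) (h₁ : x₁ 0 = z₁ 0) (h₂ : x₂ 0 = z₂ 0) :
    EqOn (fun t => (x₁ t, x₂ t)) (fun t => (z₁ t, z₂ t)) J := by
  intro t ht
  rcases le_total 0 t with h | h
  · exact (hx.mono (hJ.out h0 ht)).eqOn_Icc (hz.mono (hJ.out h0 ht)) (Or.inl rfl) h₁ h₂
      (right_mem_Icc.2 h)
  · exact (hx.mono (hJ.out ht h0)).eqOn_Icc (hz.mono (hJ.out ht h0)) (Or.inr rfl) h₁ h₂
      (left_mem_Icc.2 h)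

/-- A reduced flow whose first function tends to `0` at the time `T` is maximal to the right. -/
lemma IsReducedFlow.subset_and_eqOn {S : Set ℝ} {T : ℝ} (hT : 0 < T)
    (hx : IsReducedFlow β δ r x₁ x₂ (S ∩ Iio T)) (hxT : Tendsto x₁ (𝓝[<] T) (𝓝 0))
    (hJS : J' ⊆ S) (hJ' : J'.OrdConnected) (h0 : (0 : ℝ) ∈ J')
    (hz : IsReducedFlow β δ r z₁ z₂ J') (h₁ : z₁ 0 = x₁ 0) (h₂ : z₂ 0 = x₂ 0) :
    J' ⊆ S ∩ Iio T ∧ EqOn z₁ x₁ J' ∧ EqOn z₂ x₂ J' := by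
  have key : EqOn (fun t => (z₁ t, z₂ t)) (fun t => (x₁ t, x₂ t)) (J' ∩ Iio T) :=
    (hz.mono inter_subset_left).eqOn (hx.mono (inter_subset_inter_left _ hJS))
      (hJ'.inter ordConnected_Iio) ⟨h0, hT⟩ h₁ h₂
  -- A competitor defined at `T` would be continuous there with value `0`, the limit of `x₁`,
  -- against positivity.
  have hTJ : T ∉ J' := fun hTJ => by
    have hI : Icc 0 T ⊆ J' := hJ'.out h0 hTJ
    have h3 : Tendsto z₁ (𝓝[<] T) (𝓝 (z₁ T)) := by
      have h4 := ((hz T hTJ).2.2.1.continuousWithinAt).mono hI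
      refine h4.tendsto.mono_left ?_
      rw [← nhdsWithin_Ioo_eq_nhdsLT hT]
      exact nhdsWithin_mono _ Ioo_subset_Icc_self
    have h5 : Tendsto z₁ (𝓝[<] T) (𝓝 0) := by
      refine hxT.congr' ?_
      filter_upwards [Ioo_mem_nhdsLT hT] with t ht
      exact (congrArg Prod.fst (key ⟨hI (Ioo_subset_Icc_self ht), ht.2⟩)).symm
    exact (hz T hTJ).1.ne' (tendsto_nhds_unique h3 h5)
  have hlt : J' ⊆ Iio T := fun t ht => by
    by_contra h
    exact hTJ (hJ'.out h0 ht ⟨hT.le, not_lt.1 h⟩)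
  exact ⟨subset_inter hJS hlt, fun t ht => congrArg Prod.fst (key ⟨ht, hlt ht⟩),
    fun t ht => congrArg Prod.snd (key ⟨ht, hlt ht⟩)⟩

end Uniqueness

/-! ### Behaviour of reduced flows in the distant past. -/

section Asymptotics

variable {β δ r : ℝ} {x₁ x₂ : ℝ → ℝ}

/-- The growth of the second function at `-∞`, when the ratio converges. -/
lemma IsReducedFlow.exists_tendsto_abs_div (hβ : 0 < β) (hδ : 0 < δ) (hr : 0 < r) {T : ℝ}
    (hx : IsReducedFlow β δ r x₁ x₂ (Iio T))
    (hlim : Tendsto (fun t => x₁ t / x₂ t) atBot (𝓝 r)) :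
    ∃ L, Tendsto (fun t => |t| / x₂ t) atBot (𝓝 L) := by
  -- Minus the derivative of the second function at the Einstein ratio: `2 (2(β+δ) r - δ r)`.
  set m := 2 * (2 * β + δ) * r
  have hm : 0 < m := by positivity
  have hder : Tendsto (fun t => -2 * (2 * (β + δ) * r - δ * (x₁ t / x₂ t))) atBot (𝓝 (-m)) := by
    have := ((hlim.const_mul δ).const_sub (2 * (β + δ) * r)).const_mul (-2)
    convert this using 2
    simp only [m]; ring
  have key : Tendsto (fun t => x₂ t / t) atBot (𝓝 (-m)) := by
    rw [Metric.tendsto_nhds]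
    intro ε hε
    have h1 := (Metric.tendsto_nhds.1 hder (ε / 2) (by positivity)).and (eventually_lt_atBot T)
    obtain ⟨s, hs⟩ := eventually_atBot.1 h1
    -- Mean value inequality for `x₂ + m t`, whose derivative is at most `ε / 2` in absolute value
    -- before `s`.
    have hbound : ∀ t ≤ s, |x₂ t + m * t - (x₂ s + m * s)| ≤ ε / 2 * |t - s| := fun t ht => by
      have := (convex_Iic s).norm_image_sub_le_of_norm_hasDerivWithin_le
        (f := fun t => x₂ t + m * t)
        (f' := fun t => -2 * (2 * (β + δ) * r - δ * (x₁ t / x₂ t)) + m * 1) (C := ε / 2)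
        (x := s) (y := t) (fun u hu => ?_) (fun u hu => ?_) (mem_Iic.2 le_rfl) ht
      · simpa using this
      · exact (((hx u (hs u hu).2).2.2.2).mono (fun v hv => (hs v hv).2)).add
          ((hasDerivWithinAt_id u _).const_mul m)
      · have := (hs u hu).1
        rw [Real.dist_eq] at this
        rw [Real.norm_eq_abs, mul_one, ← sub_neg_eq_add]
        exact this.le
    have h2 : Tendsto (fun t : ℝ => |x₂ s + m * s| / |t| + ε / 2 * (|s| / |t|)) atBot
        (𝓝 (0 + ε / 2 * 0)) :=
      (tendsto_abs_atBot_atTop.const_div_atTop _).add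
        ((tendsto_abs_atBot_atTop.const_div_atTop _).const_mul _)
    have h3 : ∀ᶠ t : ℝ in atBot, |x₂ s + m * s| / |t| + ε / 2 * (|s| / |t|) < ε / 2 :=
      h2.eventually (gt_mem_nhds (by simpa using by positivity))
    filter_upwards [h3, eventually_le_atBot s, eventually_lt_atBot 0] with t ht hts ht0
    have h4 : 0 < |t| := abs_pos.2 ht0.ne
    rw [Real.dist_eq, show x₂ t / t - -m = (x₂ t + m * t) / t by
      have := ht0.ne; field_simp; ring, abs_div,
      div_lt_iff₀ h4]
    have h5 := abs_add_le (x₂ t + m * t - (x₂ s + m * s)) (x₂ s + m * s)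
    rw [sub_add_cancel] at h5
    have h6 : |t - s| ≤ |t| + |s| := abs_sub t s
    have h7 := mul_lt_mul_of_pos_right ht h4
    have h8 : (|x₂ s + m * s| / |t| + ε / 2 * (|s| / |t|)) * |t| =
      |x₂ s + m * s| + ε / 2 * |s| := by field_simp
    have := hbound t hts
    nlinarith
  refine ⟨m⁻¹, ?_⟩
  have := (key.inv₀ (by linarith : -m ≠ 0)).neg
  rw [inv_neg, neg_neg] at this
  refine this.congr' ?_
  filter_upwards [eventually_lt_atBot 0] with t ht
  rw [abs_of_neg ht, inv_div, neg_div]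

/-- A reduced flow which starts above the Einstein ratio is not ancient. -/
lemma IsReducedFlow.not_ancient (hβ : 0 < β) (hδ : 0 < δ) (hr : 0 < r) {T : ℝ} (hT : 0 < T)
    (hx : IsReducedFlow β δ r x₁ x₂ (Iio T)) : ¬ r < x₁ 0 / x₂ 0 := by
  intro h0
  have hint : ∀ {u : ℝ}, u ∈ interior (Iic 0) → u ≤ 0 :=
    fun hu => mem_Iic.1 (interior_subset hu)
  have hd : ∀ t ≤ 0, HasDerivAt (fun t => x₁ t / x₂ t)
      (-(2 * (β + δ) / x₂ t * (x₁ t / x₂ t - r) ^ 2)) t := fun t ht => by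
    obtain ⟨h1, h2, h3, h4⟩ := hx t (ht.trans_lt hT)
    have hn : Iio T ∈ 𝓝 t := Iio_mem_nhds (ht.trans_lt hT)
    refine ((h3.hasDerivAt hn).div (h4.hasDerivAt hn) h2.ne').congr_deriv ?_
    field_simp
    ring
  have hpos : ∀ t ≤ 0, 0 < x₂ t := fun t ht => (hx t (ht.trans_lt hT)).2.1
  have hκ : 0 < β + δ := by positivity
  -- The derivative of the ratio is minus a square times a positive factor, so backwards in time the
  -- ratio stays above `r`.
  have hanti : AntitoneOn (fun t => x₁ t / x₂ t) (Iic 0) := by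
    refine antitoneOn_of_deriv_nonpos (convex_Iic _)
      (fun u hu => (hd u hu).continuousAt.continuousWithinAt)
      (fun u hu => (hd u (hint hu)).differentiableAt.differentiableWithinAt)
      fun u hu => ?_
    rw [(hd u (hint hu)).deriv]
    have := hpos u (hint hu)
    have : 0 ≤ 2 * (β + δ) / x₂ u * (x₁ u / x₂ u - r) ^ 2 := by positivity
    linarith
  have hgt : ∀ t ≤ 0, r < x₁ t / x₂ t := fun t ht => h0.trans_le (hanti ht (mem_Iic.2 le_rfl) ht)
  set w : ℝ → ℝ := fun t => (x₁ t / x₂ t - r)⁻¹ with hw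
  have hwpos : ∀ t ≤ 0, 0 < w t := fun t ht => inv_pos.2 (sub_pos.2 (hgt t ht))
  have hwd : ∀ t ≤ 0, HasDerivAt w (2 * (β + δ) / x₂ t) t := fun t ht => by
    have h1 := sub_pos.2 (hgt t ht)
    have h2 := hpos t ht
    refine (((hd t ht).sub_const r).inv h1.ne').congr_deriv ?_
    rw [neg_neg, mul_div_assoc, div_self (by positivity), mul_one]
  set ρ := flowRate β δ r
  have hρ : 0 < ρ := flowRate_pos hβ hδ hr
  -- With `w = -u`, this is the second function divided by the exponential factor of the profile.
  -- Since `w > 0` in the past, monotonicity bounds `x₂` there by its value `M` at time `0`.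
  have hmono : MonotoneOn (fun t => x₂ t * Real.exp (ρ * w t)) (Iic 0) := by
    have hd' : ∀ t ≤ 0, HasDerivAt (fun t => x₂ t * Real.exp (ρ * w t))
        (2 * δ * (x₁ t / x₂ t - r) * Real.exp (ρ * w t)) t := fun t ht => by
      have hn : Iio T ∈ 𝓝 t := Iio_mem_nhds (ht.trans_lt hT)
      have h2 := hpos t ht
      have h4 := (hx t (ht.trans_lt hT)).2.2.2.hasDerivAt hn
      refine (h4.mul ((hwd t ht).const_mul ρ).exp).congr_deriv ?_
      simp only [ρ, flowRate]
      field_simp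
      ring
    refine monotoneOn_of_deriv_nonneg (convex_Iic _)
      (fun u hu => (hd' u hu).continuousAt.continuousWithinAt)
      (fun u hu => (hd' u (hint hu)).differentiableAt.differentiableWithinAt)
      fun u hu => ?_
    rw [(hd' u (hint hu)).deriv]
    have := sub_pos.2 (hgt u (hint hu))
    positivity
  set M := x₂ 0 * Real.exp (ρ * w 0)
  have hM : 0 < M := mul_pos (hpos 0 le_rfl) (Real.exp_pos _)
  have hle : ∀ t ≤ 0, x₂ t ≤ M := fun t ht => by
    have h1 : x₂ t * Real.exp (ρ * w t) ≤ M := hmono (a := t) (b := 0) ht (mem_Iic.2 le_rfl) ht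
    have h2 : 1 ≤ Real.exp (ρ * w t) := Real.one_le_exp (mul_pos hρ (hwpos t ht)).le
    nlinarith [hpos t ht]
  have hmono' : MonotoneOn (fun t => w t - 2 * (β + δ) / M * t) (Iic 0) := by
    have hd' : ∀ t ≤ 0, HasDerivAt (fun t => w t - 2 * (β + δ) / M * t)
        (2 * (β + δ) / x₂ t - 2 * (β + δ) / M * 1) t := fun t ht =>
      (hwd t ht).sub ((hasDerivAt_id t).const_mul _)
    refine monotoneOn_of_deriv_nonneg (convex_Iic _)
      (fun u hu => (hd' u hu).continuousAt.continuousWithinAt)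
      (fun u hu => (hd' u (hint hu)).differentiableAt.differentiableWithinAt)
      fun u hu => ?_
    rw [(hd' u (hint hu)).deriv, mul_one, sub_nonneg]
    have := hle u (hint hu)
    have := hpos u (hint hu)
    gcongr
  have hw0 := hwpos 0 le_rfl
  -- The time at which a function of slope `2(β+δ)/M` with value `w 0` at `0` vanishes; `w` grows at
  -- least that fast, so `w ≤ 0` there, a contradiction.
  have ht : -(w 0 * M / (2 * (β + δ))) ≤ 0 := by
    have : 0 ≤ w 0 * M / (2 * (β + δ)) := by positivity
    linarith
  have h1 := hmono' (a := -(w 0 * M / (2 * (β + δ)))) (b := 0) ht (mem_Iic.2 le_rfl) ht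
  simp only [mul_zero, sub_zero] at h1
  have h2 : 2 * (β + δ) / M * -(w 0 * M / (2 * (β + δ))) = -w 0 := by field_simp
  rw [h2] at h1
  linarith [hwpos _ ht]

end Asymptotics

/-! ### The derivative in the model space -/

section ModelDeriv

variable {E F E' : Type*} [NormedAddCommGroup E] [NormedSpace ℝ E]
  [NormedAddCommGroup F] [NormedSpace ℝ F] [NormedAddCommGroup E'] [NormedSpace ℝ E']
  {M N M' : Type*} [TopologicalSpace M] [ChartedSpace E M] [TopologicalSpace N] [ChartedSpace F N]
  [TopologicalSpace M'] [ChartedSpace E' M']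

variable (E F) in
/-- The derivative of a map between manifolds, as a map between the model spaces. -/
def modelDeriv (f : M → N) (x : M) : E →L[ℝ] F := mfderiv 𝓘(ℝ, E) 𝓘(ℝ, F) f x

/-- The intermediate point is a variable with an equation because in a group it is typically an
unsimplified expression such as `g * 1 * g⁻¹`. -/
lemma modelDeriv_comp {f : N → M'} {h : M → N} {x : M} {y : N} (hy : h x = y)
    (hf : MDifferentiableAt 𝓘(ℝ, F) 𝓘(ℝ, E') f y) (hh : MDifferentiableAt 𝓘(ℝ, E) 𝓘(ℝ, F) h x) :
    modelDeriv E E' (f ∘ h) x = (modelDeriv F E' f y).comp (modelDeriv E F h x) := by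
  subst hy
  exact mfderiv_comp x hf hh

lemma modelDeriv_comp_apply {f : N → M'} {h : M → N} {x : M} {y : N} (hy : h x = y)
    (hf : MDifferentiableAt 𝓘(ℝ, F) 𝓘(ℝ, E') f y) (hh : MDifferentiableAt 𝓘(ℝ, E) 𝓘(ℝ, F) h x)
    (v : E) :
    modelDeriv E E' (fun z => f (h z)) x v = modelDeriv F E' f y (modelDeriv E F h x v) :=
  congrArg (fun L : E →L[ℝ] E' => L v) (modelDeriv_comp hy hf hh)

lemma modelDeriv_id (x : M) : modelDeriv E E (fun z : M => z) x = ContinuousLinearMap.id ℝ E :=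
  mfderiv_id

lemma modelDeriv_congr {f h : M → N} {x : M} (hfh : f =ᶠ[𝓝 x] h) :
    modelDeriv E F f x = modelDeriv E F h x := by
  unfold modelDeriv
  have h0 : f x = h x := hfh.self_of_nhds
  have := hfh.mfderiv_eq (I := 𝓘(ℝ, E)) (I' := 𝓘(ℝ, F))
  exact this

lemma modelDeriv_eq_fderiv (f : E → F) (x : E) : modelDeriv E F f x = fderiv ℝ f x :=
  mfderiv_eq_fderiv

end ModelDeriv

/-! ### The adjoint action and the bracket -/

section Adjoint

variable {E : Type*} [NormedAddCommGroup E] [NormedSpace ℝ E]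
  {G : Type*} [TopologicalSpace G] [ChartedSpace E G] [Group G] [LieGroup 𝓘(ℝ, E) ∞ G]

lemma contMDiff_conj (g : G) : ContMDiff 𝓘(ℝ, E) 𝓘(ℝ, E) ∞ (fun x : G => g * x * g⁻¹) :=
  (contMDiff_mul_right (I := 𝓘(ℝ, E)) (a := g⁻¹)).comp (contMDiff_mul_left (I := 𝓘(ℝ, E)) (a := g))

lemma mdifferentiable_mul_left (g : G) : MDifferentiable 𝓘(ℝ, E) 𝓘(ℝ, E) (fun x : G => g * x) :=
  (contMDiff_mul_left (I := 𝓘(ℝ, E)) (n := ∞)).mdifferentiable (by simp)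

lemma mdifferentiable_mul_right (g : G) : MDifferentiable 𝓘(ℝ, E) 𝓘(ℝ, E) (fun x : G => x * g) :=
  (contMDiff_mul_right (I := 𝓘(ℝ, E)) (n := ∞)).mdifferentiable (by simp)

lemma mdifferentiable_conj (g : G) :
    MDifferentiable 𝓘(ℝ, E) 𝓘(ℝ, E) (fun x : G => g * x * g⁻¹) :=
  (contMDiff_conj g).mdifferentiable (by simp)

lemma Ad_eq (g : G) (X : LieAlg E G) :
    Ad E g X = modelDeriv E E (fun x : G => g * x * g⁻¹) 1 X := rfl

variable (E) in
/-- The adjoint action as a linear map. -/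
def AdLinear (g : G) : LieAlg E G →ₗ[ℝ] LieAlg E G where
  toFun := Ad E g
  map_add' X Y := map_add (modelDeriv E E (fun x : G => g * x * g⁻¹) 1) X Y
  map_smul' c X := map_smul (modelDeriv E E (fun x : G => g * x * g⁻¹) 1) c X

lemma Ad_one (X : LieAlg E G) : Ad E (1 : G) X = X := by
  have : (fun x : G => 1 * x * 1⁻¹) = fun x => x := by ext; simp
  rw [Ad_eq, this, modelDeriv_id]
  rfl

/-- From `g x = (g x g⁻¹) g`: left and right translation differ by `Ad`. This makes `Ad` visible in
the partial derivatives of the multiplication. -/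
lemma modelDeriv_mul_left (g : G) (X : LieAlg E G) :
    modelDeriv E E (fun x : G => g * x) 1 X =
      modelDeriv E E (fun x : G => x * g) 1 (Ad E g X) := by
  have h : (fun x : G => g * x) = fun x : G => (g * x * g⁻¹) * g := by
    ext; simp
  rw [h, Ad_eq]
  exact modelDeriv_comp_apply (E := E) (F := E) (E' := E) (by simp) (mdifferentiable_mul_right g (1 : G))
    (mdifferentiable_conj g (1 : G)) X

lemma Ad_mul (g h : G) (X : LieAlg E G) : Ad E (g * h) X = Ad E g (Ad E h X) := by
  have hc : (fun x : G => g * h * x * (g * h)⁻¹) = fun x : G => g * (h * x * h⁻¹) * g⁻¹ := by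
    ext; simp [mul_assoc]
  rw [Ad_eq, hc]
  exact modelDeriv_comp_apply (E := E) (F := E) (E' := E) (by simp) (mdifferentiable_conj g (1 : G))
    (mdifferentiable_conj h (1 : G)) X

lemma Ad_inv_Ad (g : G) (X : LieAlg E G) : Ad E g⁻¹ (Ad E g X) = X := by
  rw [← Ad_mul (E := E), inv_mul_cancel, Ad_one (E := E)]

lemma Ad_Ad_inv (g : G) (X : LieAlg E G) : Ad E g (Ad E g⁻¹ X) = X := by
  rw [← Ad_mul (E := E), mul_inv_cancel, Ad_one (E := E)]

lemma inverse_modelDeriv_conj (g x : G) :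
    ContinuousLinearMap.inverse (modelDeriv E E (fun x : G => g * x * g⁻¹) x) =
      modelDeriv E E (fun x : G => g⁻¹ * x * g) (g * x * g⁻¹) := by
  have h1 : MDifferentiable 𝓘(ℝ, E) 𝓘(ℝ, E) (fun x : G => g⁻¹ * x * g) := by
    simpa using mdifferentiable_conj (E := E) g⁻¹
  refine ContinuousLinearMap.inverse_eq ?_ ?_
  · rw [← modelDeriv_comp (by simp [mul_assoc]) (mdifferentiable_conj g x) (h1 _),
      ← modelDeriv_id (g * x * g⁻¹)]
    congr 1
    ext; simp [mul_assoc]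
  · rw [← modelDeriv_comp rfl (h1 _) (mdifferentiable_conj g x), ← modelDeriv_id x]
    congr 1
    ext; simp [mul_assoc]

/-- Conjugation is a homomorphism, hence it relates the left-invariant fields of `X` and `Ad g X`.
At a point this is the identity `g⁻¹ ((g x g⁻¹)(g y g⁻¹)) g = x y`, differentiated in `y` at `1`. -/
lemma mpullback_conj_mulInvariantVectorField (g : G) (X : LieAlg E G) :
    VectorField.mpullback 𝓘(ℝ, E) 𝓘(ℝ, E) (fun x : G => g * x * g⁻¹)
      (mulInvariantVectorField (I := 𝓘(ℝ, E)) (Ad E g X)) =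
        mulInvariantVectorField (I := 𝓘(ℝ, E)) X := by
  ext x
  have h1 : MDifferentiable 𝓘(ℝ, E) 𝓘(ℝ, E) (fun x : G => g⁻¹ * x * g) := by
    simpa using mdifferentiable_conj (E := E) g⁻¹
  change ContinuousLinearMap.inverse (modelDeriv E E (fun x : G => g * x * g⁻¹) x)
    (modelDeriv E E (fun y : G => g * x * g⁻¹ * y) 1 (Ad E g X)) =
    modelDeriv E E (fun y : G => x * y) 1 X
  have h2 := modelDeriv_comp_apply (E := E) (F := E) (E' := E) (by simp)
    (mdifferentiable_mul_left (g * x * g⁻¹) (1 : G)) (mdifferentiable_conj g (1 : G)) X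
  have h3 := modelDeriv_comp_apply (E := E) (F := E) (E' := E) (y := g * x * g⁻¹) (by simp) (h1 _)
    ((mdifferentiable_mul_left (g * x * g⁻¹)).comp (mdifferentiable_conj g) (1 : G)) X
  rw [inverse_modelDeriv_conj, Ad_eq]
  refine (congrArg _ h2.symm).trans (h3.symm.trans ?_)
  congr 2
  ext; simp [mul_assoc]

/-- The adjoint action preserves the bracket. -/
lemma Ad_lie [CompleteSpace E] (g : G) (X Y : LieAlg E G) :
    Ad E g ⁅X, Y⁆ = ⁅Ad E g X, Ad E g Y⁆ := by
  have h := VectorField.mpullback_mlieBracket (I := 𝓘(ℝ, E)) (I' := 𝓘(ℝ, E))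
    (n := minSmoothness ℝ 3) (f := fun x : G => g * x * g⁻¹) (x₀ := (1 : G))
    (V := mulInvariantVectorField (I := 𝓘(ℝ, E)) (Ad E g X))
    (W := mulInvariantVectorField (I := 𝓘(ℝ, E)) (Ad E g Y))
    (mdifferentiableAt_mulInvariantVectorField _) (mdifferentiableAt_mulInvariantVectorField _)
    (((contMDiff_conj g).of_le
      (by simpa using (mod_cast le_top : ((3 : ℕ∞) : ℕ∞ω) ≤ ∞))) 1) (minSmoothness_monotone (by norm_cast))
  rw [mpullback_conj_mulInvariantVectorField, mpullback_conj_mulInvariantVectorField] at h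
  have h1 : g * 1 * g⁻¹ = 1 := by simp
  have h2 : ⁅X, Y⁆ = ContinuousLinearMap.inverse (modelDeriv E E (fun x : G => g * x * g⁻¹) 1)
      (VectorField.mlieBracket 𝓘(ℝ, E) (mulInvariantVectorField (I := 𝓘(ℝ, E)) (Ad E g X))
        (mulInvariantVectorField (I := 𝓘(ℝ, E)) (Ad E g Y)) (g * 1 * g⁻¹)) := h.symm
  have h4 : (fun x : G => g⁻¹ * x * g) = fun x : G => g⁻¹ * x * g⁻¹⁻¹ := by simp
  rw [inverse_modelDeriv_conj, h1, h4] at h2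
  have h3 : ⁅X, Y⁆ = Ad E g⁻¹ ⁅Ad E g X, Ad E g Y⁆ := h2
  rw [h3, Ad_Ad_inv]

/-- The adjoint action by Lie algebra automorphisms. -/
def AdLieEquiv [CompleteSpace E] (g : G) : LieAlg E G ≃ₗ⁅ℝ⁆ LieAlg E G :=
  { AdLinear E g with
    map_lie' := fun {X Y} => Ad_lie g X Y
    invFun := Ad E g⁻¹
    left_inv := Ad_inv_Ad g
    right_inv := Ad_Ad_inv g }

end Adjoint

/-! ### The multiplication in the chart at the identity -/

section ChartMul

variable {E : Type*} [NormedAddCommGroup E] [NormedSpace ℝ E]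
  {G : Type*} [TopologicalSpace G] [ChartedSpace E G] [Group G] [LieGroup 𝓘(ℝ, E) ∞ G]

variable (E G) in
/-- The multiplication in the chart at the identity. -/
def chartMul (p : E × E) : E :=
  extChartAt 𝓘(ℝ, E) (1 : G)
    ((extChartAt 𝓘(ℝ, E) (1 : G)).symm p.1 * (extChartAt 𝓘(ℝ, E) (1 : G)).symm p.2)

variable (E G) in
/-- The identity in the chart at the identity. -/
def chartOne : E := extChartAt 𝓘(ℝ, E) (1 : G) 1

lemma symm_chartOne : (extChartAt 𝓘(ℝ, E) (1 : G)).symm (chartOne E G) = 1 :=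
  extChartAt_to_inv (1 : G)

lemma isManifold_one : IsManifold 𝓘(ℝ, E) 1 G :=
  IsManifold.of_le (n := ∞) (by simp)

lemma modelDeriv_extChartAt_one :
    modelDeriv E E (extChartAt 𝓘(ℝ, E) (1 : G)) (1 : G) = ContinuousLinearMap.id ℝ E :=
  haveI := isManifold_one (E := E) (G := G)
  mfderiv_extChartAt_self


lemma contDiffAt_chartMul : ContDiffAt ℝ ∞ (chartMul E G) (chartOne E G, chartOne E G) := by
  rw [← contMDiffAt_iff_contDiffAt]
  have ht : ContMDiffAt 𝓘(ℝ, E) 𝓘(ℝ, E) ∞ (extChartAt 𝓘(ℝ, E) (1 : G)).symm (chartOne E G) :=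
    (contMDiffOn_extChartAt_symm (1 : G)).contMDiffAt (extChartAt_target_mem_nhds (1 : G))
  have h1 : ContMDiffAt 𝓘(ℝ, E × E) 𝓘(ℝ, E) ∞
      (fun p : E × E => (extChartAt 𝓘(ℝ, E) (1 : G)).symm p.1) (chartOne E G, chartOne E G) :=
    ContMDiffAt.comp (g := (extChartAt 𝓘(ℝ, E) (1 : G)).symm) _ ht contDiff_fst.contMDiff.contMDiffAt
  have h2 : ContMDiffAt 𝓘(ℝ, E × E) 𝓘(ℝ, E) ∞
      (fun p : E × E => (extChartAt 𝓘(ℝ, E) (1 : G)).symm p.2) (chartOne E G, chartOne E G) :=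
    ContMDiffAt.comp (g := (extChartAt 𝓘(ℝ, E) (1 : G)).symm) _ ht contDiff_snd.contMDiff.contMDiffAt
  have h3 := h1.mul h2
  refine ContMDiffAt.comp (g := extChartAt 𝓘(ℝ, E) (1 : G)) _ ?_ h3
  have : (extChartAt 𝓘(ℝ, E) (1 : G)).symm (chartOne E G) *
      (extChartAt 𝓘(ℝ, E) (1 : G)).symm (chartOne E G) = 1 := by rw [symm_chartOne, mul_one]
  change ContMDiffAt _ _ _ _ ((extChartAt 𝓘(ℝ, E) (1 : G)).symm (chartOne E G) *
      (extChartAt 𝓘(ℝ, E) (1 : G)).symm (chartOne E G))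
  rw [this]
  exact contMDiffAt_extChartAt

lemma eventually_mem_target : ∀ᶠ x in 𝓝 (chartOne E G), x ∈ (extChartAt 𝓘(ℝ, E) (1 : G)).target :=
  extChartAt_target_mem_nhds (1 : G)

lemma mdifferentiableAt_extChartAt_one : MDifferentiableAt 𝓘(ℝ, E) 𝓘(ℝ, E)
    (extChartAt 𝓘(ℝ, E) (1 : G)) (1 : G) :=
  (contMDiffAt_extChartAt (n := ∞)).mdifferentiableAt (by simp)

lemma mdifferentiableAt_extChartAt_one' {g : G} (hg : g ∈ (extChartAt 𝓘(ℝ, E) (1 : G)).source) :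
    MDifferentiableAt 𝓘(ℝ, E) 𝓘(ℝ, E) (extChartAt 𝓘(ℝ, E) (1 : G)) g :=
  (contMDiffAt_extChartAt' (n := ∞) (by simpa using hg)).mdifferentiableAt (by simp)

lemma eventually_chartMul_differentiable :
    ∀ᶠ p in 𝓝 (chartOne E G, chartOne E G), DifferentiableAt ℝ (chartMul E G) p := by
  have h : ContDiffAt ℝ 1 (chartMul E G) (chartOne E G, chartOne E G) :=
    contDiffAt_chartMul.of_le (by simp)
  filter_upwards [h.eventually (by simp)] with p hp using hp.differentiableAt (by simp)

lemma fderiv_eq_modelDeriv_comp_extChartAt {f : E → E} (hf : DifferentiableAt ℝ f (chartOne E G))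
    (Y : E) : fderiv ℝ f (chartOne E G) Y =
      modelDeriv E E (fun z => f (extChartAt 𝓘(ℝ, E) (1 : G) z)) (1 : G) Y := by
  have h := modelDeriv_comp_apply (E := E) (F := E) (E' := E) (f := f) (h := extChartAt 𝓘(ℝ, E) (1 : G))
    (y := chartOne E G) rfl
    hf.mdifferentiableAt (mdifferentiableAt_extChartAt_one (E := E) (G := G)) Y
  rw [h, modelDeriv_extChartAt_one, modelDeriv_eq_fderiv]
  rfl

/-- With the first factor frozen, `chartMul` is a left translation read in the chart, and the
derivative of the chart at the identity is the identity map. -/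
lemma eventually_fderiv_chartMul_left : ∀ᶠ x in 𝓝 (chartOne E G), ∀ Y : E,
    fderiv ℝ (chartMul E G) (x, chartOne E G) (0, Y) =
      modelDeriv E E (extChartAt 𝓘(ℝ, E) (1 : G)) ((extChartAt 𝓘(ℝ, E) (1 : G)).symm x)
        (modelDeriv E E (fun z : G => (extChartAt 𝓘(ℝ, E) (1 : G)).symm x * z) 1 Y) := by
  have hc : Tendsto (fun x => (x, chartOne E G)) (𝓝 (chartOne E G))
    (𝓝 (chartOne E G, chartOne E G)) := (Continuous.prodMk_left _).tendsto _
  filter_upwards [eventually_mem_target, hc.eventually eventually_chartMul_differentiable]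
    with x hx hd Y
  set φ := extChartAt 𝓘(ℝ, E) (1 : G)
  have hs : φ.symm x ∈ φ.source := φ.map_target hx
  rw [← modelDeriv_comp_apply (E := E) (F := E) (E' := E)
    (h := fun z => φ.symm x * z) (mul_one _)
    (mdifferentiableAt_extChartAt_one' hs) (mdifferentiable_mul_left _ (1 : G))]
  have h1 : fderiv ℝ (chartMul E G) (x, chartOne E G) (0, Y) =
      fderiv ℝ (fun y => chartMul E G (x, y)) (chartOne E G) Y := by
    have h := hd.hasFDerivAt.comp (chartOne E G) (hasFDerivAt_prodMk_right x (chartOne E G))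
    change _ = fderiv ℝ (chartMul E G ∘ fun y => (x, y)) (chartOne E G) Y
    rw [h.fderiv]
    rfl
  have hd' : DifferentiableAt ℝ (fun y => chartMul E G (x, y)) (chartOne E G) :=
    DifferentiableAt.comp (g := chartMul E G) (chartOne E G) hd
      (hasFDerivAt_prodMk_right x (chartOne E G)).differentiableAt
  rw [h1, fderiv_eq_modelDeriv_comp_extChartAt hd']
  refine congrArg (fun L : E →L[ℝ] E => L Y) (modelDeriv_congr ?_)
  filter_upwards [extChartAt_source_mem_nhds (I := 𝓘(ℝ, E)) (1 : G)] with z hz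
  simp only [chartMul]
  rw [φ.left_inv hz]

lemma eventually_fderiv_chartMul_right : ∀ᶠ x in 𝓝 (chartOne E G), ∀ Y : E,
    fderiv ℝ (chartMul E G) (chartOne E G, x) (Y, 0) =
      modelDeriv E E (extChartAt 𝓘(ℝ, E) (1 : G)) ((extChartAt 𝓘(ℝ, E) (1 : G)).symm x)
        (modelDeriv E E (fun z : G => z * (extChartAt 𝓘(ℝ, E) (1 : G)).symm x) 1 Y) := by
  have hc : Tendsto (fun x => (chartOne E G, x)) (𝓝 (chartOne E G))
    (𝓝 (chartOne E G, chartOne E G)) := (Continuous.prodMk_right _).tendsto _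
  filter_upwards [eventually_mem_target, hc.eventually eventually_chartMul_differentiable]
    with x hx hd Y
  set φ := extChartAt 𝓘(ℝ, E) (1 : G)
  have hs : φ.symm x ∈ φ.source := φ.map_target hx
  rw [← modelDeriv_comp_apply (E := E) (F := E) (E' := E)
    (h := fun z => z * φ.symm x) (one_mul _)
    (mdifferentiableAt_extChartAt_one' hs) (mdifferentiable_mul_right _ (1 : G))]
  have h1 : fderiv ℝ (chartMul E G) (chartOne E G, x) (Y, 0) =
      fderiv ℝ (fun y => chartMul E G (y, x)) (chartOne E G) Y := by
    have h := HasFDerivAt.comp (f := fun y => (y, x)) (chartOne E G) hd.hasFDerivAt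
      (hasFDerivAt_prodMk_left (chartOne E G) x)
    change _ = fderiv ℝ (chartMul E G ∘ fun y => (y, x)) (chartOne E G) Y
    rw [h.fderiv]
    rfl
  have hd' : DifferentiableAt ℝ (fun y => chartMul E G (y, x)) (chartOne E G) :=
    DifferentiableAt.comp (g := chartMul E G) (chartOne E G) hd
      (hasFDerivAt_prodMk_left (chartOne E G) x).differentiableAt
  rw [h1, fderiv_eq_modelDeriv_comp_extChartAt hd']
  refine congrArg (fun L : E →L[ℝ] E => L Y) (modelDeriv_congr ?_)
  filter_upwards [extChartAt_source_mem_nhds (I := 𝓘(ℝ, E)) (1 : G)] with z hz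
  simp only [chartMul]
  rw [φ.left_inv hz]

/-- The adjoint action in the chart at the identity. -/
lemma eventually_fderiv_chartMul_Ad : ∀ᶠ x in 𝓝 (chartOne E G), ∀ Y : E,
    fderiv ℝ (chartMul E G) (x, chartOne E G) (0, Y) =
      fderiv ℝ (chartMul E G) (chartOne E G, x)
        (modelDeriv E E (fun z : G => (extChartAt 𝓘(ℝ, E) (1 : G)).symm x * z *
          ((extChartAt 𝓘(ℝ, E) (1 : G)).symm x)⁻¹) 1 Y, 0) := by
  filter_upwards [eventually_fderiv_chartMul_left (E := E) (G := G),
    eventually_fderiv_chartMul_right (E := E) (G := G)] with x h1 h2 Y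
  refine (h1 Y).trans (Eq.trans ?_ (h2 _).symm)
  exact congrArg _ (modelDeriv_mul_left _ _)

/-- The left-invariant vector fields in the chart at the identity. -/
def chartField (Y : LieAlg E G) : E → E :=
  VectorField.mpullbackWithin 𝓘(ℝ, E) 𝓘(ℝ, E) (extChartAt 𝓘(ℝ, E) (1 : G)).symm
    (mulInvariantVectorField (I := 𝓘(ℝ, E)) Y) (range 𝓘(ℝ, E))

lemma eventually_chartField (Y : LieAlg E G) :
    ∀ᶠ x in 𝓝 (chartOne E G), chartField Y x = fderiv ℝ (chartMul E G) (x, chartOne E G) ((0 : E), (Y : E)) := by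
  have := isManifold_one (E := E) (G := G)
  filter_upwards [eventually_fderiv_chartMul_left (E := E) (G := G), eventually_mem_target]
    with x h1 hx
  refine Eq.trans ?_ (h1 Y).symm
  refine congrArg (fun L : E →L[ℝ] E => L _) (?_ : ContinuousLinearMap.inverse
    (mfderivWithin 𝓘(ℝ, E) 𝓘(ℝ, E) (extChartAt 𝓘(ℝ, E) (1 : G)).symm (range 𝓘(ℝ, E)) x : E →L[ℝ] E)
      = modelDeriv E E (extChartAt 𝓘(ℝ, E) (1 : G)) ((extChartAt 𝓘(ℝ, E) (1 : G)).symm x))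
  exact ContinuousLinearMap.inverse_eq (mfderivWithin_extChartAt_symm_comp_mfderiv_extChartAt hx)
    (mfderiv_extChartAt_comp_mfderivWithin_extChartAt_symm hx)

lemma hasFDerivAt_fderiv_chartMul : HasFDerivAt (fderiv ℝ (chartMul E G))
    (fderiv ℝ (fderiv ℝ (chartMul E G)) (chartOne E G, chartOne E G))
    (chartOne E G, chartOne E G) := by
  have h : ContDiffAt ℝ 1 (fderiv ℝ (chartMul E G)) (chartOne E G, chartOne E G) :=
    (contDiffAt_chartMul (E := E) (G := G)).fderiv_right (m := 1) (by norm_cast)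
  exact (h.differentiableAt (by simp)).hasFDerivAt

lemma hasFDerivAt_chartMul_left (Y : E) :
    HasFDerivAt (fun x => fderiv ℝ (chartMul E G) (x, chartOne E G) (0, Y))
      (((ContinuousLinearMap.apply ℝ E ((0 : E), Y)).comp
        (fderiv ℝ (fderiv ℝ (chartMul E G)) (chartOne E G, chartOne E G))).comp
        (ContinuousLinearMap.inl ℝ E E)) (chartOne E G) :=
  (ContinuousLinearMap.hasFDerivAt (ContinuousLinearMap.apply ℝ E ((0 : E), Y))).comp _
    (HasFDerivAt.comp (f := fun x => (x, chartOne E G)) (chartOne E G)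
      (hasFDerivAt_fderiv_chartMul (E := E) (G := G)) (hasFDerivAt_prodMk_left (chartOne E G) (chartOne E G)))

lemma hasFDerivAt_chartMul_right (Y : E) :
    HasFDerivAt (fun x => fderiv ℝ (chartMul E G) (chartOne E G, x) (Y, 0))
      (((ContinuousLinearMap.apply ℝ E (Y, (0 : E))).comp
        (fderiv ℝ (fderiv ℝ (chartMul E G)) (chartOne E G, chartOne E G))).comp
        (ContinuousLinearMap.inr ℝ E E)) (chartOne E G) :=
  (ContinuousLinearMap.hasFDerivAt (ContinuousLinearMap.apply ℝ E (Y, (0 : E)))).comp _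
    (HasFDerivAt.comp (f := fun x => (chartOne E G, x)) (chartOne E G)
      (hasFDerivAt_fderiv_chartMul (E := E) (G := G)) (hasFDerivAt_prodMk_right (chartOne E G) (chartOne E G)))

lemma chartMul_chartOne_left : (fun y => chartMul E G (chartOne E G, y)) =ᶠ[𝓝 (chartOne E G)] id := by
  filter_upwards [eventually_mem_target (E := E) (G := G)] with y hy
  rw [chartMul, symm_chartOne, one_mul, PartialEquiv.right_inv _ hy]
  rfl

lemma chartMul_chartOne_right :
    (fun y => chartMul E G (y, chartOne E G)) =ᶠ[𝓝 (chartOne E G)] id := by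
  filter_upwards [eventually_mem_target (E := E) (G := G)] with y hy
  rw [chartMul, symm_chartOne, mul_one, PartialEquiv.right_inv _ hy]
  rfl

lemma fderiv_chartMul_chartOne_left (Y : E) :
    fderiv ℝ (chartMul E G) (chartOne E G, chartOne E G) (0, Y) = Y := by
  have hd := (eventually_chartMul_differentiable (E := E) (G := G)).self_of_nhds
  have h := HasFDerivAt.comp (f := fun x => (chartOne E G, x)) (chartOne E G) hd.hasFDerivAt
    (hasFDerivAt_prodMk_right (chartOne E G) (chartOne E G))
  have h' := h.unique ((hasFDerivAt_id (𝕜 := ℝ) (chartOne E G)).congr_of_eventuallyEq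
    chartMul_chartOne_left)
  simpa using congrArg (fun L : E →L[ℝ] E => L Y) h'

lemma fderiv_chartMul_chartOne_right (Y : E) :
    fderiv ℝ (chartMul E G) (chartOne E G, chartOne E G) (Y, 0) = Y := by
  have hd := (eventually_chartMul_differentiable (E := E) (G := G)).self_of_nhds
  have h := HasFDerivAt.comp (f := fun x => (x, chartOne E G)) (chartOne E G) hd.hasFDerivAt
    (hasFDerivAt_prodMk_left (chartOne E G) (chartOne E G))
  have h' := h.unique ((hasFDerivAt_id (𝕜 := ℝ) (chartOne E G)).congr_of_eventuallyEq
    chartMul_chartOne_right)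
  simpa using congrArg (fun L : E →L[ℝ] E => L Y) h'

/-- The bracket is the antisymmetric part of the second order term of the multiplication. -/
lemma lie_eq_fderiv_fderiv (X Y : LieAlg E G) :
    (⁅X, Y⁆ : LieAlg E G) =
      (fderiv ℝ (fderiv ℝ (chartMul E G)) (chartOne E G, chartOne E G) ((X : E), 0) (0, (Y : E)) -
      fderiv ℝ (fderiv ℝ (chartMul E G)) (chartOne E G, chartOne E G) ((Y : E), 0) (0, (X : E)) :
      E) := by
  -- The bracket of vector fields on the manifold is defined through the chart. Only the germs of
  -- the fields at the base point matter, and these are given by partial derivatives of the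
  -- multiplication.
  have h : (⁅X, Y⁆ : LieAlg E G) = ContinuousLinearMap.inverse
      (modelDeriv E E (extChartAt 𝓘(ℝ, E) (1 : G)) (1 : G)) (VectorField.lieBracketWithin ℝ
        (chartField X) (chartField Y)
        ((extChartAt 𝓘(ℝ, E) (1 : G)).symm ⁻¹' univ ∩ range 𝓘(ℝ, E)) (chartOne E G)) := rfl
  rw [h, modelDeriv_extChartAt_one, ContinuousLinearMap.inverse_id]
  have hu : (extChartAt 𝓘(ℝ, E) (1 : G)).symm ⁻¹' univ ∩ range 𝓘(ℝ, E) = univ := by simp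
  rw [hu, VectorField.lieBracketWithin_univ]
  have hX := eventually_chartField (E := E) X
  have hY := eventually_chartField (E := E) Y
  refine (congrArg (ContinuousLinearMap.id ℝ E)
    (Filter.EventuallyEq.lieBracket_vectorField_eq hX hY)).trans ?_
  have eX := (hasFDerivAt_chartMul_left (E := E) (G := G) X).fderiv
  have eY := (hasFDerivAt_chartMul_left (E := E) (G := G) Y).fderiv
  have oX := fderiv_chartMul_chartOne_left (E := E) (G := G) X
  have oY := fderiv_chartMul_chartOne_left (E := E) (G := G) Y
  rw [VectorField.lieBracket, eX, eY, oX, oY]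
  rfl

/-- The derivative of the adjoint action along a curve is the bracket. -/
lemma tendsto_slope_conj [CompleteSpace E] {c : ℝ → G} {X : E} (Y : E) (hc0 : c 0 = 1)
    (hcc : Tendsto c (𝓝 0) (𝓝 1))
    (hxd : HasDerivAt (fun t => extChartAt 𝓘(ℝ, E) (1 : G) (c t)) X 0) :
    Tendsto (fun t : ℝ => t⁻¹ • (modelDeriv E E (fun z : G => c t * z * (c t)⁻¹) 1 Y - Y)) (𝓝[≠] 0)
      (𝓝 (fderiv ℝ (fderiv ℝ (chartMul E G)) (chartOne E G, chartOne E G) (X, 0) (0, Y) -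
        fderiv ℝ (fderiv ℝ (chartMul E G)) (chartOne E G, chartOne E G) (Y, 0) (0, X))) := by
  set φ := extChartAt 𝓘(ℝ, E) (1 : G) with hφ
  set e := chartOne E G
  set x : ℝ → E := fun t => φ (c t) with hx
  have hx0 : x 0 = e := by simp only [hx, hc0]; rfl
  have hsrc : ∀ᶠ t in 𝓝 (0 : ℝ), φ.symm (x t) = c t := by
    filter_upwards [hcc.eventually (extChartAt_source_mem_nhds (I := 𝓘(ℝ, E)) (1 : G))] with t ht
    exact φ.left_inv ht
  have hxt : Tendsto x (𝓝 0) (𝓝 e) := hx0 ▸ hxd.continuousAt.tendsto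
  set D2 := fderiv ℝ (fderiv ℝ (chartMul E G)) (e, e)
  have hder : HasDerivAt (fun t => fderiv ℝ (chartMul E G) (x t, e) (0, Y) -
      fderiv ℝ (chartMul E G) (e, x t) (Y, 0)) (D2 (X, 0) (0, Y) - D2 (Y, 0) (0, X)) 0 := by
    have h1 := HasFDerivAt.comp_hasDerivAt (0 : ℝ) (f := x)
      (by rw [hx0]; exact hasFDerivAt_chartMul_left (E := E) (G := G) Y) hxd
    have h2 := HasFDerivAt.comp_hasDerivAt (0 : ℝ) (f := x)
      (by rw [hx0]; exact hasFDerivAt_chartMul_right (E := E) (G := G) Y) hxd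
    -- Symmetry of the second derivative brings the second term into the form occurring in
    -- `lie_eq_fderiv_fderiv`.
    have hsymm : IsSymmSndFDerivAt ℝ (chartMul E G) (e, e) :=
      (contDiffAt_chartMul (E := E) (G := G)).isSymmSndFDerivAt (by
        simpa using (mod_cast le_top : ((2 : ℕ∞) : ℕ∞ω) ≤ ∞))
    have h3 : D2 (Y, 0) (0, X) = D2 (0, X) (Y, 0) := hsymm.eq _ _
    rw [h3]
    exact h1.sub h2
  have hslope := hder.tendsto_slope_zero
  simp only [zero_add, hx0] at hslope
  have hzero : fderiv ℝ (chartMul E G) (e, e) (0, Y) -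
      fderiv ℝ (chartMul E G) (e, e) (Y, 0) = 0 := by
    have h1 := fderiv_chartMul_chartOne_left (E := E) (G := G) Y
    have h2 := fderiv_chartMul_chartOne_right (E := E) (G := G) Y
    rw [h1, h2, sub_self]
  -- By `eventually_fderiv_chartMul_Ad`, the function differentiated above is `B t (Ad Y - Y)`.
  -- Since `B t → 1`, the operator can be inverted near `0` without changing the limit of the
  -- slopes.
  set B : ℝ → (E →L[ℝ] E) := fun t =>
    (fderiv ℝ (chartMul E G) (e, x t)).comp (ContinuousLinearMap.inl ℝ E E) with hB
  have hBt : Tendsto B (𝓝 0) (𝓝 1) := by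
    have h1 : ContinuousAt (fderiv ℝ (chartMul E G)) (e, e) :=
      (hasFDerivAt_fderiv_chartMul (E := E) (G := G)).continuousAt
    have h2 : Tendsto (fun t => (e, x t)) (𝓝 0) (𝓝 (e, e)) := by
      rw [nhds_prod_eq]; exact tendsto_const_nhds.prodMk hxt
    have h3 : Tendsto (fun t => fderiv ℝ (chartMul E G) (e, x t)) (𝓝 0)
      (𝓝 (fderiv ℝ (chartMul E G) (e, e))) := h1.tendsto.comp h2
    have h4 : (fderiv ℝ (chartMul E G) (e, e)).comp (ContinuousLinearMap.inl ℝ E E) = 1 := by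
      ext v
      simpa using fderiv_chartMul_chartOne_right (E := E) (G := G) v
    rw [← h4]
    exact ((ContinuousLinearMap.compL ℝ E (E × E) E).flip
      (ContinuousLinearMap.inl ℝ E E)).continuous.continuousAt.tendsto.comp h3
  have hinv : Tendsto (fun t => Ring.inverse (B t)) (𝓝 0) (𝓝 1) := by
    have := (NormedRing.inverse_continuousAt (1 : (E →L[ℝ] E)ˣ)).tendsto.comp hBt
    simpa using! this
  have hunit : ∀ᶠ t in 𝓝 (0 : ℝ), IsUnit (B t) :=
    hBt.eventually (Units.isOpen.mem_nhds isUnit_one)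
  have h1 : Tendsto (fun t : ℝ => Ring.inverse (B t) (t⁻¹ •
      (fderiv ℝ (chartMul E G) (x t, e) (0, Y) -
        fderiv ℝ (chartMul E G) (e, x t) (Y, 0)))) (𝓝[≠] 0)
      (𝓝 ((1 : E →L[ℝ] E) (D2 (X, 0) (0, Y) - D2 (Y, 0) (0, X)))) := by
    have h2 := (isBoundedBilinearMap_apply (𝕜 := ℝ) (E := E) (F := E)).continuous.tendsto
      (1, D2 (X, 0) (0, Y) - D2 (Y, 0) (0, X))
    refine h2.comp ((hinv.mono_left nhdsWithin_le_nhds).prodMk_nhds ?_)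
    simpa [hzero] using hslope
  refine h1.congr' ?_
  filter_upwards [nhdsWithin_le_nhds hunit, nhdsWithin_le_nhds hsrc,
    nhdsWithin_le_nhds (hxt.eventually (eventually_fderiv_chartMul_Ad (E := E) (G := G)))]
    with t hu hs hA
  have h2 : fderiv ℝ (chartMul E G) (x t, e) (0, Y) = B t (modelDeriv E E (fun z : G => c t * z * (c t)⁻¹) 1 Y) := by
    rw [← hs]; exact hA Y
  have h3 : fderiv ℝ (chartMul E G) (e, x t) (Y, 0) = B t Y := rfl
  rw [h2, h3, ← map_sub, ← map_smul]
  exact congrArg (fun L : E →L[ℝ] E => L _) (Ring.inverse_mul_cancel (B t) hu)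

/-- A subspace invariant under a Lie subgroup is invariant under the bracket with its Lie
algebra. -/
lemma AdInvariant.lie_mem [FiniteDimensional ℝ E]
    {F : Type*} [NormedAddCommGroup F] [NormedSpace ℝ F] {L : Subgroup G} [ChartedSpace F L]
    (hL : IsClosedLieSubgroup E F L) {W : Submodule ℝ (LieAlg E G)} (hW : AdInvariant E L W)
    {X Y : LieAlg E G} (hX : X ∈ subLieAlg E F L) (hY : Y ∈ W) : ⁅X, Y⁆ ∈ W := by
  obtain ⟨Z, rfl⟩ := hX
  set φ := extChartAt 𝓘(ℝ, E) (1 : G) with hφ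
  set ψ := extChartAt 𝓘(ℝ, F) (1 : L)
  have hmd : MDifferentiableAt 𝓘(ℝ, F) 𝓘(ℝ, E) (Subtype.val : L → G) 1 :=
    (hL.smooth 1).mdifferentiableAt (by simp)
  set f : F → E := fun w => φ (ψ.symm w : L)
  have hψ : ψ.symm (ψ 1) = 1 := extChartAt_to_inv (1 : L)
  have hf : HasFDerivAt f (modelDeriv F E (Subtype.val : L → G) 1) (ψ 1) := by
    have h := hmd.hasMFDerivAt.2
    have hr : range 𝓘(ℝ, F) = univ := by simp
    rw [hr] at h
    have h' : HasFDerivWithinAt f (modelDeriv F E (Subtype.val : L → G) 1) univ (ψ 1) := h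
    exact hasFDerivWithinAt_univ.1 h'
  obtain ⟨Z', hZ'⟩ : ∃ Z' : F, Z' = Z := ⟨Z, rfl⟩
  have hline : HasDerivAt (fun t : ℝ => ψ 1 + t • Z') Z' 0 := by
    simpa using! ((hasDerivAt_id (0 : ℝ)).smul_const Z').const_add (ψ 1)
  have hl0 : ψ 1 + (0 : ℝ) • Z' = ψ 1 := by simp
  -- A curve in `L` through the identity with velocity `Z'`: a straight line in the chart of `L`.
  set c : ℝ → L := fun t => ψ.symm (ψ 1 + t • Z') with hc
  have hc0 : c 0 = 1 := by simp only [hc, hl0, hψ]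
  have hcc : Tendsto (fun t => (c t : G)) (𝓝 0) (𝓝 1) := by
    have h1 : ContinuousAt ψ.symm (ψ 1 + (0 : ℝ) • Z') := by
      rw [hl0]; exact continuousAt_extChartAt_symm (1 : L)
    have h2 : ContinuousAt c 0 :=
      ContinuousAt.comp (f := fun t : ℝ => ψ 1 + t • Z') h1 hline.continuousAt
    have h3 : ContinuousAt (fun t => (c t : G)) 0 := continuous_subtype_val.continuousAt.comp h2
    have h4 : Tendsto (fun t => (c t : G)) (𝓝 0) (𝓝 (c 0 : G)) := h3
    rwa [hc0] at h4
  have hxd : HasDerivAt (fun t => φ (c t : G)) (modelDeriv F E (Subtype.val : L → G) 1 Z') 0 :=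
    HasFDerivAt.comp_hasDerivAt (f := fun t : ℝ => ψ 1 + t • Z') (0 : ℝ)
      (l := f) (by rw [hl0]; exact hf) hline
  have := FiniteDimensional.complete ℝ E
  have hfin := tendsto_slope_conj (E := E) (G := G) Y (by rw [hc0]; rfl) hcc hxd
  -- The difference quotients of `Ad` along the curve lie in `W`; their limit, the bracket, does too
  -- because `W` is closed.
  have hclosed : IsClosed ((show Submodule ℝ E from W : Submodule ℝ E) : Set E) :=
    Submodule.closed_of_finiteDimensional _
  have hmem := hclosed.mem_of_tendsto hfin
    (Eventually.of_forall fun t => W.smul_mem _ (W.sub_mem (hW _ (c t).2 Y hY) hY))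
  rw [lie_eq_fderiv_fderiv, ← hZ']
  exact hmem

/-- The inclusion of a Lie subgroup intertwines the adjoint actions. -/
lemma inclDeriv_Ad {F : Type*} [NormedAddCommGroup F] [NormedSpace ℝ F] {L : Subgroup G}
    [ChartedSpace F L] [LieGroup 𝓘(ℝ, F) ∞ L] (hL : IsClosedLieSubgroup E F L) (h : L)
    (Z : LieAlg F L) : inclDeriv E F L (Ad F h Z) = Ad E (h : G) (inclDeriv E F L Z) := by
  have hmd : MDifferentiableAt 𝓘(ℝ, F) 𝓘(ℝ, E) (Subtype.val : L → G) 1 :=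
    (hL.smooth 1).mdifferentiableAt (by simp)
  have h1 := modelDeriv_comp_apply (E := F) (F := F) (E' := E) (f := (Subtype.val : L → G))
    (h := fun x : L => h * x * h⁻¹) (by simp) hmd (mdifferentiable_conj h (1 : L)) Z
  have h2 := modelDeriv_comp_apply (E := F) (F := E) (E' := E) (h := (Subtype.val : L → G))
    (f := fun x : G => h * x * (h : G)⁻¹) (x := (1 : L)) rfl
    (mdifferentiable_conj (h : G) (1 : G)) hmd Z
  exact h1.symm.trans h2

lemma adInvariant_subLieAlg {F : Type*} [NormedAddCommGroup F] [NormedSpace ℝ F] {L : Subgroup G}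
    [ChartedSpace F L] [LieGroup 𝓘(ℝ, F) ∞ L] (hL : IsClosedLieSubgroup E F L) :
    AdInvariant E L (subLieAlg E F L) := by
  rintro k hk _ ⟨Z, rfl⟩
  exact ⟨Ad F ⟨k, hk⟩ Z, inclDeriv_Ad hL ⟨k, hk⟩ Z⟩

lemma killingForm_Ad [CompleteSpace E] (g : G) (X Y : LieAlg E G) :
    killingForm ℝ (LieAlg E G) (Ad E g X) (Ad E g Y) = killingForm ℝ (LieAlg E G) X Y :=
  LieAlgebra.killingForm_of_equiv_apply (AdLieEquiv (E := E) g) X Y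

end ChartMul

/-! ### Invariant bilinear forms on irreducible summands -/

section Schur

variable {E : Type*} [NormedAddCommGroup E] [NormedSpace ℝ E]
  {G : Type*} [TopologicalSpace G] [ChartedSpace E G] [Group G] [LieGroup 𝓘(ℝ, E) ∞ G]
  [CompleteSpace E]

variable (E G) in
/-- The negative of the Killing form. -/
def negKilling : LieAlg E G →ₗ[ℝ] LieAlg E G →ₗ[ℝ] ℝ := -killingForm ℝ (LieAlg E G)

lemma negKilling_apply (X Y : LieAlg E G) :
    negKilling E G X Y = -killingForm ℝ (LieAlg E G) X Y := rfl

lemma negKilling_comm (X Y : LieAlg E G) : negKilling E G X Y = negKilling E G Y X := by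
  rw [negKilling_apply, negKilling_apply]
  exact congrArg _ (LieModule.traceForm_comm ℝ (LieAlg E G) (LieAlg E G) X Y)

lemma negKilling_lie (X Y Z : LieAlg E G) :
    negKilling E G ⁅X, Y⁆ Z = negKilling E G X ⁅Y, Z⁆ := by
  rw [negKilling_apply, negKilling_apply]
  exact congrArg _ (LieModule.traceForm_apply_lie_apply ℝ (LieAlg E G) (LieAlg E G) X Y Z)

lemma negKilling_Ad (g : G) (X Y : LieAlg E G) :
    negKilling E G (Ad E g X) (Ad E g Y) = negKilling E G X Y := by
  rw [negKilling_apply, negKilling_apply, killingForm_Ad]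

/-- A bilinear form on the Lie algebra is invariant under a subgroup. -/
def FormInvariant (L : Subgroup G) (T : LieAlg E G →ₗ[ℝ] LieAlg E G →ₗ[ℝ] ℝ) : Prop :=
  ∀ k ∈ L, ∀ X Y, T (Ad E k X) (Ad E k Y) = T X Y

lemma formInvariant_negKilling (L : Subgroup G) : FormInvariant L (negKilling E G) :=
  fun k _ X Y => negKilling_Ad k X Y

lemma FormInvariant.apply_Ad {L : Subgroup G} {T : LieAlg E G →ₗ[ℝ] LieAlg E G →ₗ[ℝ] ℝ}
    (hT : FormInvariant L T) {k : G} (hk : k ∈ L) (X Y : LieAlg E G) :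
    T (Ad E k X) Y = T X (Ad E k⁻¹ Y) := by
  conv_lhs => rw [← Ad_Ad_inv (E := E) k Y]
  exact hT k hk _ _

variable {L : Subgroup G} {p q : Submodule ℝ (LieAlg E G)} {d : ℕ} {b : ℝ}

lemma eq_sum_repr_smul (e : Module.Basis (Fin d) ℝ q) {Y : LieAlg E G} (hY : Y ∈ q) :
    Y = ∑ i, e.repr ⟨Y, hY⟩ i • (e i : LieAlg E G) := by
  have := congrArg q.subtype (e.sum_repr ⟨Y, hY⟩)
  rw [map_sum] at this
  exact this.symm

lemma eq_of_forall_basis (e : Module.Basis (Fin d) ℝ q) {f g : LieAlg E G →ₗ[ℝ] ℝ}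
    (h : ∀ i, f (e i) = g (e i)) {Y : LieAlg E G} (hY : Y ∈ q) : f Y = g Y := by
  rw [eq_sum_repr_smul e hY, map_sum, map_sum]
  exact Finset.sum_congr rfl fun i _ => by rw [map_smul, map_smul, h]

/-- Nondegeneracy on one summand is what is available: on all of `𝔤` the Killing form may
degenerate. -/
lemma negKilling_eq_zero_of_forall (e : Module.Basis (Fin d) ℝ q) (hb : 0 < b)
    (he : ∀ i j, negKilling E G (e i) (e j) = b * if i = j then 1 else 0)
    {Z : LieAlg E G} (hZ : Z ∈ q) (h : ∀ Y ∈ q, negKilling E G Z Y = 0) : Z = 0 := by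
  have h1 : (Z : LieAlg E G) = ∑ i, e.repr ⟨Z, hZ⟩ i • (e i : LieAlg E G) :=
    eq_sum_repr_smul e hZ
  have h2 : ∀ j, e.repr ⟨Z, hZ⟩ j = 0 := fun j => by
    have h3 := h (e j) (e j).2
    rw [h1, map_sum, LinearMap.sum_apply] at h3
    simp only [map_smul, LinearMap.smul_apply, he, smul_eq_mul] at h3
    simpa [hb.ne'] using h3
  rw [h1]
  simp [h2]

/-- The map representing a bilinear form with respect to an orthogonal basis. -/
def formMap (T : LieAlg E G →ₗ[ℝ] LieAlg E G →ₗ[ℝ] ℝ) (e : Module.Basis (Fin d) ℝ q) (b : ℝ) :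
    LieAlg E G →ₗ[ℝ] LieAlg E G :=
  ∑ j, ((b⁻¹ • T.flip (e j : LieAlg E G)).smulRight (e j : LieAlg E G))

lemma formMap_apply (T : LieAlg E G →ₗ[ℝ] LieAlg E G →ₗ[ℝ] ℝ) (e : Module.Basis (Fin d) ℝ q)
    (X : LieAlg E G) : formMap T e b X = ∑ j, (b⁻¹ * T X (e j)) • (e j : LieAlg E G) := by
  simp [formMap, LinearMap.sum_apply]

lemma formMap_mem (T : LieAlg E G →ₗ[ℝ] LieAlg E G →ₗ[ℝ] ℝ) (e : Module.Basis (Fin d) ℝ q)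
    (X : LieAlg E G) : formMap T e b X ∈ q := by
  rw [formMap_apply]
  exact q.sum_mem fun j _ => q.smul_mem _ (e j).2

lemma negKilling_formMap (T : LieAlg E G →ₗ[ℝ] LieAlg E G →ₗ[ℝ] ℝ) (e : Module.Basis (Fin d) ℝ q)
    (hb : 0 < b) (he : ∀ i j, negKilling E G (e i) (e j) = b * if i = j then 1 else 0)
    (X : LieAlg E G) {Y : LieAlg E G} (hY : Y ∈ q) :
    negKilling E G (formMap T e b X) Y = T X Y := by
  have h2 : ∀ i, negKilling E G (formMap T e b X) (e i) = T X (e i) := fun i => by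
    rw [formMap_apply, map_sum, LinearMap.sum_apply]
    simp only [map_smul, LinearMap.smul_apply, he, smul_eq_mul]
    simp
    field_simp
  exact eq_of_forall_basis e h2 hY

/-- Schur's lemma for two inequivalent summands. -/
lemma FormInvariant.eq_zero (hp : AdIrreducible E L p) (hq : AdIrreducible E L q)
    (hpq : ¬ AdEquivalent E L p q) (e : Module.Basis (Fin d) ℝ q) (hb : 0 < b)
    (he : ∀ i j, negKilling E G (e i) (e j) = b * if i = j then 1 else 0)
    {T : LieAlg E G →ₗ[ℝ] LieAlg E G →ₗ[ℝ] ℝ} (hT : FormInvariant L T)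
    {X Y : LieAlg E G} (hX : X ∈ p) (hY : Y ∈ q) : T X Y = 0 := by
  obtain ⟨φ, hφdef⟩ : ∃ φ, φ = formMap T e b := ⟨_, rfl⟩
  have hφT : ∀ X, ∀ Y ∈ q, negKilling E G (φ X) Y = T X Y := fun X Y hY =>
    hφdef ▸ negKilling_formMap T e hb he X hY
  have hφm : ∀ X, φ X ∈ q := fun X => hφdef ▸ formMap_mem T e X
  have hφ : ∀ k ∈ L, ∀ X, φ (Ad E k X) = Ad E k (φ X) := fun k hk X => by
    rw [← sub_eq_zero]
    refine negKilling_eq_zero_of_forall e hb he (q.sub_mem (hφm _)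
      (hq.invariant k hk _ (hφm _))) fun Z hZ => ?_
    rw [map_sub, LinearMap.sub_apply, hφT _ _ hZ,
      (formInvariant_negKilling L).apply_Ad hk, hφT _ _ (hq.invariant _ (L.inv_mem hk) _ hZ),
      hT.apply_Ad hk, sub_self]
  -- The representing map intertwines the actions, so its kernel in `p` and its image are invariant.
  -- It is zero on `p` or an isomorphism onto `q`, and the latter contradicts inequivalence.
  have hker := hp.eq_bot_or_eq (p ⊓ LinearMap.ker φ) inf_le_left fun k hk X hX =>
    ⟨hp.invariant k hk X hX.1, by
      rw [SetLike.mem_coe, LinearMap.mem_ker, hφ k hk, LinearMap.mem_ker.1 hX.2]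
      exact map_zero (AdLinear E k)⟩
  rcases hker with hker | hker
  · exfalso
    have hinj : ∀ X ∈ p, φ X = 0 → X = 0 := fun X hX h => by
      have : X ∈ p ⊓ LinearMap.ker φ := ⟨hX, h⟩
      rwa [hker, Submodule.mem_bot] at this
    have hran := hq.eq_bot_or_eq (p.map φ)
      (by rintro _ ⟨X, -, rfl⟩; exact hφm X)
      (by rintro k hk _ ⟨X, hX, rfl⟩; exact ⟨Ad E k X, hp.invariant k hk X hX, hφ k hk X⟩)
    rcases hran with hran | hran
    · refine hp.ne_bot ((Submodule.eq_bot_iff _).2 fun X hX => hinj X hX ?_)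
      have : φ X ∈ p.map φ := ⟨X, hX, rfl⟩
      rwa [hran, Submodule.mem_bot] at this
    · let ψ : p →ₗ[ℝ] q := LinearMap.codRestrict q (φ.comp p.subtype) fun X => hφm X
      have hψ : Function.Bijective ψ := by
        refine ⟨(injective_iff_map_eq_zero ψ).2 fun X hX =>
          Subtype.ext (hinj X X.2 (congrArg Subtype.val hX)), fun Y => ?_⟩
        have hY : (Y : LieAlg E G) ∈ p.map φ := hran ▸ Y.2
        obtain ⟨X, hX, h⟩ := hY
        exact ⟨⟨X, hX⟩, Subtype.ext h⟩
      refine hpq ⟨LinearEquiv.ofBijective ψ hψ, fun k hk X Y h => ?_⟩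
      change φ (Y : LieAlg E G) = Ad E k (φ X)
      rw [h, hφ k hk]
  · have hX0 : X ∈ p ⊓ LinearMap.ker φ := by rw [hker]; exact hX
    rw [← hφT X Y hY, LinearMap.mem_ker.1 hX0.2, map_zero, LinearMap.zero_apply]

/-- Schur's lemma for one summand. -/
lemma FormInvariant.exists_eq_mul (hp : AdIrreducible E L p) (e : Module.Basis (Fin d) ℝ p)
    (hb : 0 < b) (he : ∀ i j, negKilling E G (e i) (e j) = b * if i = j then 1 else 0)
    {T : LieAlg E G →ₗ[ℝ] LieAlg E G →ₗ[ℝ] ℝ} (hT : FormInvariant L T)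
    (hsymm : ∀ X ∈ p, ∀ Y ∈ p, T X Y = T Y X) :
    ∃ c : ℝ, ∀ X ∈ p, ∀ Y ∈ p, T X Y = c * negKilling E G X Y := by
  -- Symmetry of the form supplies a real eigenvector. It is indispensable: a real irreducible
  -- representation may have commutant larger than `ℝ`.
  set M : Matrix (Fin d) (Fin d) ℝ := Matrix.of fun i j => T (e i) (e j)
  have hM : M.IsHermitian := Matrix.IsHermitian.ext fun i j => by
    simp only [M, Matrix.of_apply, star_trivial]
    exact hsymm _ (e j).2 _ (e i).2
  have hd : Nonempty (Fin d) := by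
    by_contra h
    rw [not_nonempty_iff] at h
    refine hp.ne_bot ((Submodule.eq_bot_iff _).2 fun X hX => ?_)
    rw [eq_sum_repr_smul e hX]
    exact Finset.sum_eq_zero fun i _ => h.elim i
  obtain ⟨i₀⟩ := hd
  set v : Fin d → ℝ := ⇑(hM.eigenvectorBasis i₀)
  set μ := hM.eigenvalues i₀
  have hv : ∀ i, ∑ j, M i j * v j = μ * v i := fun i => by
    have := congrFun (hM.mulVec_eigenvectorBasis i₀) i
    simpa [Matrix.mulVec, dotProduct] using this
  have hv0 : ∃ i, v i ≠ 0 := by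
    by_contra! h
    refine hM.eigenvectorBasis.orthonormal.ne_zero i₀ ?_
    ext i
    exact h i
  set X₀ : LieAlg E G := ∑ j, v j • (e j : LieAlg E G)
  have hX₀p : X₀ ∈ p := p.sum_mem fun j _ => p.smul_mem _ (e j).2
  have hk₀ : ∀ i, negKilling E G X₀ (e i) = b * v i := fun i => by
    simp only [X₀, map_sum, LinearMap.sum_apply, map_smul, LinearMap.smul_apply, he, smul_eq_mul]
    simp
    ring
  have hX₀0 : X₀ ≠ 0 := fun h => by
    obtain ⟨i, hi⟩ := hv0
    have := hk₀ i
    rw [h, map_zero, LinearMap.zero_apply, zero_eq_mul] at this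
    exact this.elim hb.ne' hi
  have hT₀ : ∀ i, T X₀ (e i) = μ / b * negKilling E G X₀ (e i) := fun i => by
    rw [hk₀, hsymm _ hX₀p _ (e i).2]
    simp only [X₀, map_sum, map_smul, smul_eq_mul]
    have := hv i
    simp only [M, Matrix.of_apply] at this
    rw [div_mul_eq_mul_div, eq_div_iff hb.ne']
    rw [show μ * (b * v i) = (μ * v i) * b by ring, ← this]
    congr 1
    exact Finset.sum_congr rfl fun j _ => mul_comm _ _
  have hT₀' : ∀ Y ∈ p, T X₀ Y = μ / b * negKilling E G X₀ Y := fun Y hY =>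
    eq_of_forall_basis e (f := T X₀) (g := (μ / b) • negKilling E G X₀) hT₀ hY
  set S := T - (μ / b) • negKilling E G
  have hS : FormInvariant L S := fun k hk X Y => by
    simp only [S, LinearMap.sub_apply, LinearMap.smul_apply, hT k hk, negKilling_Ad]
  -- The radical in `p` of the form minus its eigenvalue multiple of `-B`. It is invariant and
  -- contains the eigenvector, hence is all of `p`.
  set N : Submodule ℝ (LieAlg E G) :=
    { carrier := {X | X ∈ p ∧ ∀ Y ∈ p, S X Y = 0}
      add_mem' := fun {X Z} hX hZ => ⟨p.add_mem hX.1 hZ.1, fun Y hY => by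
        rw [map_add, LinearMap.add_apply, hX.2 Y hY, hZ.2 Y hY, add_zero]⟩
      zero_mem' := ⟨p.zero_mem, fun Y _ => by rw [map_zero, LinearMap.zero_apply]⟩
      smul_mem' := fun c X hX => ⟨p.smul_mem c hX.1, fun Y hY => by
        rw [map_smul, LinearMap.smul_apply, hX.2 Y hY, smul_zero]⟩ }
  have hN := hp.eq_bot_or_eq N (fun X hX => hX.1) fun k hk X hX =>
    ⟨hp.invariant k hk X hX.1, fun Y hY => by
      rw [hS.apply_Ad hk]
      exact hX.2 _ (hp.invariant _ (L.inv_mem hk) Y hY)⟩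
  have hX₀N : X₀ ∈ N := ⟨hX₀p, fun Y hY => by
    simp only [S, LinearMap.sub_apply, LinearMap.smul_apply, smul_eq_mul, hT₀' Y hY, sub_self]⟩
  rcases hN with hN | hN
  · rw [hN, Submodule.mem_bot] at hX₀N
    exact absurd hX₀N hX₀0
  · refine ⟨μ / b, fun X hX Y hY => ?_⟩
    have hXN : X ∈ N := hN ▸ hX
    have := hXN.2 Y hY
    simpa [S, sub_eq_zero] using this

end Schur

namespace TwoSummands

/-! ### Projections and the Killing form in the basis of `𝔭` -/

section Coordinates

variable {E : Type*} [NormedAddCommGroup E] [NormedSpace ℝ E]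
  {G : Type*} [TopologicalSpace G] [ChartedSpace E G] [Group G] [LieGroup 𝓘(ℝ, E) ∞ G]
  [CompleteSpace E]
  {EK : Type*} [NormedAddCommGroup EK] [NormedSpace ℝ EK]
  {EH : Type*} [NormedAddCommGroup EH] [NormedSpace ℝ EH]
  {K H : Subgroup G} [ChartedSpace EK K] [ChartedSpace EH H]
  (D : TwoSummands E EK EH K H)

lemma negKilling_e₁ (i j) :
    negKilling E G (D.e₁ i) (D.e₁ j) = D.b₁ * if i = j then 1 else 0 := D.orthonormal_e₁ i j

lemma negKilling_e₂ (i j) :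
    negKilling E G (D.e₂ i) (D.e₂ j) = D.b₂ * if i = j then 1 else 0 := D.orthonormal_e₂ i j

/-- Orthogonality of the two summands is not part of the data; it follows from their inequivalence.
-/
lemma negKilling_p₁_p₂ {X Y : LieAlg E G} (hX : X ∈ D.p₁) (hY : Y ∈ D.p₂) :
    negKilling E G X Y = 0 :=
  (formInvariant_negKilling K).eq_zero D.irreducible_p₁ D.irreducible_p₂ D.inequivalent D.e₂
    D.b₂_pos D.negKilling_e₂ hX hY

lemma negKilling_p₂_p₁ {X Y : LieAlg E G} (hX : X ∈ D.p₂) (hY : Y ∈ D.p₁) :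
    negKilling E G X Y = 0 := by
  rw [negKilling_comm, D.negKilling_p₁_p₂ hY hX]

lemma negKilling_k_p {X Y : LieAlg E G} (hX : X ∈ subLieAlg E EK K) (hY : Y ∈ D.p₁ ⊔ D.p₂) :
    negKilling E G X Y = 0 := by
  rw [negKilling_apply, D.killing_orthogonal X hX Y hY, neg_zero]

lemma p₁_le : D.p₁ ≤ D.p₁ ⊔ D.p₂ := le_sup_left

lemma p₂_le : D.p₂ ≤ D.p₁ ⊔ D.p₂ := le_sup_right

lemma pr₁_mem (X : LieAlg E G) : D.pr₁ X ∈ D.p₁ := Submodule.projection_apply_mem _ _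

lemma pr₂_mem (X : LieAlg E G) : D.pr₂ X ∈ D.p₂ := Submodule.projection_apply_mem _ _

lemma prK_mem (X : LieAlg E G) : D.prK X ∈ subLieAlg E EK K := Submodule.projection_apply_mem _ _

lemma negKilling_pr₁ (X : LieAlg E G) {Y : LieAlg E G} (hY : Y ∈ D.p₁) :
    negKilling E G (D.pr₁ X) Y = negKilling E G X Y := by
  have h : X - D.pr₁ X ∈ subLieAlg E EK K ⊔ D.p₂ := Submodule.sub_projection_mem _ _
  obtain ⟨k, hk, Z, hZ, h⟩ := Submodule.mem_sup.1 h
  have h1 : X = D.pr₁ X + (k + Z) := by rw [h]; abel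
  conv_rhs => rw [h1]
  rw [map_add, map_add, LinearMap.add_apply, LinearMap.add_apply,
    D.negKilling_k_p hk (D.p₁_le hY), D.negKilling_p₂_p₁ hZ hY]
  simp

lemma negKilling_pr₂ (X : LieAlg E G) {Y : LieAlg E G} (hY : Y ∈ D.p₂) :
    negKilling E G (D.pr₂ X) Y = negKilling E G X Y := by
  have h : X - D.pr₂ X ∈ subLieAlg E EK K ⊔ D.p₁ := Submodule.sub_projection_mem _ _
  obtain ⟨k, hk, Z, hZ, h⟩ := Submodule.mem_sup.1 h
  have h1 : X = D.pr₂ X + (k + Z) := by rw [h]; abel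
  conv_rhs => rw [h1]
  rw [map_add, map_add, LinearMap.add_apply, LinearMap.add_apply,
    D.negKilling_k_p hk (D.p₂_le hY), D.negKilling_p₁_p₂ hZ hY]
  simp

/-- The projection is orthogonal for `-B`, so it has an explicit expansion in the basis, from which
traces become sums of structure constants. -/
lemma pr₁_eq_formMap : D.pr₁ = formMap (negKilling E G) D.e₁ D.b₁ := by
  ext X
  rw [← sub_eq_zero]
  refine negKilling_eq_zero_of_forall D.e₁ D.b₁_pos D.negKilling_e₁
    (D.p₁.sub_mem (D.pr₁_mem X) (formMap_mem _ _ _)) fun Y hY => ?_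
  rw [map_sub, LinearMap.sub_apply, D.negKilling_pr₁ X hY,
    negKilling_formMap _ _ D.b₁_pos D.negKilling_e₁ X hY, sub_self]

lemma pr₂_eq_formMap : D.pr₂ = formMap (negKilling E G) D.e₂ D.b₂ := by
  ext X
  rw [← sub_eq_zero]
  refine negKilling_eq_zero_of_forall D.e₂ D.b₂_pos D.negKilling_e₂
    (D.p₂.sub_mem (D.pr₂_mem X) (formMap_mem _ _ _)) fun Y hY => ?_
  rw [map_sub, LinearMap.sub_apply, D.negKilling_pr₂ X hY,
    negKilling_formMap _ _ D.b₂_pos D.negKilling_e₂ X hY, sub_self]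

lemma pr₁_of_mem_p₁ {X : LieAlg E G} (hX : X ∈ D.p₁) : D.pr₁ X = X :=
  Submodule.projection_apply_of_mem_left _ hX

lemma pr₂_of_mem_p₂ {X : LieAlg E G} (hX : X ∈ D.p₂) : D.pr₂ X = X :=
  Submodule.projection_apply_of_mem_left _ hX

lemma pr₁_of_mem_p₂ {X : LieAlg E G} (hX : X ∈ D.p₂) : D.pr₁ X = 0 :=
  (Submodule.projection_apply_eq_zero_iff _).2 (Submodule.mem_sup_right hX)

lemma pr₂_of_mem_p₁ {X : LieAlg E G} (hX : X ∈ D.p₁) : D.pr₂ X = 0 :=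
  (Submodule.projection_apply_eq_zero_iff _).2 (Submodule.mem_sup_right hX)

lemma pr₁_of_mem_k {X : LieAlg E G} (hX : X ∈ subLieAlg E EK K) : D.pr₁ X = 0 :=
  (Submodule.projection_apply_eq_zero_iff _).2 (Submodule.mem_sup_left hX)

lemma pr₂_of_mem_k {X : LieAlg E G} (hX : X ∈ subLieAlg E EK K) : D.pr₂ X = 0 :=
  (Submodule.projection_apply_eq_zero_iff _).2 (Submodule.mem_sup_left hX)

lemma prK_of_mem_p {X : LieAlg E G} (hX : X ∈ D.p₁ ⊔ D.p₂) : D.prK X = 0 :=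
  (Submodule.projection_apply_eq_zero_iff _).2 hX

lemma prP_mem (X : LieAlg E G) : D.prP X ∈ D.p₁ ⊔ D.p₂ :=
  add_mem (D.p₁_le (D.pr₁_mem X)) (D.p₂_le (D.pr₂_mem X))

lemma prK_add_prP (X : LieAlg E G) : D.prK X + D.prP X = X := by
  have h : X - D.prK X ∈ D.p₁ ⊔ D.p₂ := Submodule.sub_projection_mem _ _
  obtain ⟨Y, hY, Z, hZ, h⟩ := Submodule.mem_sup.1 h
  have h1 : X = D.prK X + (Y + Z) := by rw [h]; abel
  have h2 : D.pr₁ X = Y := by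
    conv_lhs => rw [h1]
    rw [map_add, map_add, D.pr₁_of_mem_k (D.prK_mem X), D.pr₁_of_mem_p₁ hY, D.pr₁_of_mem_p₂ hZ]
    simp
  have h3 : D.pr₂ X = Z := by
    conv_lhs => rw [h1]
    rw [map_add, map_add, D.pr₂_of_mem_k (D.prK_mem X), D.pr₂_of_mem_p₁ hY, D.pr₂_of_mem_p₂ hZ]
    simp
  rw [prP, h2, h3, ← h1]

lemma prP_of_mem {X : LieAlg E G} (hX : X ∈ D.p₁ ⊔ D.p₂) : D.prP X = X := by
  have := D.prK_add_prP X
  rwa [D.prK_of_mem_p hX, zero_add] at this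

/-- The squared length of the vectors of `basis` for `-B`. -/
abbrev killingWeight : Fin D.d₁ ⊕ Fin D.d₂ → ℝ := D.weight D.b₁ D.b₂

lemma weight_pos {x₁ x₂ : ℝ} (h₁ : 0 < x₁) (h₂ : 0 < x₂) (a) : 0 < D.weight x₁ x₂ a := by
  rcases a with a | a
  exacts [h₁, h₂]

lemma killingWeight_ne_zero (a) : D.killingWeight a ≠ 0 := (D.weight_pos D.b₁_pos D.b₂_pos a).ne'

lemma weight_eq_mul (x₁ x₂ : ℝ) (a) :
    D.weight x₁ x₂ a = D.weight (x₁ / D.b₁) (x₂ / D.b₂) a * D.killingWeight a := by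
  have h₁ := D.b₁_pos.ne'
  have h₂ := D.b₂_pos.ne'
  rcases a with a | a <;> simp [weight, h₁, h₂]

lemma basis_mem (a) : D.basis a ∈ D.p₁ ⊔ D.p₂ := by
  rcases a with a | a
  exacts [D.p₁_le (D.e₁ a).2, D.p₂_le (D.e₂ a).2]

lemma negKilling_basis (a c) :
    negKilling E G (D.basis a) (D.basis c) = if a = c then D.killingWeight a else 0 := by
  rcases a with a | a <;> rcases c with c | c
  · simpa [basis, weight] using D.negKilling_e₁ a c
  · simpa [basis, weight] using D.negKilling_p₁_p₂ (D.e₁ a).2 (D.e₂ c).2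
  · simpa [basis, weight] using D.negKilling_p₂_p₁ (D.e₂ a).2 (D.e₁ c).2
  · simpa [basis, weight] using D.negKilling_e₂ a c

lemma pr₁_apply (X : LieAlg E G) :
    D.pr₁ X = ∑ i, (negKilling E G X (D.e₁ i) / D.b₁) • (D.e₁ i : LieAlg E G) := by
  rw [D.pr₁_eq_formMap, formMap_apply]
  exact Finset.sum_congr rfl fun i _ => by rw [div_eq_inv_mul]

lemma pr₂_apply (X : LieAlg E G) :
    D.pr₂ X = ∑ i, (negKilling E G X (D.e₂ i) / D.b₂) • (D.e₂ i : LieAlg E G) := by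
  rw [D.pr₂_eq_formMap, formMap_apply]
  exact Finset.sum_congr rfl fun i _ => by rw [div_eq_inv_mul]

lemma prP_eq_sum (X : LieAlg E G) :
    D.prP X = ∑ a, (negKilling E G X (D.basis a) / D.killingWeight a) • D.basis a := by
  rw [prP, D.pr₁_apply, D.pr₂_apply, Fintype.sum_sum_type]
  rfl

lemma negKilling_prP (X : LieAlg E G) {Y : LieAlg E G} (hY : Y ∈ D.p₁ ⊔ D.p₂) :
    negKilling E G (D.prP X) Y = negKilling E G X Y := by
  conv_rhs => rw [← D.prK_add_prP X]
  rw [map_add, LinearMap.add_apply, D.negKilling_k_p (D.prK_mem X) hY, zero_add]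

lemma negKilling_eq_sum (X : LieAlg E G) {Y : LieAlg E G} (hY : Y ∈ D.p₁ ⊔ D.p₂) :
    negKilling E G X Y = ∑ a, negKilling E G X (D.basis a) * negKilling E G Y (D.basis a) /
      D.killingWeight a := by
  rw [← D.negKilling_prP X hY, D.prP_eq_sum, map_sum, LinearMap.sum_apply]
  refine Finset.sum_congr rfl fun a _ => ?_
  rw [map_smul, LinearMap.smul_apply, negKilling_comm (D.basis a), smul_eq_mul]
  ring

lemma Q₁_eq (X Y : LieAlg E G) : D.Q₁ X Y = negKilling E G (D.pr₁ X) Y / D.b₁ := by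
  rw [Q₁, ← negKilling_apply, negKilling_comm (D.pr₁ X) Y, ← D.negKilling_pr₁ Y (D.pr₁_mem X),
    negKilling_comm]

lemma Q₂_eq (X Y : LieAlg E G) : D.Q₂ X Y = negKilling E G (D.pr₂ X) Y / D.b₂ := by
  rw [Q₂, ← negKilling_apply, negKilling_comm (D.pr₂ X) Y, ← D.negKilling_pr₂ Y (D.pr₂_mem X),
    negKilling_comm]

lemma Q₁_comm (X Y : LieAlg E G) : D.Q₁ X Y = D.Q₁ Y X := by
  rw [Q₁, Q₁, ← negKilling_apply, negKilling_comm, negKilling_apply]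

lemma Q₂_comm (X Y : LieAlg E G) : D.Q₂ X Y = D.Q₂ Y X := by
  rw [Q₂, Q₂, ← negKilling_apply, negKilling_comm, negKilling_apply]

lemma metric_comm (x₁ x₂ : ℝ) (X Y : LieAlg E G) : D.metric x₁ x₂ X Y = D.metric x₁ x₂ Y X := by
  rw [metric, metric, D.Q₁_comm, D.Q₂_comm]

lemma Q₁_of_mem_p₁ {X : LieAlg E G} (hX : X ∈ D.p₁) (Y : LieAlg E G) :
    D.Q₁ X Y = negKilling E G X Y / D.b₁ := by
  rw [Q₁_eq, D.pr₁_of_mem_p₁ hX]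

lemma Q₂_of_mem_p₂ {X : LieAlg E G} (hX : X ∈ D.p₂) (Y : LieAlg E G) :
    D.Q₂ X Y = negKilling E G X Y / D.b₂ := by
  rw [Q₂_eq, D.pr₂_of_mem_p₂ hX]

lemma Q₁_of_mem_p₂ {X : LieAlg E G} (hX : X ∈ D.p₂) (Y : LieAlg E G) : D.Q₁ X Y = 0 := by
  rw [Q₁_eq, D.pr₁_of_mem_p₂ hX, map_zero, LinearMap.zero_apply, zero_div]

lemma Q₂_of_mem_p₁ {X : LieAlg E G} (hX : X ∈ D.p₁) (Y : LieAlg E G) : D.Q₂ X Y = 0 := by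
  rw [Q₂_eq, D.pr₂_of_mem_p₁ hX, map_zero, LinearMap.zero_apply, zero_div]

/-- `X` is an eigenvector, with eigenvalue `l`, of the metric `(x₁, x₂)` with respect to `-B`. -/
def IsEigen (x₁ x₂ l : ℝ) (X : LieAlg E G) : Prop :=
  ∀ Y, D.metric x₁ x₂ X Y = l * negKilling E G X Y

lemma isEigen_p₁ (x₁ x₂ : ℝ) {X : LieAlg E G} (hX : X ∈ D.p₁) :
    D.IsEigen x₁ x₂ (x₁ / D.b₁) X := fun Y => by
  rw [metric, D.Q₁_of_mem_p₁ hX, D.Q₂_of_mem_p₁ hX]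
  ring

lemma isEigen_p₂ (x₁ x₂ : ℝ) {X : LieAlg E G} (hX : X ∈ D.p₂) :
    D.IsEigen x₁ x₂ (x₂ / D.b₂) X := fun Y => by
  rw [metric, D.Q₁_of_mem_p₂ hX, D.Q₂_of_mem_p₂ hX]
  ring

lemma isEigen_basis (x₁ x₂ : ℝ) (a) :
    D.IsEigen x₁ x₂ (D.weight (x₁ / D.b₁) (x₂ / D.b₂) a) (D.basis a) := by
  rcases a with a | a
  exacts [D.isEigen_p₁ x₁ x₂ (D.e₁ a).2, D.isEigen_p₂ x₁ x₂ (D.e₂ a).2]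

/-- The metric `(x₁, x₂)` as a bilinear form. -/
def metricForm (x₁ x₂ : ℝ) : LieAlg E G →ₗ[ℝ] LieAlg E G →ₗ[ℝ] ℝ :=
  (x₁ / D.b₁) • (negKilling E G).comp D.pr₁ + (x₂ / D.b₂) • (negKilling E G).comp D.pr₂

lemma metricForm_apply (x₁ x₂ : ℝ) (X Y : LieAlg E G) :
    D.metricForm x₁ x₂ X Y = D.metric x₁ x₂ X Y := by
  simp only [metricForm, metric, Q₁_eq, Q₂_eq, LinearMap.add_apply, LinearMap.smul_apply,
    LinearMap.comp_apply, smul_eq_mul]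
  ring

/-- The Koszul formula in the eigenbasis. -/
lemma IsEigen.koszul {x₁ x₂ l m : ℝ} {X Y : LieAlg E G} (hX : D.IsEigen x₁ x₂ l X)
    (hY : D.IsEigen x₁ x₂ m Y) (a) :
    D.koszul x₁ x₂ X Y (D.basis a) = (D.weight (x₁ / D.b₁) (x₂ / D.b₂) a + m - l) / 2 *
      negKilling E G ⁅X, Y⁆ (D.basis a) := by
  -- By `ad`-invariance of `-B` all three Koszul terms are the same structure constant up to sign;
  -- the eigenvalues are the only weights left.
  have h1 : negKilling E G Y ⁅D.basis a, X⁆ = negKilling E G ⁅X, Y⁆ (D.basis a) := by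
    rw [negKilling_comm, negKilling_lie, negKilling_comm]
  have h2 : negKilling E G X ⁅D.basis a, Y⁆ = -negKilling E G ⁅X, Y⁆ (D.basis a) := by
    rw [← lie_skew, map_neg, negKilling_lie]
  rw [TwoSummands.koszul, D.metric_comm _ _ ⁅X, Y⁆, D.metric_comm _ _ ⁅D.basis a, X⁆,
    D.isEigen_basis, hX, hY, h1, h2, negKilling_comm]
  ring

end Coordinates

end TwoSummands

/-! ### Invariance and the structure forms -/

section StructureForms

variable {E : Type*} [NormedAddCommGroup E] [NormedSpace ℝ E]
  {G : Type*} [TopologicalSpace G] [ChartedSpace E G] [Group G] [LieGroup 𝓘(ℝ, E) ∞ G]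
  [CompleteSpace E]

/-- The bilinear form `(X, Y) ↦ -tr (P ∘ ad Y ∘ P' ∘ ad X)`. -/
def bracketForm (P P' : LieAlg E G →ₗ[ℝ] LieAlg E G) : LieAlg E G →ₗ[ℝ] LieAlg E G →ₗ[ℝ] ℝ :=
  LinearMap.mk₂ ℝ (fun X Y => -LinearMap.trace ℝ (LieAlg E G)
      (P ∘ₗ LieAlgebra.ad ℝ (LieAlg E G) Y ∘ₗ P' ∘ₗ LieAlgebra.ad ℝ (LieAlg E G) X))
    (fun X X' Y => by
      rw [map_add, LinearMap.comp_add, LinearMap.comp_add, LinearMap.comp_add, map_add, neg_add])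
    (fun c X Y => by
      rw [map_smul, LinearMap.comp_smul, LinearMap.comp_smul, LinearMap.comp_smul, map_smul,
        smul_neg])
    (fun X Y Y' => by
      rw [map_add, LinearMap.add_comp, LinearMap.comp_add, map_add, neg_add])
    (fun c X Y => by
      rw [map_smul, LinearMap.smul_comp, LinearMap.comp_smul, map_smul, smul_neg])

lemma bracketForm_apply (P P' : LieAlg E G →ₗ[ℝ] LieAlg E G) (X Y : LieAlg E G) :
    bracketForm P P' X Y = -LinearMap.trace ℝ (LieAlg E G)
      (P ∘ₗ LieAlgebra.ad ℝ (LieAlg E G) Y ∘ₗ P' ∘ₗ LieAlgebra.ad ℝ (LieAlg E G) X) := rfl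

/-- Conjugating by `Ad k` replaces `ad X` by `ad (Ad k X)` and leaves `P`, `P'` and the trace
unchanged. The trace definition of `bracketForm` makes invariance independent of bases. -/
lemma formInvariant_bracketForm {L : Subgroup G} {P P' : LieAlg E G →ₗ[ℝ] LieAlg E G}
    (hP : ∀ k ∈ L, ∀ X, P (Ad E k X) = Ad E k (P X))
    (hP' : ∀ k ∈ L, ∀ X, P' (Ad E k X) = Ad E k (P' X)) : FormInvariant L (bracketForm P P') := by
  intro k hk X Y
  rw [bracketForm_apply, bracketForm_apply]
  rw [← LinearMap.trace_conj' (P ∘ₗ LieAlgebra.ad ℝ (LieAlg E G) Y ∘ₗ P' ∘ₗ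
    LieAlgebra.ad ℝ (LieAlg E G) X) (AdLieEquiv (E := E) k).toLinearEquiv]
  congr 2
  refine LinearMap.ext fun Z => ?_
  have hZ : Z = Ad E k (Ad E k⁻¹ Z) := (Ad_Ad_inv (E := E) k Z).symm
  have h : (AdLieEquiv (E := E) k).toLinearEquiv.symm Z = Ad E k⁻¹ Z := by
    rw [LinearEquiv.symm_apply_eq]
    exact hZ
  rw [LinearEquiv.conj_apply_apply, h]
  simp only [LinearMap.comp_apply, LieAlgebra.ad_apply]
  conv_lhs => rw [hZ]
  rw [← Ad_lie, hP' k hk, ← Ad_lie, hP k hk]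
  rfl

variable {ι ι' : Type*} [Fintype ι] [Fintype ι'] {P P' : LieAlg E G →ₗ[ℝ] LieAlg E G}
  {u : ι → LieAlg E G} {w : ι → ℝ} {u' : ι' → LieAlg E G} {w' : ι' → ℝ}

lemma trace_comp_of_eq_sum [FiniteDimensional ℝ E]
    (hP : ∀ X, P X = ∑ i, (negKilling E G X (u i) / w i) • u i) (f : LieAlg E G →ₗ[ℝ] LieAlg E G) :
    LinearMap.trace ℝ (LieAlg E G) (P ∘ₗ f) = ∑ i, negKilling E G (f (u i)) (u i) / w i := by
  have : FiniteDimensional ℝ (LieAlg E G) := inferInstanceAs (FiniteDimensional ℝ E)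
  have h : P ∘ₗ f = ∑ i, ((w i)⁻¹ • (negKilling E G).flip (u i) ∘ₗ f).smulRight (u i) := by
    refine LinearMap.ext fun X => ?_
    rw [LinearMap.comp_apply, hP, LinearMap.sum_apply]
    refine Finset.sum_congr rfl fun i _ => ?_
    simp [div_eq_inv_mul]
  rw [h, map_sum]
  refine Finset.sum_congr rfl fun i _ => ?_
  rw [LinearMap.trace_smulRight]
  simp [div_eq_inv_mul]

lemma negKilling_lie_lie_self (X Y Z : LieAlg E G) :
    negKilling E G ⁅X, ⁅Y, Z⁆⁆ Z = -negKilling E G ⁅Y, Z⁆ ⁅X, Z⁆ := by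
  rw [← lie_skew, map_neg, LinearMap.neg_apply, negKilling_lie]

lemma negKilling_lie_swap (X Y Z : LieAlg E G) :
    negKilling E G ⁅X, Y⁆ Z = -negKilling E G ⁅X, Z⁆ Y := by
  rw [negKilling_comm, ← negKilling_lie, ← lie_skew, map_neg, LinearMap.neg_apply]

lemma negKilling_lie_rotate (X Y Z : LieAlg E G) :
    negKilling E G ⁅X, Y⁆ Z = negKilling E G ⁅Y, Z⁆ X := by
  rw [negKilling_lie, negKilling_comm]

/-- The link between the two descriptions: traces give invariance, and hence Schur's lemma, while
sums of products of structure constants are what the Ricci tensor produces. -/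
lemma bracketForm_eq_sum [FiniteDimensional ℝ E]
    (hP : ∀ X, P X = ∑ i, (negKilling E G X (u i) / w i) • u i)
    (hP' : ∀ X, P' X = ∑ i, (negKilling E G X (u' i) / w' i) • u' i) (X Y : LieAlg E G) :
    bracketForm P P' X Y = ∑ i, ∑ j, negKilling E G ⁅X, u i⁆ (u' j) *
      negKilling E G ⁅Y, u i⁆ (u' j) / (w i * w' j) := by
  rw [bracketForm_apply, trace_comp_of_eq_sum hP, ← Finset.sum_neg_distrib]
  refine Finset.sum_congr rfl fun i _ => ?_
  simp only [LinearMap.comp_apply, LieAlgebra.ad_apply]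
  rw [hP', lie_sum, map_sum, LinearMap.sum_apply, Finset.sum_div, ← Finset.sum_neg_distrib]
  refine Finset.sum_congr rfl fun j _ => ?_
  rw [lie_smul, map_smul, LinearMap.smul_apply, negKilling_lie_swap Y (u' j), smul_eq_mul]
  ring

end StructureForms

namespace TwoSummands

/-! ### Equivariance of the projections and the Killing form identity. -/

section Ricci

variable {E : Type*} [NormedAddCommGroup E] [NormedSpace ℝ E]
  {G : Type*} [TopologicalSpace G] [ChartedSpace E G] [Group G] [LieGroup 𝓘(ℝ, E) ∞ G]
  [CompleteSpace E]
  {EK : Type*} [NormedAddCommGroup EK] [NormedSpace ℝ EK]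
  {EH : Type*} [NormedAddCommGroup EH] [NormedSpace ℝ EH]
  {K H : Subgroup G} [ChartedSpace EK K] [ChartedSpace EH H]
  (D : TwoSummands E EK EH K H)

lemma pr₁_Ad (k : G) (hk : k ∈ K) (X : LieAlg E G) : D.pr₁ (Ad E k X) = Ad E k (D.pr₁ X) := by
  rw [← sub_eq_zero]
  refine negKilling_eq_zero_of_forall D.e₁ D.b₁_pos D.negKilling_e₁ (D.p₁.sub_mem (D.pr₁_mem _)
    (D.irreducible_p₁.invariant k hk _ (D.pr₁_mem _))) fun Y hY => ?_
  rw [map_sub, LinearMap.sub_apply, D.negKilling_pr₁ _ hY,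
    (formInvariant_negKilling K).apply_Ad hk, (formInvariant_negKilling K).apply_Ad hk,
    D.negKilling_pr₁ _ (D.irreducible_p₁.invariant _ (K.inv_mem hk) Y hY), sub_self]

lemma pr₂_Ad (k : G) (hk : k ∈ K) (X : LieAlg E G) : D.pr₂ (Ad E k X) = Ad E k (D.pr₂ X) := by
  rw [← sub_eq_zero]
  refine negKilling_eq_zero_of_forall D.e₂ D.b₂_pos D.negKilling_e₂ (D.p₂.sub_mem (D.pr₂_mem _)
    (D.irreducible_p₂.invariant k hk _ (D.pr₂_mem _))) fun Y hY => ?_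
  rw [map_sub, LinearMap.sub_apply, D.negKilling_pr₂ _ hY,
    (formInvariant_negKilling K).apply_Ad hk, (formInvariant_negKilling K).apply_Ad hk,
    D.negKilling_pr₂ _ (D.irreducible_p₂.invariant _ (K.inv_mem hk) Y hY), sub_self]

lemma Q₁_Ad (k : G) (hk : k ∈ K) (X Y : LieAlg E G) :
    D.Q₁ (Ad E k X) (Ad E k Y) = D.Q₁ X Y := by
  rw [Q₁_eq, Q₁_eq, D.pr₁_Ad k hk, negKilling_Ad]

lemma Q₂_Ad (k : G) (hk : k ∈ K) (X Y : LieAlg E G) :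
    D.Q₂ (Ad E k X) (Ad E k Y) = D.Q₂ X Y := by
  rw [Q₂_eq, Q₂_eq, D.pr₂_Ad k hk, negKilling_Ad]

section

variable [FiniteDimensional ℝ E] (hK : IsClosedLieSubgroup E EK K)
include hK

lemma lie_k_p₁ {X Y : LieAlg E G} (hX : X ∈ subLieAlg E EK K) (hY : Y ∈ D.p₁) : ⁅X, Y⁆ ∈ D.p₁ :=
  D.irreducible_p₁.invariant.lie_mem hK hX hY

lemma lie_k_p₂ {X Y : LieAlg E G} (hX : X ∈ subLieAlg E EK K) (hY : Y ∈ D.p₂) : ⁅X, Y⁆ ∈ D.p₂ :=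
  D.irreducible_p₂.invariant.lie_mem hK hX hY

lemma lie_k_p {X Y : LieAlg E G} (hX : X ∈ subLieAlg E EK K) (hY : Y ∈ D.p₁ ⊔ D.p₂) :
    ⁅X, Y⁆ ∈ D.p₁ ⊔ D.p₂ := by
  obtain ⟨Y₁, h₁, Y₂, h₂, rfl⟩ := Submodule.mem_sup.1 hY
  rw [lie_add]
  exact add_mem (D.p₁_le (D.lie_k_p₁ hK hX h₁)) (D.p₂_le (D.lie_k_p₂ hK hX h₂))

lemma prK_lie_prK {X : LieAlg E G} (hX : X ∈ D.p₁ ⊔ D.p₂) (Y : LieAlg E G) :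
    D.prK ⁅X, D.prK Y⁆ = 0 := by
  refine D.prK_of_mem_p ?_
  rw [← lie_skew]
  exact neg_mem (D.lie_k_p hK (D.prK_mem Y) hX)

/-- Split the trace of `ad X ∘ ad Y` along `𝔨 ⊕ 𝔭`. As `[𝔭, 𝔨] ⊆ 𝔭`, the `𝔨` part sees only what
passes through `𝔭`, and cyclicity of the trace turns it into a `𝔭` trace as well. The identity
removes the isotropy term from the Ricci tensor. -/
lemma sum_negKilling_lie_lie {X Y : LieAlg E G} (hX : X ∈ D.p₁ ⊔ D.p₂) :
    2 * ∑ a, negKilling E G ⁅X, D.basis a⁆ ⁅Y, D.basis a⁆ / D.killingWeight a =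
      negKilling E G X Y + bracketForm (D.pr₁ + D.pr₂) (D.pr₁ + D.pr₂) X Y := by
  have : FiniteDimensional ℝ (LieAlg E G) := inferInstanceAs (FiniteDimensional ℝ E)
  set adX := LieAlgebra.ad ℝ (LieAlg E G) X with hadX
  set adY := LieAlgebra.ad ℝ (LieAlg E G) Y with hadY
  set P := D.pr₁ + D.pr₂ with hPdef
  have hP : ∀ Z, P Z = ∑ a, (negKilling E G Z (D.basis a) / D.killingWeight a) • D.basis a :=
    D.prP_eq_sum
  have hsum : D.prK + P = LinearMap.id := LinearMap.ext D.prK_add_prP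
  have h1 : killingForm ℝ (LieAlg E G) X Y = LinearMap.trace ℝ (LieAlg E G) (adX ∘ₗ adY) := rfl
  have h2 : D.prK ∘ₗ adX ∘ₗ adY = D.prK ∘ₗ adX ∘ₗ P ∘ₗ adY := by
    refine LinearMap.ext fun Z => ?_
    have h3 : adY Z = D.prK (adY Z) + P (adY Z) := (D.prK_add_prP _).symm
    have h4 : D.prK (adX (D.prK (adY Z))) = 0 := D.prK_lie_prK hK hX _
    change D.prK (adX (adY Z)) = D.prK (adX (P (adY Z)))
    conv_lhs => rw [h3]
    rw [map_add, map_add, h4, zero_add]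
  have h3 : LinearMap.trace ℝ (LieAlg E G) (D.prK ∘ₗ adX ∘ₗ P ∘ₗ adY) =
      LinearMap.trace ℝ (LieAlg E G) (P ∘ₗ adY ∘ₗ D.prK ∘ₗ adX) :=
    LinearMap.trace_comp_comm' (P ∘ₗ adY) (D.prK ∘ₗ adX)
  have h4 : P ∘ₗ adY ∘ₗ D.prK ∘ₗ adX = P ∘ₗ adY ∘ₗ adX - P ∘ₗ adY ∘ₗ P ∘ₗ adX := by
    have : D.prK = LinearMap.id - P := by rw [← hsum]; abel
    rw [this, LinearMap.sub_comp, LinearMap.comp_sub, LinearMap.comp_sub, LinearMap.id_comp]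
  have h5 : adX ∘ₗ adY = D.prK ∘ₗ adX ∘ₗ adY + P ∘ₗ adX ∘ₗ adY := by
    rw [← LinearMap.add_comp, hsum, LinearMap.id_comp]
  have h6 : LinearMap.trace ℝ (LieAlg E G) (P ∘ₗ adX ∘ₗ adY) =
      -∑ a, negKilling E G ⁅X, D.basis a⁆ ⁅Y, D.basis a⁆ / D.killingWeight a := by
    rw [trace_comp_of_eq_sum hP, ← Finset.sum_neg_distrib]
    refine Finset.sum_congr rfl fun a _ => ?_
    change negKilling E G ⁅X, ⁅Y, D.basis a⁆⁆ _ / _ = _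
    rw [negKilling_lie_lie_self, negKilling_comm, neg_div]
  have h7 : LinearMap.trace ℝ (LieAlg E G) (P ∘ₗ adY ∘ₗ adX) =
      -∑ a, negKilling E G ⁅X, D.basis a⁆ ⁅Y, D.basis a⁆ / D.killingWeight a := by
    rw [trace_comp_of_eq_sum hP, ← Finset.sum_neg_distrib]
    refine Finset.sum_congr rfl fun a _ => ?_
    change negKilling E G ⁅Y, ⁅X, D.basis a⁆⁆ _ / _ = _
    rw [negKilling_lie_lie_self, neg_div]
  have h8 : bracketForm P P X Y =
      -LinearMap.trace ℝ (LieAlg E G) (P ∘ₗ adY ∘ₗ P ∘ₗ adX) := rfl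
  rw [negKilling_apply, h1, h5, map_add, h6, h2, h3, h4, map_sub, h7, h8]
  ring

end

end Ricci

end TwoSummands

namespace TwoSummands

/-! ### The Ricci tensor in the eigenbasis -/

section RicciSum

variable {E : Type*} [NormedAddCommGroup E] [NormedSpace ℝ E]
  {G : Type*} [TopologicalSpace G] [ChartedSpace E G] [Group G] [LieGroup 𝓘(ℝ, E) ∞ G]
  [CompleteSpace E]
  {EK : Type*} [NormedAddCommGroup EK] [NormedSpace ℝ EK]
  {EH : Type*} [NormedAddCommGroup EH] [NormedSpace ℝ EH]
  {K H : Subgroup G} [ChartedSpace EK K] [ChartedSpace EH H]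
  (D : TwoSummands E EK EH K H) {x₁ x₂ : ℝ}

/-- The connection map `(X, Y) ↦ Λ(X)Y` as a bilinear map. -/
def nablaForm (x₁ x₂ : ℝ) : LieAlg E G →ₗ[ℝ] LieAlg E G →ₗ[ℝ] LieAlg E G :=
  LinearMap.mk₂ ℝ (D.nabla x₁ x₂)
    (fun X X' Y => by
      simp only [nabla, ← Finset.sum_add_distrib, ← add_smul]
      refine Finset.sum_congr rfl fun a _ => ?_
      congr 1
      simp only [koszul, ← metricForm_apply, add_lie, lie_add, map_add, LinearMap.add_apply]
      ring)
    (fun c X Y => by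
      simp only [nabla, Finset.smul_sum, smul_smul]
      refine Finset.sum_congr rfl fun a _ => ?_
      congr 1
      simp only [koszul, ← metricForm_apply, smul_lie, lie_smul, map_smul, LinearMap.smul_apply,
        smul_eq_mul]
      ring)
    (fun X Y Y' => by
      simp only [nabla, ← Finset.sum_add_distrib, ← add_smul]
      refine Finset.sum_congr rfl fun a _ => ?_
      congr 1
      simp only [koszul, ← metricForm_apply, add_lie, lie_add, map_add, LinearMap.add_apply]
      ring)
    (fun c X Y => by
      simp only [nabla, Finset.smul_sum, smul_smul]
      refine Finset.sum_congr rfl fun a _ => ?_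
      congr 1
      simp only [koszul, ← metricForm_apply, smul_lie, lie_smul, map_smul, LinearMap.smul_apply,
        smul_eq_mul]
      ring)

lemma nablaForm_apply (X Y : LieAlg E G) : D.nablaForm x₁ x₂ X Y = D.nabla x₁ x₂ X Y := rfl

lemma nabla_mem (X Y : LieAlg E G) : D.nabla x₁ x₂ X Y ∈ D.p₁ ⊔ D.p₂ :=
  Submodule.sum_mem _ fun a _ => Submodule.smul_mem _ _ (D.basis_mem a)

lemma negKilling_nabla (X Y : LieAlg E G) (a) :
    negKilling E G (D.nabla x₁ x₂ X Y) (D.basis a) =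
      D.koszul x₁ x₂ X Y (D.basis a) / D.weight (x₁ / D.b₁) (x₂ / D.b₂) a := by
  rw [nabla, map_sum, LinearMap.sum_apply]
  simp only [map_smul, LinearMap.smul_apply, negKilling_basis, smul_eq_mul, mul_ite, mul_zero,
    Finset.sum_ite_eq', Finset.mem_univ, if_true]
  rw [D.weight_eq_mul x₁ x₂, ← div_div, div_mul_cancel₀ _ (D.killingWeight_ne_zero a)]

variable {D} in
lemma IsEigen.nabla {l m : ℝ} {X Y : LieAlg E G} (hX : D.IsEigen x₁ x₂ l X)
    (hY : D.IsEigen x₁ x₂ m Y) (a) :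
    negKilling E G (D.nabla x₁ x₂ X Y) (D.basis a) =
      (D.weight (x₁ / D.b₁) (x₂ / D.b₂) a + m - l) /
        (2 * D.weight (x₁ / D.b₁) (x₂ / D.b₂) a) * negKilling E G ⁅X, Y⁆ (D.basis a) := by
  rw [negKilling_nabla, hX.koszul D hY, mul_div_right_comm, div_div]

/-- Expansion of `Λ(X)V` along the components of `V`. -/
lemma negKilling_nabla_right (X : LieAlg E G) {V Z : LieAlg E G} (hV : V ∈ D.p₁ ⊔ D.p₂) :
    negKilling E G (D.nabla x₁ x₂ X V) Z = ∑ c, negKilling E G V (D.basis c) /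
      D.killingWeight c * negKilling E G (D.nabla x₁ x₂ X (D.basis c)) Z := by
  conv_lhs => rw [← D.prP_of_mem hV, D.prP_eq_sum, ← nablaForm_apply, map_sum, map_sum,
    LinearMap.sum_apply]
  refine Finset.sum_congr rfl fun c _ => ?_
  rw [map_smul, map_smul, LinearMap.smul_apply, smul_eq_mul, nablaForm_apply]

lemma negKilling_nabla_left {V : LieAlg E G} (hV : V ∈ D.p₁ ⊔ D.p₂) (Y Z : LieAlg E G) :
    negKilling E G (D.nabla x₁ x₂ V Y) Z = ∑ c, negKilling E G V (D.basis c) /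
      D.killingWeight c * negKilling E G (D.nabla x₁ x₂ (D.basis c) Y) Z := by
  conv_lhs => rw [← D.prP_of_mem hV, D.prP_eq_sum, ← nablaForm_apply, map_sum,
    LinearMap.sum_apply, map_sum, LinearMap.sum_apply]
  refine Finset.sum_congr rfl fun c _ => ?_
  rw [map_smul, LinearMap.smul_apply, map_smul, LinearMap.smul_apply, smul_eq_mul, nablaForm_apply]

/-- The Koszul terms reduce to `-B([eₐ, eₐ], V) = 0`, since `eₐ` is an eigenvector. So the first
curvature term does not contribute to the Ricci trace. -/
lemma negKilling_nabla_self (V : LieAlg E G) (a) :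
    negKilling E G (D.nabla x₁ x₂ (D.basis a) V) (D.basis a) = 0 := by
  rw [negKilling_nabla, koszul, D.metric_comm _ _ ⁅D.basis a, V⁆, lie_self]
  simp only [D.isEigen_basis x₁ x₂ a _, ← metricForm_apply, map_zero, LinearMap.zero_apply]
  rw [← negKilling_lie, lie_self, map_zero, LinearMap.zero_apply]
  simp

lemma ric_eq_sum_negKilling (h₁ : 0 < x₁) (h₂ : 0 < x₂) (X Y : LieAlg E G) :
    D.ric x₁ x₂ X Y = ∑ a, negKilling E G (D.curv x₁ x₂ (D.basis a) X Y) (D.basis a) /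
      D.killingWeight a := by
  refine Finset.sum_congr rfl fun a _ => ?_
  have := (D.weight_pos (div_pos h₁ D.b₁_pos) (div_pos h₂ D.b₂_pos) a).ne'
  rw [D.metric_comm, D.isEigen_basis, D.weight_eq_mul x₁ x₂, negKilling_comm,
    mul_div_mul_left _ _ this]

/-- The coefficient of a pair of structure constants in the Ricci tensor. -/
def ricCoeff (l m u v : ℝ) : ℝ :=
  -((u + v - l) * (v + m - u)) / (4 * u * v) + (u + m - v) / (2 * u) - 1 / 2

/-- Between eigenvectors `Λ` is a multiple of the bracket in each coordinate, so every curvature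
term becomes a product of two structure constants with a coefficient rational in the eigenvalues. -/
lemma ric_eq_sum [FiniteDimensional ℝ E] (hK : IsClosedLieSubgroup E EK K)
    (h₁ : 0 < x₁) (h₂ : 0 < x₂) {l m : ℝ} {X Y : LieAlg E G} (hX : D.IsEigen x₁ x₂ l X)
    (hY : D.IsEigen x₁ x₂ m Y) (hXp : X ∈ D.p₁ ⊔ D.p₂) :
    D.ric x₁ x₂ X Y = negKilling E G X Y / 2 + ∑ a, ∑ c,
      negKilling E G ⁅X, D.basis a⁆ (D.basis c) * negKilling E G ⁅Y, D.basis a⁆ (D.basis c) /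
        (D.killingWeight a * D.killingWeight c) *
      ricCoeff l m (D.weight (x₁ / D.b₁) (x₂ / D.b₂) a) (D.weight (x₁ / D.b₁) (x₂ / D.b₂) c) := by
  set lam := D.weight (x₁ / D.b₁) (x₂ / D.b₂) with hlam
  have hpos : ∀ a, lam a ≠ 0 := fun a =>
    (D.weight_pos (div_pos h₁ D.b₁_pos) (div_pos h₂ D.b₂_pos) a).ne'
  have hβ := D.killingWeight_ne_zero
  -- Trades the sum over full brackets, including their `𝔨` parts, for `-B(X, Y)/2` and a sum over
  -- `𝔭`; the latter supplies the missing `1/2` in the coefficient of `key`.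
  have hU := D.sum_negKilling_lie_lie hK (Y := Y) hXp
  rw [bracketForm_eq_sum D.prP_eq_sum D.prP_eq_sum] at hU
  have key : ∀ a, negKilling E G (D.curv x₁ x₂ (D.basis a) X Y) (D.basis a) / D.killingWeight a =
      negKilling E G ⁅X, D.basis a⁆ ⁅Y, D.basis a⁆ / D.killingWeight a + ∑ c,
        negKilling E G ⁅X, D.basis a⁆ (D.basis c) * negKilling E G ⁅Y, D.basis a⁆ (D.basis c) /
        (D.killingWeight a * D.killingWeight c) * (ricCoeff l m (lam a) (lam c) - 1 / 2) := by
    intro a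
    have hXa : ∀ Z, negKilling E G ⁅D.basis a, X⁆ Z = -negKilling E G ⁅X, D.basis a⁆ Z := fun Z => by
      rw [← lie_skew, map_neg, LinearMap.neg_apply]
    have hYa : ∀ Z, negKilling E G ⁅D.basis a, Y⁆ Z = -negKilling E G ⁅Y, D.basis a⁆ Z := fun Z => by
      rw [← lie_skew, map_neg, LinearMap.neg_apply]
    have t2 : negKilling E G (D.nabla x₁ x₂ X (D.nabla x₁ x₂ (D.basis a) Y)) (D.basis a) =
        ∑ c, negKilling E G ⁅X, D.basis a⁆ (D.basis c) * negKilling E G ⁅Y, D.basis a⁆ (D.basis c) /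
        D.killingWeight c * ((lam a + lam c - l) * (lam c + m - lam a) /
          (4 * lam a * lam c)) := by
      rw [D.negKilling_nabla_right X (D.nabla_mem _ _)]
      refine Finset.sum_congr rfl fun c _ => ?_
      rw [(D.isEigen_basis x₁ x₂ a).nabla hY, hX.nabla (D.isEigen_basis x₁ x₂ c), hYa,
        negKilling_lie_swap X (D.basis c)]
      have := hpos a
      have := hpos c
      have := hβ c
      simp only [← hlam]
      field_simp
      ring
    have t3 : negKilling E G (D.nabla x₁ x₂ (D.prP ⁅D.basis a, X⁆) Y) (D.basis a) =
        ∑ c, negKilling E G ⁅X, D.basis a⁆ (D.basis c) * negKilling E G ⁅Y, D.basis a⁆ (D.basis c) /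
        D.killingWeight c * (-(lam a + m - lam c) / (2 * lam a)) := by
      rw [D.negKilling_nabla_left (D.prP_mem _)]
      refine Finset.sum_congr rfl fun c _ => ?_
      rw [D.negKilling_prP _ (D.basis_mem c), (D.isEigen_basis x₁ x₂ c).nabla hY, hXa,
        negKilling_lie_rotate (D.basis c) Y]
      ring
    have t4 : negKilling E G ⁅D.prK ⁅D.basis a, X⁆, Y⁆ (D.basis a) =
        -(negKilling E G ⁅X, D.basis a⁆ ⁅Y, D.basis a⁆) + 
        ∑ c, negKilling E G ⁅X, D.basis a⁆ (D.basis c) * negKilling E G ⁅Y, D.basis a⁆ (D.basis c) /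
        D.killingWeight c := by
      rw [negKilling_lie, eq_sub_of_add_eq (D.prK_add_prP ⁅D.basis a, X⁆), map_sub,
        LinearMap.sub_apply, hXa, negKilling_comm (D.prP _),
        D.negKilling_eq_sum _ (D.prP_mem _), sub_eq_add_neg, ← Finset.sum_neg_distrib]
      congr 1
      refine Finset.sum_congr rfl fun c _ => ?_
      rw [D.negKilling_prP _ (D.basis_mem c), hXa]
      ring
    rw [curv, map_sub, map_sub, map_sub, LinearMap.sub_apply, LinearMap.sub_apply,
      LinearMap.sub_apply, negKilling_nabla_self, t2, t3, t4]
    have h : ∀ f g h k : Fin D.d₁ ⊕ Fin D.d₂ → ℝ, (∀ c, -f c - g c - h c = D.killingWeight a * k c) →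
        ∀ v, (0 - ∑ c, f c - ∑ c, g c - (-v + ∑ c, h c)) / D.killingWeight a =
          v / D.killingWeight a + ∑ c, k c := fun f g h k H v => by
      have h3 : ∑ c, k c = (-∑ c, f c - ∑ c, g c - ∑ c, h c) / D.killingWeight a := by
        rw [eq_div_iff (hβ a), mul_comm, Finset.mul_sum, ← Finset.sum_neg_distrib,
          ← Finset.sum_sub_distrib, ← Finset.sum_sub_distrib]
        exact Finset.sum_congr rfl fun c _ => (H c).symm
      rw [h3]
      ring
    refine h _ _ _ _ (fun c => ?_) _
    have := hβ a
    have := hβ c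
    have := hpos a
    have := hpos c
    rw [ricCoeff]
    field_simp
    ring
  rw [D.ric_eq_sum_negKilling h₁ h₂, Finset.sum_congr rfl fun a _ => key a, Finset.sum_add_distrib]
  have : negKilling E G X Y / 2 = ∑ a, negKilling E G ⁅X, D.basis a⁆ ⁅Y, D.basis a⁆ / D.killingWeight a
    - 1 / 2 * ∑ a, ∑ c, negKilling E G ⁅X, D.basis a⁆ (D.basis c) *
      negKilling E G ⁅Y, D.basis a⁆ (D.basis c) / (D.killingWeight a * D.killingWeight c) := by
    linarith
  rw [this]
  simp only [mul_sub, Finset.sum_sub_distrib, Finset.mul_sum]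
  have h : ∀ a c : Fin D.d₁ ⊕ Fin D.d₂, 1 / 2 * (negKilling E G ⁅X, D.basis a⁆ (D.basis c) *
      negKilling E G ⁅Y, D.basis a⁆ (D.basis c) / (D.killingWeight a * D.killingWeight c)) =
      negKilling E G ⁅X, D.basis a⁆ (D.basis c) *
      negKilling E G ⁅Y, D.basis a⁆ (D.basis c) / (D.killingWeight a * D.killingWeight c) *
      (1 / 2) := fun a c => mul_comm _ _
  simp only [h]
  ring

end RicciSum

end TwoSummands

namespace TwoSummands

/-! ### The Ricci tensor on the two summands -/

section RicciBlocks

variable {E : Type*} [NormedAddCommGroup E] [NormedSpace ℝ E]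
  {G : Type*} [TopologicalSpace G] [ChartedSpace E G] [Group G] [LieGroup 𝓘(ℝ, E) ∞ G]
  [CompleteSpace E]
  {EK : Type*} [NormedAddCommGroup EK] [NormedSpace ℝ EK]
  {EH : Type*} [NormedAddCommGroup EH] [NormedSpace ℝ EH]
  {K H : Subgroup G} [ChartedSpace EK K] [ChartedSpace EH H]
  (D : TwoSummands E EK EH K H) {x₁ x₂ : ℝ}

lemma curv_add_middle (Z X X' Y : LieAlg E G) :
    D.curv x₁ x₂ Z (X + X') Y = D.curv x₁ x₂ Z X Y + D.curv x₁ x₂ Z X' Y := by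
  simp only [curv, ← nablaForm_apply, prP, lie_add, map_add, LinearMap.add_apply, add_lie]
  abel

lemma curv_add_right (Z X Y Y' : LieAlg E G) :
    D.curv x₁ x₂ Z X (Y + Y') = D.curv x₁ x₂ Z X Y + D.curv x₁ x₂ Z X Y' := by
  simp only [curv, ← nablaForm_apply, lie_add, map_add]
  abel

lemma ric_add_left (X X' Y : LieAlg E G) :
    D.ric x₁ x₂ (X + X') Y = D.ric x₁ x₂ X Y + D.ric x₁ x₂ X' Y := by
  simp only [ric, curv_add_middle, ← metricForm_apply, map_add, LinearMap.add_apply, add_div,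
    Finset.sum_add_distrib]

lemma ric_add_right (X Y Y' : LieAlg E G) :
    D.ric x₁ x₂ X (Y + Y') = D.ric x₁ x₂ X Y + D.ric x₁ x₂ X Y' := by
  simp only [ric, curv_add_right, ← metricForm_apply, map_add, LinearMap.add_apply, add_div,
    Finset.sum_add_distrib]

lemma Q₁_add_left (X X' Y : LieAlg E G) : D.Q₁ (X + X') Y = D.Q₁ X Y + D.Q₁ X' Y := by
  simp only [Q₁_eq, map_add, LinearMap.add_apply, add_div]

lemma Q₂_add_left (X X' Y : LieAlg E G) : D.Q₂ (X + X') Y = D.Q₂ X Y + D.Q₂ X' Y := by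
  simp only [Q₂_eq, map_add, LinearMap.add_apply, add_div]

lemma Q₁_add_right (X Y Y' : LieAlg E G) : D.Q₁ X (Y + Y') = D.Q₁ X Y + D.Q₁ X Y' := by
  simp only [Q₁_eq, map_add, add_div]

lemma Q₂_add_right (X Y Y' : LieAlg E G) : D.Q₂ X (Y + Y') = D.Q₂ X Y + D.Q₂ X Y' := by
  simp only [Q₂_eq, map_add, add_div]

variable [FiniteDimensional ℝ E]

lemma bracketForm_pr₁_pr₁ (X Y : LieAlg E G) : bracketForm D.pr₁ D.pr₁ X Y =
    ∑ i, ∑ j, negKilling E G ⁅X, (D.e₁ i : LieAlg E G)⁆ (D.e₁ j) *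
      negKilling E G ⁅Y, (D.e₁ i : LieAlg E G)⁆ (D.e₁ j) / (D.b₁ * D.b₁) :=
  bracketForm_eq_sum D.pr₁_apply D.pr₁_apply X Y

lemma bracketForm_pr₁_pr₂ (X Y : LieAlg E G) : bracketForm D.pr₁ D.pr₂ X Y =
    ∑ i, ∑ j, negKilling E G ⁅X, (D.e₁ i : LieAlg E G)⁆ (D.e₂ j) *
      negKilling E G ⁅Y, (D.e₁ i : LieAlg E G)⁆ (D.e₂ j) / (D.b₁ * D.b₂) :=
  bracketForm_eq_sum D.pr₁_apply D.pr₂_apply X Y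

lemma bracketForm_pr₂_pr₂ (X Y : LieAlg E G) : bracketForm D.pr₂ D.pr₂ X Y =
    ∑ i, ∑ j, negKilling E G ⁅X, (D.e₂ i : LieAlg E G)⁆ (D.e₂ j) *
      negKilling E G ⁅Y, (D.e₂ i : LieAlg E G)⁆ (D.e₂ j) / (D.b₂ * D.b₂) :=
  bracketForm_eq_sum D.pr₂_apply D.pr₂_apply X Y

/-- The coefficients depend only on which summand each index belongs to, so the double sum collapses
to one invariant form per pair of summands; the two mixed blocks coincide by `ad`-invariance. -/
lemma ric_eq_bracketForm (hK : IsClosedLieSubgroup E EK K)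
    (h₁ : 0 < x₁) (h₂ : 0 < x₂) {l m : ℝ} {X Y : LieAlg E G} (hX : D.IsEigen x₁ x₂ l X)
    (hY : D.IsEigen x₁ x₂ m Y) (hXp : X ∈ D.p₁ ⊔ D.p₂) :
    D.ric x₁ x₂ X Y = negKilling E G X Y / 2 +
      bracketForm D.pr₁ D.pr₁ X Y * ricCoeff l m (x₁ / D.b₁) (x₁ / D.b₁) +
      bracketForm D.pr₁ D.pr₂ X Y * (ricCoeff l m (x₁ / D.b₁) (x₂ / D.b₂) +
        ricCoeff l m (x₂ / D.b₂) (x₁ / D.b₁)) +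
      bracketForm D.pr₂ D.pr₂ X Y * ricCoeff l m (x₂ / D.b₂) (x₂ / D.b₂) := by
  have h21 : ∑ i, ∑ j, negKilling E G ⁅X, (D.e₂ i : LieAlg E G)⁆ (D.e₁ j) *
      negKilling E G ⁅Y, (D.e₂ i : LieAlg E G)⁆ (D.e₁ j) / (D.b₂ * D.b₁) =
      bracketForm D.pr₁ D.pr₂ X Y := by
    rw [bracketForm_pr₁_pr₂, Finset.sum_comm]
    refine Finset.sum_congr rfl fun i _ => Finset.sum_congr rfl fun j _ => ?_
    rw [negKilling_lie_swap X, negKilling_lie_swap Y, neg_mul_neg, mul_comm D.b₁]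
  rw [D.ric_eq_sum hK h₁ h₂ hX hY hXp]
  simp only [Fintype.sum_sum_type, basis, weight, Sum.elim_inl, Sum.elim_inr, Finset.sum_add_distrib]
  simp only [← Finset.sum_mul, h21]
  rw [← bracketForm_pr₁_pr₁, ← bracketForm_pr₁_pr₂, ← bracketForm_pr₂_pr₂]
  ring

lemma formInvariant_structure₁₁ : FormInvariant K (bracketForm D.pr₁ D.pr₁) :=
  formInvariant_bracketForm D.pr₁_Ad D.pr₁_Ad

lemma formInvariant_structure₁₂ : FormInvariant K (bracketForm D.pr₁ D.pr₂) :=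
  formInvariant_bracketForm D.pr₁_Ad D.pr₂_Ad

lemma formInvariant_structure₂₂ : FormInvariant K (bracketForm D.pr₂ D.pr₂) :=
  formInvariant_bracketForm D.pr₂_Ad D.pr₂_Ad

lemma bracketForm_pr₁_pr₁_comm (X Y : LieAlg E G) :
    bracketForm D.pr₁ D.pr₁ X Y = bracketForm D.pr₁ D.pr₁ Y X := by
  simp only [bracketForm_pr₁_pr₁, mul_comm]

lemma bracketForm_pr₁_pr₂_comm (X Y : LieAlg E G) :
    bracketForm D.pr₁ D.pr₂ X Y = bracketForm D.pr₁ D.pr₂ Y X := by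
  simp only [bracketForm_pr₁_pr₂, mul_comm]

lemma bracketForm_pr₂_pr₂_comm (X Y : LieAlg E G) :
    bracketForm D.pr₂ D.pr₂ X Y = bracketForm D.pr₂ D.pr₂ Y X := by
  simp only [bracketForm_pr₂_pr₂, mul_comm]

section

variable [LieGroup 𝓘(ℝ, EH) ∞ H] (hH : IsClosedLieSubgroup E EH H)
include hH

/-- `𝔥 = 𝔨 ⊕ 𝔭₁` is `Ad_H`-invariant, hence a subalgebra, and it is orthogonal to `𝔭₂`. In structure
constants: `[112] = 0`. -/
lemma negKilling_lie_p₁_p₁ {X Y Z : LieAlg E G} (hX : X ∈ D.p₁) (hY : Y ∈ D.p₁) (hZ : Z ∈ D.p₂) :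
    negKilling E G ⁅X, Y⁆ Z = 0 := by
  have hle : D.p₁ ≤ subLieAlg E EH H := by
    rw [D.lieAlg_H]
    exact le_sup_right
  have h := (adInvariant_subLieAlg hH).lie_mem hH (hle hX) (hle hY)
  rw [D.lieAlg_H] at h
  obtain ⟨k, hk, W, hW, h⟩ := Submodule.mem_sup.1 h
  rw [← h, map_add, LinearMap.add_apply, D.negKilling_k_p hk (D.p₂_le hZ),
    D.negKilling_p₁_p₂ hW hZ, add_zero]

lemma bracketForm_pr₁_pr₂_of_mem_p₁ {X : LieAlg E G} (hX : X ∈ D.p₁) (Y : LieAlg E G) :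
    bracketForm D.pr₁ D.pr₂ X Y = 0 := by
  rw [bracketForm_pr₁_pr₂]
  refine Finset.sum_eq_zero fun i _ => Finset.sum_eq_zero fun j _ => ?_
  rw [D.negKilling_lie_p₁_p₁ hH hX (D.e₁ i).2 (D.e₂ j).2, zero_mul, zero_div]

lemma bracketForm_pr₁_pr₁_of_mem_p₂ {X : LieAlg E G} (hX : X ∈ D.p₂) (Y : LieAlg E G) :
    bracketForm D.pr₁ D.pr₁ X Y = 0 := by
  rw [bracketForm_pr₁_pr₁]
  refine Finset.sum_eq_zero fun i _ => Finset.sum_eq_zero fun j _ => ?_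
  rw [negKilling_lie_rotate, D.negKilling_lie_p₁_p₁ hH (D.e₁ i).2 (D.e₁ j).2 hX, zero_mul,
    zero_div]

/-- The forms involving `pr₁` vanish because `[112] = 0`; the remaining one vanishes by Schur's
lemma. -/
lemma ric_p₁_p₂ (hK : IsClosedLieSubgroup E EK K) (h₁ : 0 < x₁) (h₂ : 0 < x₂) {X Y : LieAlg E G}
    (hX : X ∈ D.p₁) (hY : Y ∈ D.p₂) : D.ric x₁ x₂ X Y = 0 := by
  rw [D.ric_eq_bracketForm hK h₁ h₂ (D.isEigen_p₁ x₁ x₂ hX) (D.isEigen_p₂ x₁ x₂ hY) (D.p₁_le hX),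
    D.negKilling_p₁_p₂ hX hY, bracketForm_pr₁_pr₁_comm, D.bracketForm_pr₁_pr₁_of_mem_p₂ hH hY,
    D.bracketForm_pr₁_pr₂_of_mem_p₁ hH hX, D.formInvariant_structure₂₂.eq_zero D.irreducible_p₁
      D.irreducible_p₂ D.inequivalent D.e₂ D.b₂_pos D.negKilling_e₂ hX hY]
  ring

lemma ric_p₂_p₁ (hK : IsClosedLieSubgroup E EK K) (h₁ : 0 < x₁) (h₂ : 0 < x₂) {X Y : LieAlg E G}
    (hX : X ∈ D.p₂) (hY : Y ∈ D.p₁) : D.ric x₁ x₂ X Y = 0 := by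
  rw [D.ric_eq_bracketForm hK h₁ h₂ (D.isEigen_p₂ x₁ x₂ hX) (D.isEigen_p₁ x₁ x₂ hY) (D.p₂_le hX),
    D.negKilling_p₂_p₁ hX hY, D.bracketForm_pr₁_pr₁_of_mem_p₂ hH hX, bracketForm_pr₁_pr₂_comm,
    D.bracketForm_pr₁_pr₂_of_mem_p₁ hH hY, bracketForm_pr₂_pr₂_comm,
    D.formInvariant_structure₂₂.eq_zero D.irreducible_p₁
      D.irreducible_p₂ D.inequivalent D.e₂ D.b₂_pos D.negKilling_e₂ hY hX]
  ring

/-- Schur's lemma makes the two surviving forms multiples `s`, `t` of `-B`, and tracing gives `[111]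
= s b₁ d₁`, `[122] = t b₁ d₁`. Then `C = b₁ (1 - s/2 - t)`, and the constant term of the Ricci
tensor is `C/2`. -/
lemma exists_ric_p₁ (hK : IsClosedLieSubgroup E EK K) (h122 : 0 < D.c122) (hC : 0 < D.constC) :
    ∃ α β : ℝ, 0 < α ∧ 0 < β ∧ ∀ x₁ x₂ : ℝ, 0 < x₁ → 0 < x₂ → ∀ X ∈ D.p₁, ∀ Y ∈ D.p₁,
      D.ric x₁ x₂ X Y = (α + β * (x₁ / x₂) ^ 2) * D.Q₁ X Y := by
  have hb₁ := D.b₁_pos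
  have hb₂ := D.b₂_pos
  obtain ⟨s, hs⟩ := D.formInvariant_structure₁₁.exists_eq_mul D.irreducible_p₁ D.e₁ hb₁
    D.negKilling_e₁ fun X _ Y _ => D.bracketForm_pr₁_pr₁_comm X Y
  obtain ⟨t, ht⟩ := D.formInvariant_structure₂₂.exists_eq_mul D.irreducible_p₁ D.e₁ hb₁
    D.negKilling_e₁ fun X _ Y _ => D.bracketForm_pr₂_pr₂_comm X Y
  have h111s : D.c111 = s * D.b₁ * D.d₁ := by
    have : ∀ i, bracketForm D.pr₁ D.pr₁ (D.e₁ i : LieAlg E G) (D.e₁ i) = s * D.b₁ := fun i => by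
      rw [hs _ (D.e₁ i).2 _ (D.e₁ i).2, D.negKilling_e₁, if_pos rfl, mul_one]
    have hsum : D.c111 = ∑ i : Fin D.d₁, s * D.b₁ := by
      refine Finset.sum_congr rfl fun i _ => ?_
      rw [← this i, bracketForm_pr₁_pr₁]
      refine Finset.sum_congr rfl fun j _ => Finset.sum_congr rfl fun k _ => ?_
      rw [Q₁_comm, D.Q₁_of_mem_p₁ (D.e₁ k).2, negKilling_comm]
      ring
    rw [hsum, Finset.sum_const, Finset.card_fin, nsmul_eq_mul]
    ring
  have h122t : D.c122 = t * D.b₁ * D.d₁ := by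
    have : ∀ i, bracketForm D.pr₂ D.pr₂ (D.e₁ i : LieAlg E G) (D.e₁ i) = t * D.b₁ := fun i => by
      rw [ht _ (D.e₁ i).2 _ (D.e₁ i).2, D.negKilling_e₁, if_pos rfl, mul_one]
    have hsum : D.c122 = ∑ i : Fin D.d₁, t * D.b₁ := by
      refine Finset.sum_congr rfl fun i _ => ?_
      rw [← this i, bracketForm_pr₂_pr₂]
      refine Finset.sum_congr rfl fun j _ => Finset.sum_congr rfl fun k _ => ?_
      rw [Q₂_comm, D.Q₂_of_mem_p₂ (D.e₂ k).2, negKilling_comm]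
      ring
    rw [hsum, Finset.sum_const, Finset.card_fin, nsmul_eq_mul]
    ring
  have hd₁ : (D.d₁ : ℝ) ≠ 0 := fun h => by simp [h122t, h] at h122
  have ht0 : 0 < t := by
    have : 0 < (D.d₁ : ℝ) := lt_of_le_of_ne (Nat.cast_nonneg _) hd₁.symm
    rw [h122t] at h122
    exact (mul_pos_iff_of_pos_right (by positivity)).1 (by linarith : 0 < t * (D.b₁ * D.d₁))
  have hCeq : D.constC = D.b₁ * (1 - s / 2 - t) := by
    rw [constC, h111s, h122t]
    field_simp
  refine ⟨D.constC / 2, t * D.b₂ ^ 2 / (4 * D.b₁), by positivity, by positivity, ?_⟩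
  intro x₁ x₂ h₁ h₂ X hX Y hY
  rw [D.ric_eq_bracketForm hK h₁ h₂ (D.isEigen_p₁ x₁ x₂ hX) (D.isEigen_p₁ x₁ x₂ hY) (D.p₁_le hX),
    D.bracketForm_pr₁_pr₂_of_mem_p₁ hH hX, hs X hX Y hY, ht X hX Y hY, D.Q₁_of_mem_p₁ hX, hCeq]
  simp only [ricCoeff]
  field_simp
  ring

/-- The constant parts of the two mixed coefficients cancel, leaving a term linear in `x₁/x₂`
proportional to `[122] = s b₁ d₂ > 0`. The sign of `γ` is not needed: the Einstein condition
determines `γ` later. -/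
lemma exists_ric_p₂ (hK : IsClosedLieSubgroup E EK K) (h122 : 0 < D.c122) :
    ∃ γ δ : ℝ, 0 < δ ∧ ∀ x₁ x₂ : ℝ, 0 < x₁ → 0 < x₂ → ∀ X ∈ D.p₂, ∀ Y ∈ D.p₂,
      D.ric x₁ x₂ X Y = (γ - δ * (x₁ / x₂)) * D.Q₂ X Y := by
  have hb₁ := D.b₁_pos
  have hb₂ := D.b₂_pos
  obtain ⟨s, hs⟩ := D.formInvariant_structure₁₂.exists_eq_mul D.irreducible_p₂ D.e₂ hb₂
    D.negKilling_e₂ fun X _ Y _ => D.bracketForm_pr₁_pr₂_comm X Y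
  obtain ⟨t, ht⟩ := D.formInvariant_structure₂₂.exists_eq_mul D.irreducible_p₂ D.e₂ hb₂
    D.negKilling_e₂ fun X _ Y _ => D.bracketForm_pr₂_pr₂_comm X Y
  have h122s : D.c122 = s * (D.b₁ * D.d₂) := by
    have : ∀ i, bracketForm D.pr₁ D.pr₂ (D.e₂ i : LieAlg E G) (D.e₂ i) * (D.b₁ / D.b₂) =
        s * D.b₁ := fun i => by
      rw [hs _ (D.e₂ i).2 _ (D.e₂ i).2, D.negKilling_e₂, if_pos rfl]
      field_simp
    have hsum : D.c122 = ∑ i : Fin D.d₂, s * D.b₁ := by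
      rw [c122, Finset.sum_comm]
      refine Finset.sum_congr rfl fun i _ => ?_
      rw [← this i, bracketForm_pr₁_pr₂, Finset.sum_mul]
      refine Finset.sum_congr rfl fun j _ => ?_
      rw [Finset.sum_mul]
      refine Finset.sum_congr rfl fun k _ => ?_
      rw [Q₂_comm, D.Q₂_of_mem_p₂ (D.e₂ k).2, negKilling_comm, ← lie_skew, map_neg,
        LinearMap.neg_apply]
      field_simp
    rw [hsum, Finset.sum_const, Finset.card_fin, nsmul_eq_mul]
    ring
  have hs0 : 0 < s := by
    rw [h122s] at h122
    by_contra! h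
    exact absurd h122 (not_lt.2 (mul_nonpos_of_nonpos_of_nonneg h (by positivity)))
  refine ⟨D.b₂ * (1 / 2 - t / 4), s * D.b₂ ^ 2 / (2 * D.b₁), by positivity, ?_⟩
  intro x₁ x₂ h₁ h₂ X hX Y hY
  rw [D.ric_eq_bracketForm hK h₁ h₂ (D.isEigen_p₂ x₁ x₂ hX) (D.isEigen_p₂ x₁ x₂ hY) (D.p₂_le hX),
    D.bracketForm_pr₁_pr₁_of_mem_p₂ hH hX, hs X hX Y hY, ht X hX Y hY, D.Q₂_of_mem_p₂ hX]
  simp only [ricCoeff]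
  field_simp
  ring

/-- The Ricci tensor of the invariant metrics. -/
lemma exists_ric_eq (hK : IsClosedLieSubgroup E EK K) (h122 : 0 < D.c122) (hC : 0 < D.constC) :
    ∃ α β γ δ : ℝ, 0 < α ∧ 0 < β ∧ 0 < δ ∧ ∀ x₁ x₂ : ℝ, 0 < x₁ → 0 < x₂ →
      ∀ X ∈ D.p₁ ⊔ D.p₂, ∀ Y ∈ D.p₁ ⊔ D.p₂, D.ric x₁ x₂ X Y =
        (α + β * (x₁ / x₂) ^ 2) * D.Q₁ X Y + (γ - δ * (x₁ / x₂)) * D.Q₂ X Y := by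
  obtain ⟨α, β, hα, hβ, h1⟩ := D.exists_ric_p₁ hH hK h122 hC
  obtain ⟨γ, δ, hδ, h2⟩ := D.exists_ric_p₂ hH hK h122
  refine ⟨α, β, γ, δ, hα, hβ, hδ, fun x₁ x₂ h₁ h₂ X hX Y hY => ?_⟩
  obtain ⟨X₁, hX₁, X₂, hX₂, rfl⟩ := Submodule.mem_sup.1 hX
  obtain ⟨Y₁, hY₁, Y₂, hY₂, rfl⟩ := Submodule.mem_sup.1 hY
  simp only [ric_add_left, ric_add_right, Q₁_add_left, Q₂_add_left, Q₁_add_right, Q₂_add_right,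
    h1 x₁ x₂ h₁ h₂ X₁ hX₁ Y₁ hY₁, h2 x₁ x₂ h₁ h₂ X₂ hX₂ Y₂ hY₂, D.ric_p₁_p₂ hH hK h₁ h₂ hX₁ hY₂,
    D.ric_p₂_p₁ hH hK h₁ h₂ hX₂ hY₁, D.Q₁_of_mem_p₂ hX₂, D.Q₂_of_mem_p₁ hX₁,
    D.Q₁_comm X₁ Y₂, D.Q₁_of_mem_p₂ hY₂, D.Q₂_comm X₂ Y₁, D.Q₂_of_mem_p₁ hY₁]
  ring

end

end RicciBlocks

end TwoSummands

namespace TwoSummands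

/-! ### Einstein metrics and the reduced flow -/

section Reduction

variable {E : Type*} [NormedAddCommGroup E] [NormedSpace ℝ E]
  {G : Type*} [TopologicalSpace G] [ChartedSpace E G] [Group G] [LieGroup 𝓘(ℝ, E) ∞ G]
  [CompleteSpace E]
  {EK : Type*} [NormedAddCommGroup EK] [NormedSpace ℝ EK]
  {EH : Type*} [NormedAddCommGroup EH] [NormedSpace ℝ EH]
  {K H : Subgroup G} [ChartedSpace EK K] [ChartedSpace EH H]
  (D : TwoSummands E EK EH K H) {x₁ x₂ : ℝ}

lemma exists_Q₁_eq_one : ∃ i : Fin D.d₁,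
    D.Q₁ (D.e₁ i) (D.e₁ i) = 1 ∧ D.Q₂ (D.e₁ i) (D.e₁ i) = 0 := by
  have : Nonempty (Fin D.d₁) := by
    by_contra h
    rw [not_nonempty_iff] at h
    refine D.irreducible_p₁.ne_bot ((Submodule.eq_bot_iff _).2 fun X hX => ?_)
    rw [eq_sum_repr_smul D.e₁ hX]
    exact Finset.sum_eq_zero fun i _ => h.elim i
  obtain ⟨i⟩ := this
  refine ⟨i, ?_, D.Q₂_of_mem_p₁ (D.e₁ i).2 _⟩
  rw [D.Q₁_of_mem_p₁ (D.e₁ i).2, D.negKilling_e₁, if_pos rfl, mul_one, div_self D.b₁_pos.ne']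

lemma exists_Q₂_eq_one : ∃ i : Fin D.d₂,
    D.Q₁ (D.e₂ i) (D.e₂ i) = 0 ∧ D.Q₂ (D.e₂ i) (D.e₂ i) = 1 := by
  have : Nonempty (Fin D.d₂) := by
    by_contra h
    rw [not_nonempty_iff] at h
    refine D.irreducible_p₂.ne_bot ((Submodule.eq_bot_iff _).2 fun X hX => ?_)
    rw [eq_sum_repr_smul D.e₂ hX]
    exact Finset.sum_eq_zero fun i _ => h.elim i
  obtain ⟨i⟩ := this
  refine ⟨i, D.Q₁_of_mem_p₂ (D.e₂ i).2 _, ?_⟩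
  rw [D.Q₂_of_mem_p₂ (D.e₂ i).2, D.negKilling_e₂, if_pos rfl, mul_one, div_self D.b₂_pos.ne']

/-- The Ricci tensor when there is exactly one invariant Einstein metric up to scaling. -/
lemma exists_ric_eq_of_einstein [FiniteDimensional ℝ E] [LieGroup 𝓘(ℝ, EH) ∞ H]
    (hH : IsClosedLieSubgroup E EH H) (hK : IsClosedLieSubgroup E EK K) (h122 : 0 < D.c122)
    (hC : 0 < D.constC) {r : ℝ} (hr : 0 < r)
    (hE : ∀ x₁ x₂ : ℝ, 0 < x₁ → 0 < x₂ → (D.IsEinstein x₁ x₂ ↔ x₁ / x₂ = r)) :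
    ∃ β δ : ℝ, 0 < β ∧ 0 < δ ∧ ∀ x₁ x₂ : ℝ, 0 < x₁ → 0 < x₂ →
      ∀ X ∈ D.p₁ ⊔ D.p₂, ∀ Y ∈ D.p₁ ⊔ D.p₂, D.ric x₁ x₂ X Y =
        ((β + δ) * r ^ 2 + β * (x₁ / x₂) ^ 2) * D.Q₁ X Y +
          (2 * (β + δ) * r - δ * (x₁ / x₂)) * D.Q₂ X Y := by
  obtain ⟨α, β, γ, δ, hα, hβ, hδ, h⟩ := D.exists_ric_eq hH hK h122 hC
  obtain ⟨i, hi⟩ := D.exists_Q₁_eq_one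
  obtain ⟨j, hj⟩ := D.exists_Q₂_eq_one
  have key : ∀ y : ℝ, 0 < y → (α + β * y ^ 2 = y * (γ - δ * y) ↔ y = r) := fun y hy => by
    have h1 := hE y 1 hy one_pos
    rw [div_one] at h1
    rw [← h1]
    have hy' := h y 1 hy one_pos
    rw [div_one] at hy'
    constructor
    · refine fun h2 => ⟨γ - δ * y, fun X hX Y hY => ?_⟩
      rw [hy' X hX Y hY, h2, metric]
      ring
    · rintro ⟨c, hc⟩
      have hi' := hc _ (D.p₁_le (D.e₁ i).2) _ (D.p₁_le (D.e₁ i).2)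
      have hj' := hc _ (D.p₂_le (D.e₂ j).2) _ (D.p₂_le (D.e₂ j).2)
      rw [hy' _ (D.p₁_le (D.e₁ i).2) _ (D.p₁_le (D.e₁ i).2), metric, hi.1, hi.2] at hi'
      rw [hy' _ (D.p₂_le (D.e₂ j).2) _ (D.p₂_le (D.e₂ j).2), metric, hj.1, hj.2] at hj'
      linear_combination hi' - y * hj'
  have hr0 := (key r hr).2 rfl
  have hκ : 0 < β + δ := by positivity
  -- By Vieta the left side is the other root of the quadratic. It is positive, hence Einstein, and
  -- uniqueness makes the root double.
  have hr' : α / ((β + δ) * r) = r := by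
    refine (key _ (by positivity)).1 ?_
    have h1 : α + β * (α / ((β + δ) * r)) ^ 2 - α / ((β + δ) * r) * (γ - δ * (α / ((β + δ) * r))) =
        α / ((β + δ) * r ^ 2) * (α + β * r ^ 2 - r * (γ - δ * r)) := by
      field_simp
      ring
    rw [← sub_eq_zero, h1, hr0, sub_self, mul_zero]
  have hα' : α = (β + δ) * r ^ 2 := by
    rw [div_eq_iff (by positivity)] at hr'
    linear_combination hr'
  have hγ : γ = 2 * (β + δ) * r := by
    have : r * γ = r * (2 * (β + δ) * r) := by linear_combination -hr0 + hα'
    exact mul_left_cancel₀ hr.ne' this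
  refine ⟨β, δ, hβ, hδ, fun x₁ x₂ h₁ h₂ X hX Y hY => ?_⟩
  rw [h x₁ x₂ h₁ h₂ X hX Y hY, ← hα', ← hγ]

/-- Testing the tensor equation on one unit vector from each summand recovers both scalar equations,
since both sides are combinations of `Q₁` and `Q₂`. -/
lemma isRicciFlowOn_iff {β δ r : ℝ} (h : ∀ x₁ x₂ : ℝ, 0 < x₁ → 0 < x₂ →
      ∀ X ∈ D.p₁ ⊔ D.p₂, ∀ Y ∈ D.p₁ ⊔ D.p₂, D.ric x₁ x₂ X Y =
        ((β + δ) * r ^ 2 + β * (x₁ / x₂) ^ 2) * D.Q₁ X Y +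
          (2 * (β + δ) * r - δ * (x₁ / x₂)) * D.Q₂ X Y) (x₁ x₂ : ℝ → ℝ) (J : Set ℝ) :
    D.IsRicciFlowOn x₁ x₂ J ↔ IsReducedFlow β δ r x₁ x₂ J := by
  obtain ⟨i, hi⟩ := D.exists_Q₁_eq_one
  obtain ⟨j, hj⟩ := D.exists_Q₂_eq_one
  refine forall₂_congr fun t ht => and_congr_right fun h₁ => and_congr_right fun h₂ => ⟨?_, ?_⟩
  · intro hd
    have hi' := hd _ (D.p₁_le (D.e₁ i).2) _ (D.p₁_le (D.e₁ i).2)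
    have hj' := hd _ (D.p₂_le (D.e₂ j).2) _ (D.p₂_le (D.e₂ j).2)
    rw [h _ _ h₁ h₂ _ (D.p₁_le (D.e₁ i).2) _ (D.p₁_le (D.e₁ i).2)] at hi'
    rw [h _ _ h₁ h₂ _ (D.p₂_le (D.e₂ j).2) _ (D.p₂_le (D.e₂ j).2)] at hj'
    simp only [metric, hi, mul_one, mul_zero, add_zero] at hi'
    simp only [metric, hj, mul_one, mul_zero, zero_add] at hj'
    exact ⟨hi', hj'⟩
  · rintro ⟨h3, h4⟩ X hX Y hY
    rw [h _ _ h₁ h₂ X hX Y hY]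
    refine ((h3.mul_const (D.Q₁ X Y)).add (h4.mul_const (D.Q₂ X Y))).congr_deriv ?_
    ring

end Reduction

/-! ### The norm of the curvature tensor -/

section CurvatureNorm

variable {E : Type*} [NormedAddCommGroup E] [NormedSpace ℝ E]
  {G : Type*} [TopologicalSpace G] [ChartedSpace E G] [Group G] [LieGroup 𝓘(ℝ, E) ∞ G]
  [CompleteSpace E]
  {EK : Type*} [NormedAddCommGroup EK] [NormedSpace ℝ EK]
  {EH : Type*} [NormedAddCommGroup EH] [NormedSpace ℝ EH]
  {K H : Subgroup G} [ChartedSpace EK K] [ChartedSpace EH H]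
  (D : TwoSummands E EK EH K H) {x₁ x₂ : ℝ}

lemma weight_mul (c x₁ x₂ : ℝ) (a) : D.weight (c * x₁) (c * x₂) a = c * D.weight x₁ x₂ a := by
  rcases a with a | a <;> rfl

lemma metric_mul (c x₁ x₂ : ℝ) (X Y : LieAlg E G) :
    D.metric (c * x₁) (c * x₂) X Y = c * D.metric x₁ x₂ X Y := by
  rw [metric, metric]
  ring

lemma nabla_mul {c : ℝ} (hc : c ≠ 0) (x₁ x₂ : ℝ) (X Y : LieAlg E G) :
    D.nabla (c * x₁) (c * x₂) X Y = D.nabla x₁ x₂ X Y := by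
  refine Finset.sum_congr rfl fun a _ => ?_
  rw [koszul, koszul, weight_mul, metric_mul, metric_mul, metric_mul, ← mul_add, ← mul_add,
    mul_div_assoc, mul_div_mul_left _ _ hc]

/-- Connection and curvature operator are unchanged by scaling. Each squared component gains `c²`
from the metric and loses `c⁴` to the four weights. -/
lemma rmNorm_mul {c : ℝ} (hc : 0 < c) (x₁ x₂ : ℝ) :
    D.rmNorm (c * x₁) (c * x₂) = c⁻¹ * D.rmNorm x₁ x₂ := by
  have h : ∀ X Y Z, D.curv (c * x₁) (c * x₂) X Y Z = D.curv x₁ x₂ X Y Z := fun X Y Z => by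
    simp only [curv, D.nabla_mul hc.ne']
  rw [rmNorm, rmNorm, ← Real.sqrt_sq (inv_pos.2 hc).le, ← Real.sqrt_mul (sq_nonneg _)]
  congr 1
  simp only [Finset.mul_sum, h, weight_mul, metric_mul]
  refine Finset.sum_congr rfl fun _ _ => Finset.sum_congr rfl fun _ _ =>
    Finset.sum_congr rfl fun _ _ => Finset.sum_congr rfl fun _ _ => ?_
  have := hc.ne'
  rw [show ∀ p q r s : ℝ, c * p * (c * q) * (c * r) * (c * s) = c ^ 2 * (c ^ 2 * (p * q * r * s))
    by intros; ring, mul_pow, mul_div_mul_left _ _ (by positivity), ← div_div, div_right_comm,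
    inv_pow, div_eq_inv_mul]

lemma rmNorm_eq (x₁ : ℝ) (h₂ : 0 < x₂) :
    D.rmNorm x₁ x₂ = x₂⁻¹ * D.rmNorm (x₁ / x₂) 1 := by
  rw [← D.rmNorm_mul h₂, mul_one, mul_div_cancel₀ _ h₂.ne']

lemma le_rmNorm (h₁ : 0 < x₁) (h₂ : 0 < x₂) (a b c d) :
    |D.metric x₁ x₂ (D.curv x₁ x₂ (D.basis a) (D.basis b) (D.basis c)) (D.basis d)| ≤
      D.rmNorm x₁ x₂ *
        √(D.weight x₁ x₂ a * D.weight x₁ x₂ b * D.weight x₁ x₂ c * D.weight x₁ x₂ d) := by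
  have hw := fun a => D.weight_pos h₁ h₂ a
  have hw4 : 0 < D.weight x₁ x₂ a * D.weight x₁ x₂ b * D.weight x₁ x₂ c * D.weight x₁ x₂ d :=
    mul_pos (mul_pos (mul_pos (hw a) (hw b)) (hw c)) (hw d)
  have hnn : ∀ a b c d, 0 ≤ D.metric x₁ x₂ (D.curv x₁ x₂ (D.basis a) (D.basis b) (D.basis c))
      (D.basis d) ^ 2 / (D.weight x₁ x₂ a * D.weight x₁ x₂ b * D.weight x₁ x₂ c *
        D.weight x₁ x₂ d) := fun a b c d => div_nonneg (sq_nonneg _)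
    (mul_pos (mul_pos (mul_pos (hw a) (hw b)) (hw c)) (hw d)).le
  rw [rmNorm, ← Real.sqrt_mul (Finset.sum_nonneg fun a _ => Finset.sum_nonneg fun b _ =>
    Finset.sum_nonneg fun c _ => Finset.sum_nonneg fun d _ => hnn a b c d)]
  refine Real.abs_le_sqrt ?_
  rw [← div_le_iff₀ hw4]
  refine le_trans ?_ (Finset.single_le_sum (fun a _ => Finset.sum_nonneg fun b _ =>
    Finset.sum_nonneg fun c _ => Finset.sum_nonneg fun d _ => hnn a b c d) (Finset.mem_univ a))
  refine le_trans ?_ (Finset.single_le_sum (fun b _ =>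
    Finset.sum_nonneg fun c _ => Finset.sum_nonneg fun d _ => hnn a b c d) (Finset.mem_univ b))
  refine le_trans ?_ (Finset.single_le_sum (fun c _ =>
    Finset.sum_nonneg fun d _ => hnn a b c d) (Finset.mem_univ c))
  exact Finset.single_le_sum (fun d _ => hnn a b c d) (Finset.mem_univ d)

/-- Each of the `d₁ + d₂` terms of the trace is one component of the curvature tensor; the factor
`x₁` is the squared length of the vector. -/
lemma ric_e₁_le (h₁ : 0 < x₁) (h₂ : 0 < x₂) (i) :
    D.ric x₁ x₂ (D.e₁ i) (D.e₁ i) ≤ (D.d₁ + D.d₂) * (D.rmNorm x₁ x₂ * x₁) := by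
  have : ((D.d₁ : ℝ) + D.d₂) * (D.rmNorm x₁ x₂ * x₁) =
      ∑ a : Fin D.d₁ ⊕ Fin D.d₂, D.rmNorm x₁ x₂ * x₁ := by
    simp
  rw [this]
  refine Finset.sum_le_sum fun a _ => ?_
  have hw := D.weight_pos h₁ h₂ a
  rw [div_le_iff₀ hw]
  refine (le_abs_self _).trans ((D.le_rmNorm h₁ h₂ a (Sum.inl i) (Sum.inl i) a).trans_eq ?_)
  have : D.weight x₁ x₂ (Sum.inl i) = x₁ := rfl
  rw [this, show D.weight x₁ x₂ a * x₁ * x₁ * D.weight x₁ x₂ a = (x₁ * D.weight x₁ x₂ a) ^ 2 by ring,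
    Real.sqrt_sq (by positivity)]
  ring

omit [CompleteSpace E] in
-- Continuity of vectors depending on `y` is expressed by testing against linear functionals; this
-- passes through the nested connection terms of the curvature.
lemma continuousAt_of_isLinearMap {y : ℝ} {V : ℝ → LieAlg E G}
    (hV : ∀ f : LieAlg E G →ₗ[ℝ] ℝ, ContinuousAt (fun y => f (V y)) y) (f : LieAlg E G → ℝ)
    (h₁ : ∀ X Y, f (X + Y) = f X + f Y) (h₂ : ∀ (c : ℝ) (X), f (c • X) = c * f X) :
    ContinuousAt (fun y => f (V y)) y :=
  hV { toFun := f, map_add' := h₁, map_smul' := h₂ }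

lemma continuousAt_nabla [FiniteDimensional ℝ E] {y : ℝ} (hy : 0 < y) (X : LieAlg E G)
    {V : ℝ → LieAlg E G} (hV : ∀ f : LieAlg E G →ₗ[ℝ] ℝ, ContinuousAt (fun y => f (V y)) y)
    (f : LieAlg E G →ₗ[ℝ] ℝ) : ContinuousAt (fun y => f (D.nabla y 1 X (V y))) y := by
  simp only [nabla, map_sum, map_smul, smul_eq_mul]
  refine tendsto_finsetSum _ fun a _ => ?_
  refine ContinuousAt.mul (ContinuousAt.div ?_ ?_ (D.weight_pos hy one_pos a).ne') continuousAt_const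
  · simp only [koszul, metric]
    have h1 : ∀ (g : LieAlg E G →ₗ[ℝ] LieAlg E G) (Z W : LieAlg E G),
        ContinuousAt (fun y => negKilling E G (g ⁅Z, V y⁆) W) y := fun g Z W =>
      continuousAt_of_isLinearMap hV (fun U => negKilling E G (g ⁅Z, U⁆) W)
        (fun _ _ => by rw [lie_add, map_add, map_add, LinearMap.add_apply])
        (fun _ _ => by rw [lie_smul, map_smul, map_smul, LinearMap.smul_apply, smul_eq_mul])
    have h2 : ∀ Z, ContinuousAt (fun y => negKilling E G Z (V y)) y := fun Z =>
      hV (negKilling E G Z)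
    have h3 : ∀ Z W : LieAlg E G, ContinuousAt (fun y => negKilling E G Z ⁅W, V y⁆) y := fun Z W =>
      continuousAt_of_isLinearMap hV (fun U => negKilling E G Z ⁅W, U⁆)
        (fun _ _ => by rw [lie_add, map_add])
        (fun _ _ => by rw [lie_smul, map_smul, smul_eq_mul])
    simp only [Q₁_eq, Q₂_eq]
    have h4 : ∀ f g : ℝ → ℝ, ContinuousAt f y → ContinuousAt g y →
        ContinuousAt (fun y => y * (f y / D.b₁) + 1 * (g y / D.b₂)) y := fun f g hf hg =>
      (continuousAt_id.mul (hf.div_const _)).add (continuousAt_const.mul (hg.div_const _))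
    exact (((h4 _ _ (h1 _ _ _) (h1 _ _ _)).add (h4 _ _ (h2 _) (h2 _))).add
      (h4 _ _ (h3 _ _) (h3 _ _))).div_const 2
  · rcases a with a | a
    · exact continuousAt_id
    · exact continuousAt_const

lemma continuousAt_rmNorm [FiniteDimensional ℝ E] {y : ℝ} (hy : 0 < y) :
    ContinuousAt (fun y => D.rmNorm y 1) y := by
  refine Real.continuous_sqrt.continuousAt.comp ?_
  refine tendsto_finsetSum _ fun a _ => tendsto_finsetSum _ fun b _ =>
    tendsto_finsetSum _ fun c _ => tendsto_finsetSum _ fun d _ => ?_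
  have hw : ∀ a, ContinuousAt (fun y => D.weight y 1 a) y := fun a => by
    rcases a with a | a
    · exact continuousAt_id
    · exact continuousAt_const
  have hpos := fun a => (D.weight_pos hy one_pos a).ne'
  have h0 : ∀ X (f : LieAlg E G →ₗ[ℝ] ℝ), ContinuousAt (fun _ : ℝ => f X) y := fun X f =>
    continuousAt_const
  have hcurv : ∀ f : LieAlg E G →ₗ[ℝ] ℝ, ContinuousAt (fun y => f (D.curv y 1 (D.basis a)
      (D.basis b) (D.basis c))) y := fun f => by
    simp only [curv, map_sub]
    refine ((ContinuousAt.sub ?_ ?_).sub ?_).sub continuousAt_const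
    · exact D.continuousAt_nabla hy _ (fun g => D.continuousAt_nabla hy _ (h0 _) g) f
    · exact D.continuousAt_nabla hy _ (fun g => D.continuousAt_nabla hy _ (h0 _) g) f
    · exact D.continuousAt_nabla hy _ (h0 _) f
  refine ContinuousAt.div (ContinuousAt.pow ?_ 2) ((((hw a).mul (hw b)).mul (hw c)).mul (hw d))
    (mul_ne_zero (mul_ne_zero (mul_ne_zero (hpos a) (hpos b)) (hpos c)) (hpos d))
  simp only [metric]
  refine ContinuousAt.add (continuousAt_id.mul ?_) (continuousAt_const.mul ?_)
  · simp only [Q₁_eq]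
    exact (continuousAt_of_isLinearMap hcurv
      (fun U => negKilling E G (D.pr₁ U) (D.basis d))
      (fun _ _ => by rw [map_add, map_add, LinearMap.add_apply])
      (fun _ _ => by rw [map_smul, map_smul, LinearMap.smul_apply, smul_eq_mul])).div_const _
  · simp only [Q₂_eq]
    exact (continuousAt_of_isLinearMap hcurv
      (fun U => negKilling E G (D.pr₂ U) (D.basis d))
      (fun _ _ => by rw [map_add, map_add, LinearMap.add_apply])
      (fun _ _ => by rw [map_smul, map_smul, LinearMap.smul_apply, smul_eq_mul])).div_const _

/-- A uniform lower bound on the Ricci tensor along `𝔭₁`, against `ric_e₁_le`, forces `|Rm|` to grow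
at least like `1/x₁`. -/
lemma curvatureUnbounded_of_tendsto {x₁ x₂ : ℝ → ℝ} {T α : ℝ} (hα : 0 < α)
    (hric : ∀ x₁ x₂ : ℝ, 0 < x₁ → 0 < x₂ → ∀ i, α ≤ D.ric x₁ x₂ (D.e₁ i) (D.e₁ i))
    (hpos : ∀ᶠ t in 𝓝[<] T, 0 < x₁ t ∧ 0 < x₂ t) (hx : Tendsto x₁ (𝓝[<] T) (𝓝 0)) :
    D.CurvatureUnbounded x₁ x₂ T := by
  obtain ⟨i, -⟩ := D.exists_Q₁_eq_one
  intro M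
  refine Eventually.frequently ?_
  have hd : 0 ≤ (D.d₁ : ℝ) + D.d₂ := by positivity
  have h1 : ∀ᶠ t in 𝓝[<] T, ((D.d₁ : ℝ) + D.d₂) * (M * x₁ t) < α := by
    have := (hx.const_mul M).const_mul ((D.d₁ : ℝ) + D.d₂)
    rw [mul_zero, mul_zero] at this
    exact this.eventually_lt_const hα
  filter_upwards [h1, hpos] with t ht ⟨h₁, h₂⟩
  have h3 := (hric _ _ h₁ h₂ i).trans (D.ric_e₁_le h₁ h₂ i)
  by_contra! hM
  have : ((D.d₁ : ℝ) + D.d₂) * (D.rmNorm (x₁ t) (x₂ t) * x₁ t) ≤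
      ((D.d₁ : ℝ) + D.d₂) * (M * x₁ t) := by gcongr
  linarith

end CurvatureNorm

end TwoSummands

/-! ### The logarithmic derivative of a curve in a Lie group -/

section LogDeriv

variable {E : Type*} [NormedAddCommGroup E] [NormedSpace ℝ E]
  {G : Type*} [TopologicalSpace G] [ChartedSpace E G] [Group G] [LieGroup 𝓘(ℝ, E) ∞ G]

variable (E) in
/-- The left logarithmic derivative `γ⁻¹ γ'` of a curve in a Lie group. -/
def leftLogDeriv (γ : ℝ → G) (t : ℝ) : LieAlg E G :=
  modelDeriv ℝ E (fun s => (γ t)⁻¹ * γ s) t 1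

lemma leftLogDeriv_eq {γ : ℝ → G} {t : ℝ} (hγ : MDifferentiableAt 𝓘(ℝ, ℝ) 𝓘(ℝ, E) γ t) :
    leftLogDeriv E γ t =
      modelDeriv E E (fun z : G => (γ t)⁻¹ * z) (γ t) (modelDeriv ℝ E γ t 1) :=
  modelDeriv_comp_apply (E := ℝ) (F := E) (E' := E) rfl (mdifferentiable_mul_left (γ t)⁻¹ (γ t)) hγ 1

lemma leftLogDeriv_mul_left (g : G) (γ : ℝ → G) (t : ℝ) :
    leftLogDeriv E (fun s => g * γ s) t = leftLogDeriv E γ t := by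
  simp only [leftLogDeriv, mul_inv_rev, mul_assoc, inv_mul_cancel_left]
  rfl

lemma mdifferentiableAt_inv_mul {γ : ℝ → G} {t : ℝ}
    (hγ : MDifferentiableAt 𝓘(ℝ, ℝ) 𝓘(ℝ, E) γ t) (g : G) :
    MDifferentiableAt 𝓘(ℝ, ℝ) 𝓘(ℝ, E) (fun s => g * γ s) t :=
  (mdifferentiable_mul_left g (γ t)).comp t hγ

lemma leftLogDeriv_mul_right {γ : ℝ → G} {t : ℝ}
    (hγ : MDifferentiableAt 𝓘(ℝ, ℝ) 𝓘(ℝ, E) γ t) (k : G) :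
    leftLogDeriv E (fun s => γ s * k) t = Ad E k⁻¹ (leftLogDeriv E γ t) := by
  have h : (fun s => (γ t * k)⁻¹ * (γ s * k)) = fun s => k⁻¹ * ((γ t)⁻¹ * γ s) * k⁻¹⁻¹ := by
    ext s
    group
  rw [leftLogDeriv, h]
  exact modelDeriv_comp_apply (E := ℝ) (F := E) (E' := E) (f := fun x : G => k⁻¹ * x * k⁻¹⁻¹)
    (h := fun s => (γ t)⁻¹ * γ s) (by simp) (mdifferentiable_conj k⁻¹ 1)
    (mdifferentiableAt_inv_mul hγ _) 1

lemma leftLogDeriv_coe {F : Type*} [NormedAddCommGroup F] [NormedSpace ℝ F] {L : Subgroup G}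
    [ChartedSpace F L] [LieGroup 𝓘(ℝ, F) ∞ L] (hL : IsClosedLieSubgroup E F L) {γ : ℝ → L} {t : ℝ}
    (hγ : MDifferentiableAt 𝓘(ℝ, ℝ) 𝓘(ℝ, F) γ t) :
    leftLogDeriv E (fun s => (γ s : G)) t = inclDeriv E F L (leftLogDeriv F γ t) :=
  modelDeriv_comp_apply (E := ℝ) (F := F) (E' := E) (f := (Subtype.val : L → G))
    (h := fun s => (γ t)⁻¹ * γ s) (by simp) ((hL.smooth.mdifferentiable (by simp)) 1)
    (mdifferentiableAt_inv_mul hγ _) 1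

lemma leftLogDeriv_eq_fderiv {γ : ℝ → G} {t : ℝ}
    (hγ : MDifferentiableAt 𝓘(ℝ, ℝ) 𝓘(ℝ, E) γ t) :
    leftLogDeriv E γ t =
      fderiv ℝ (fun s => extChartAt 𝓘(ℝ, E) (1 : G) ((γ t)⁻¹ * γ s)) t 1 := by
  have h := modelDeriv_comp_apply (E := ℝ) (F := E) (E' := E)
    (f := extChartAt 𝓘(ℝ, E) (1 : G)) (h := fun s => (γ t)⁻¹ * γ s) (x := t) (y := 1) (by simp)
    mdifferentiableAt_extChartAt_one (mdifferentiableAt_inv_mul hγ _) 1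
  rw [modelDeriv_extChartAt_one, modelDeriv_eq_fderiv] at h
  exact h.symm

/-- The derivative of a partial map along the diagonal. -/
lemma fderiv_partial_right {f : E × E → E} {c : ℝ → E} {t : ℝ} {v : E}
    (hf : DifferentiableAt ℝ f (c t, c t)) (hc : HasDerivAt c v t) :
    fderiv ℝ (fun s => f (c t, c s)) t 1 = fderiv ℝ f (c t, c t) (0, v) := by
  have h1 : HasDerivAt (fun s => (c t, c s)) ((0 : E), v) t := (hasDerivAt_const t (c t)).prodMk hc
  have h2 : HasDerivAt (fun s => f (c t, c s)) (fderiv ℝ f (c t, c t) (0, v)) t :=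
    hf.hasFDerivAt.comp_hasDerivAt t h1
  rw [← h2.deriv]
  rfl

variable (E G) in
/-- The left division `x⁻¹ y` in the chart at the identity. -/
def chartDiv (p : E × E) : E :=
  extChartAt 𝓘(ℝ, E) (1 : G)
    (((extChartAt 𝓘(ℝ, E) (1 : G)).symm p.1)⁻¹ * (extChartAt 𝓘(ℝ, E) (1 : G)).symm p.2)

lemma contDiffAt_chartDiv : ContDiffAt ℝ ∞ (chartDiv E G) (chartOne E G, chartOne E G) := by
  have : ContMDiffAt 𝓘(ℝ, E × E) 𝓘(ℝ, E) ∞ (chartDiv E G) (chartOne E G, chartOne E G) := by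
    have ht : ContMDiffAt 𝓘(ℝ, E) 𝓘(ℝ, E) ∞ (extChartAt 𝓘(ℝ, E) (1 : G)).symm (chartOne E G) :=
      (contMDiffOn_extChartAt_symm (1 : G)).contMDiffAt (extChartAt_target_mem_nhds (1 : G))
    have h1 : ContMDiffAt 𝓘(ℝ, E × E) 𝓘(ℝ, E) ∞
        (fun p : E × E => (extChartAt 𝓘(ℝ, E) (1 : G)).symm p.1) (chartOne E G, chartOne E G) :=
      ContMDiffAt.comp (x := (chartOne E G, chartOne E G)) ht contDiff_fst.contMDiff.contMDiffAt
    have h2 : ContMDiffAt 𝓘(ℝ, E × E) 𝓘(ℝ, E) ∞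
        (fun p : E × E => (extChartAt 𝓘(ℝ, E) (1 : G)).symm p.2) (chartOne E G, chartOne E G) :=
      ContMDiffAt.comp (x := (chartOne E G, chartOne E G)) ht contDiff_snd.contMDiff.contMDiffAt
    have h3 := h1.inv.mul h2
    refine ContMDiffAt.comp (x := (chartOne E G, chartOne E G))
      (g := extChartAt 𝓘(ℝ, E) (1 : G)) ?_ h3
    have h4 : ((extChartAt 𝓘(ℝ, E) (1 : G)).symm (chartOne E G))⁻¹ *
        (extChartAt 𝓘(ℝ, E) (1 : G)).symm (chartOne E G) = 1 := by simp
    simp only [h4]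
    exact contMDiffAt_extChartAt
  exact contMDiffAt_iff_contDiffAt.1 this

/-- In the single chart at the identity, `(s, t) ↦ γ(s)⁻¹ γ(t)` is `C¹` near the diagonal, and the
logarithmic derivative is its second partial derivative there. -/
lemma continuous_leftLogDeriv {γ : ℝ → G} (hγ : ContMDiff 𝓘(ℝ, ℝ) 𝓘(ℝ, E) 1 γ) :
    Continuous (fun t => (leftLogDeriv E γ t : E)) := by
  have := isManifold_one (E := E) (G := G)
  rw [continuous_iff_continuousAt]
  intro t₀
  set f : ℝ × ℝ → E := fun p => extChartAt 𝓘(ℝ, E) (1 : G) ((γ p.1)⁻¹ * γ p.2) with hf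
  have hfC : ContDiffAt ℝ 1 f (t₀, t₀) := by
    rw [← contMDiffAt_iff_contDiffAt]
    have h1 : ContMDiffAt 𝓘(ℝ, ℝ × ℝ) 𝓘(ℝ, E) 1 (fun p : ℝ × ℝ => γ p.1) (t₀, t₀) :=
      (hγ t₀).comp (x := (t₀, t₀)) (f := (Prod.fst : ℝ × ℝ → ℝ)) contDiff_fst.contMDiff.contMDiffAt
    have h2 : ContMDiffAt 𝓘(ℝ, ℝ × ℝ) 𝓘(ℝ, E) 1 (fun p : ℝ × ℝ => γ p.2) (t₀, t₀) :=
      (hγ t₀).comp (x := (t₀, t₀)) (f := (Prod.snd : ℝ × ℝ → ℝ)) contDiff_snd.contMDiff.contMDiffAt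
    have : LieGroup 𝓘(ℝ, E) 1 G := LieGroup.of_le (n := ∞) (by simp)
    have h3 := h1.inv.mul h2
    refine ContMDiffAt.comp (x := (t₀, t₀)) (g := extChartAt 𝓘(ℝ, E) (1 : G)) ?_ h3
    simp only [inv_mul_cancel]
    exact contMDiffAt_extChartAt
  have hev : ∀ᶠ t in 𝓝 t₀, DifferentiableAt ℝ f (t, t) := by
    have h1 := hfC.eventually (by simp)
    have hc : Tendsto (fun t : ℝ => (t, t)) (𝓝 t₀) (𝓝 (t₀, t₀)) :=
      (continuous_id.prodMk continuous_id).tendsto t₀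
    filter_upwards [hc.eventually h1] with t ht using ht.differentiableAt (by simp)
  have hcont : ContinuousAt (fun t => fderiv ℝ f (t, t) (0, 1)) t₀ := by
    have h1 : ContinuousAt (fderiv ℝ f) (t₀, t₀) :=
      (hfC.fderiv_right (m := 0) (by simp)).continuousAt
    have hc : ContinuousAt (fun t : ℝ => (t, t)) t₀ := (continuous_id.prodMk continuous_id).continuousAt
    exact (ContinuousAt.comp (f := fun t : ℝ => (t, t)) (x := t₀) h1 hc).clm_apply continuousAt_const
  refine hcont.congr ?_
  filter_upwards [hev] with t ht
  have h1 : HasDerivAt (fun s : ℝ => (t, s)) ((0 : ℝ), (1 : ℝ)) t :=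
    (hasDerivAt_const t t).prodMk (hasDerivAt_id t)
  have h2 : HasDerivAt (fun s => f (t, s)) (fderiv ℝ f (t, t) (0, 1)) t :=
    ht.hasFDerivAt.comp_hasDerivAt t h1
  rw [leftLogDeriv_eq_fderiv (hγ.mdifferentiable (by simp) t), ← h2.deriv]
  rfl

end LogDeriv

/-! ### Lengths of curves -/

section Lengths

variable {E : Type*} [NormedAddCommGroup E] [NormedSpace ℝ E]
  {G : Type*} [TopologicalSpace G] [ChartedSpace E G] [Group G] [LieGroup 𝓘(ℝ, E) ∞ G]

/-- The absolutely homogeneous functions of at most linear growth on the Lie algebra. -/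
structure IsLengthFunction (N : LieAlg E G → ℝ) : Prop where
  homogeneous : ∀ (c : ℝ) (X : LieAlg E G), N (c • X) = |c| * N X
  bounded : ∃ C : ℝ, ∀ X : E, N X ≤ C * ‖X‖

/-- The extended norms on the tangent spaces that define `leftEDist`. -/
abbrev tangentENorm (N : LieAlg E G → ℝ) (x : G) : ENorm (TangentSpace 𝓘(ℝ, E) x) :=
  ⟨fun v => ENNReal.ofReal
    (N ((mfderiv 𝓘(ℝ, E) 𝓘(ℝ, E) (fun z : G => x⁻¹ * z) x : E →L[ℝ] E) v))⟩

omit [LieGroup 𝓘(ℝ, E) ∞ G] in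
lemma leftEDist_eq (N : LieAlg E G → ℝ) (a b : G) :
    leftEDist E N a b = letI := tangentENorm N; riemannianEDist 𝓘(ℝ, E) a b := rfl

omit [LieGroup 𝓘(ℝ, E) ∞ G] in
lemma IsLengthFunction.eNormSMulClass {N : LieAlg E G → ℝ} (hN : IsLengthFunction N) (x : G) :
    letI := tangentENorm N
    ENormSMulClass ℝ (TangentSpace 𝓘(ℝ, E) x) := by
  let _ := tangentENorm N
  refine ⟨fun c v => ?_⟩
  change ENNReal.ofReal (N (modelDeriv E E (fun z : G => x⁻¹ * z) x (c • v))) =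
    ‖c‖ₑ * ENNReal.ofReal (N (modelDeriv E E (fun z : G => x⁻¹ * z) x v))
  rw [Real.enorm_eq_ofReal_abs, ← ENNReal.ofReal_mul (abs_nonneg c)]
  have h := map_smul (modelDeriv E E (fun z : G => x⁻¹ * z) x) c (show E from v)
  exact congrArg _ ((congrArg N h).trans (hN.homogeneous c _))

/-- The length of a curve on the unit interval. -/
def curveLength (N : LieAlg E G → ℝ) (γ : ℝ → G) : ENNReal :=
  ∫⁻ t in Ioo (0 : ℝ) 1, ENNReal.ofReal (N (leftLogDeriv E γ t))

lemma pathELength_eq_curveLength (N : LieAlg E G → ℝ) {γ : ℝ → G}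
    (hγ : ∀ t ∈ Ioo (0 : ℝ) 1, MDifferentiableAt 𝓘(ℝ, ℝ) 𝓘(ℝ, E) γ t) :
    letI := tangentENorm N
    pathELength 𝓘(ℝ, E) γ 0 1 = curveLength N γ := by
  let _ := tangentENorm N
  rw [pathELength_eq_lintegral_mfderiv_Ioo]
  refine MeasureTheory.setLIntegral_congr_fun measurableSet_Ioo fun t ht => ?_
  change ENNReal.ofReal (N (modelDeriv E E (fun z : G => (γ t)⁻¹ * z) (γ t) (modelDeriv ℝ E γ t 1))) = _
  rw [leftLogDeriv_eq (hγ t ht)]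

variable {N : LieAlg E G → ℝ}

lemma leftEDist_le_curveLength (hN : IsLengthFunction N) {γ : ℝ → G}
    (hγ : ∀ t ∈ Icc (0 : ℝ) 1, ContMDiffAt 𝓘(ℝ, ℝ) 𝓘(ℝ, E) 1 γ t) :
    leftEDist E N (γ 0) (γ 1) ≤ curveLength N γ := by
  let _ := tangentENorm N
  have _ : ∀ x : G, ENormSMulClass ℝ (TangentSpace 𝓘(ℝ, E) x) := hN.eNormSMulClass
  rw [← pathELength_eq_curveLength N fun t ht =>
    (hγ t (Ioo_subset_Icc_self ht)).mdifferentiableAt (by simp)]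
  rw [leftEDist_eq]
  exact riemannianEDist_le_pathELength (fun t ht => (hγ t ht).contMDiffWithinAt) rfl rfl zero_le_one

lemma exists_curveLength_lt (hN : IsLengthFunction N) {a b : G} {r : ENNReal}
    (h : leftEDist E N a b < r) : ∃ γ : ℝ → G, γ 0 = a ∧ γ 1 = b ∧
      ContMDiff 𝓘(ℝ, ℝ) 𝓘(ℝ, E) 1 γ ∧ curveLength N γ < r := by
  let _ := tangentENorm N
  have _ : ∀ x : G, ENormSMulClass ℝ (TangentSpace 𝓘(ℝ, E) x) := hN.eNormSMulClass
  rw [leftEDist_eq] at h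
  obtain ⟨γ, h0, h1, h2, h3, -⟩ :=
    exists_lt_locally_constant_of_riemannianEDist_lt (I := 𝓘(ℝ, E)) h zero_lt_one
  refine ⟨γ, h0, h1, h2, ?_⟩
  rwa [← pathELength_eq_curveLength N fun t _ => h2.mdifferentiable (by simp) t]

lemma leftEDist_self (hN : IsLengthFunction N) (a : G) : leftEDist E N a a = 0 := by
  let _ := tangentENorm N
  have _ : ∀ x : G, ENormSMulClass ℝ (TangentSpace 𝓘(ℝ, E) x) := hN.eNormSMulClass
  rw [leftEDist_eq]
  exact riemannianEDist_self

lemma leftEDist_comm (hN : IsLengthFunction N) (a b : G) :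
    leftEDist E N a b = leftEDist E N b a := by
  let _ := tangentENorm N
  have _ : ∀ x : G, ENormSMulClass ℝ (TangentSpace 𝓘(ℝ, E) x) := hN.eNormSMulClass
  rw [leftEDist_eq, leftEDist_eq]
  exact riemannianEDist_comm

lemma leftEDist_triangle (hN : IsLengthFunction N) (a b c : G) :
    leftEDist E N a c ≤ leftEDist E N a b + leftEDist E N b c := by
  let _ := tangentENorm N
  have _ : ∀ x : G, ENormSMulClass ℝ (TangentSpace 𝓘(ℝ, E) x) := hN.eNormSMulClass
  have := isManifold_one (E := E) (G := G)
  rw [leftEDist_eq, leftEDist_eq, leftEDist_eq]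
  exact riemannianEDist_triangle

lemma leftEDist_mul_left_le (hN : IsLengthFunction N) (g a b : G) :
    leftEDist E N (g * a) (g * b) ≤ leftEDist E N a b := by
  refine le_of_forall_gt fun r hr => ?_
  obtain ⟨γ, rfl, rfl, hγ, hlen⟩ := exists_curveLength_lt hN hr
  refine lt_of_le_of_lt (leftEDist_le_curveLength hN (γ := fun s => g * γ s) fun t _ => ?_) ?_
  · exact ((contMDiff_mul_left (I := 𝓘(ℝ, E)) (n := ∞) (a := g)).of_le (by simp)).contMDiffAt.comp t
      (hγ t)
  · simpa only [curveLength, leftLogDeriv_mul_left] using hlen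

lemma leftEDist_mul_left (hN : IsLengthFunction N) (g a b : G) :
    leftEDist E N (g * a) (g * b) = leftEDist E N a b := by
  refine le_antisymm (leftEDist_mul_left_le hN g a b) ?_
  simpa using leftEDist_mul_left_le hN g⁻¹ (g * a) (g * b)

lemma leftEDist_eq_one (hN : IsLengthFunction N) (a b : G) :
    leftEDist E N a b = leftEDist E N 1 (a⁻¹ * b) := by
  rw [← leftEDist_mul_left hN a⁻¹, inv_mul_cancel]

/-- Right translation by `k` changes the logarithmic derivative by `Ad k⁻¹`, so it preserves lengths
when `N` is `Ad`-invariant at `k`. -/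
lemma leftEDist_mul_right_le (hN : IsLengthFunction N) {k : G} (hk : ∀ X, N (Ad E k⁻¹ X) = N X)
    (a b : G) : leftEDist E N (a * k) (b * k) ≤ leftEDist E N a b := by
  refine le_of_forall_gt fun r hr => ?_
  obtain ⟨γ, rfl, rfl, hγ, hlen⟩ := exists_curveLength_lt hN hr
  refine lt_of_le_of_lt (leftEDist_le_curveLength hN (γ := fun s => γ s * k) fun t _ => ?_) ?_
  · exact ((contMDiff_mul_right (I := 𝓘(ℝ, E)) (n := ∞) (a := k)).of_le (by simp)).contMDiffAt.comp t
      (hγ t)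
  · have h : ∀ t, leftLogDeriv E (fun s => γ s * k) t = Ad E k⁻¹ (leftLogDeriv E γ t) := fun t =>
      leftLogDeriv_mul_right (hγ.mdifferentiable (by simp) t) k
    simpa only [curveLength, h, hk] using hlen

omit [LieGroup 𝓘(ℝ, E) ∞ G] in
lemma curveLength_le_mul {N' : LieAlg E G → ℝ} {c : ℝ} (hc : 0 ≤ c) (h : ∀ X, N X ≤ c * N' X)
    (γ : ℝ → G) : curveLength N γ ≤ ENNReal.ofReal c * curveLength N' γ := by
  rw [curveLength, curveLength, ← MeasureTheory.lintegral_const_mul' _ _ ENNReal.ofReal_ne_top]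
  refine MeasureTheory.lintegral_mono fun t => ?_
  rw [← ENNReal.ofReal_mul hc]
  exact ENNReal.ofReal_le_ofReal (h _)

lemma leftEDist_le_mul {N' : LieAlg E G → ℝ} (hN : IsLengthFunction N) (hN' : IsLengthFunction N')
    {c : ℝ} (hc : 0 < c) (h : ∀ X, N X ≤ c * N' X) (a b : G) :
    leftEDist E N a b ≤ ENNReal.ofReal c * leftEDist E N' a b := by
  have hc0 : ENNReal.ofReal c ≠ 0 := by simpa using hc
  refine le_of_forall_gt fun r hr => ?_
  rw [mul_comm, ← ENNReal.lt_div_iff_mul_lt (Or.inl hc0) (Or.inl ENNReal.ofReal_ne_top)] at hr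
  obtain ⟨γ, rfl, rfl, hγ, hlen⟩ := exists_curveLength_lt hN' hr
  refine (leftEDist_le_curveLength hN fun t _ => hγ t).trans_lt
    ((curveLength_le_mul hc.le h γ).trans_lt ?_)
  rwa [mul_comm, ← ENNReal.lt_div_iff_mul_lt (Or.inl hc0) (Or.inl ENNReal.ofReal_ne_top)]

lemma leftEDist_coe_le {F : Type*} [NormedAddCommGroup F] [NormedSpace ℝ F] {L : Subgroup G}
    [ChartedSpace F L] [LieGroup 𝓘(ℝ, F) ∞ L] (hL : IsClosedLieSubgroup E F L)
    (hN : IsLengthFunction N) {N' : LieAlg F L → ℝ} (hN' : IsLengthFunction N')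
    (h : ∀ X, N (inclDeriv E F L X) = N' X) (a b : L) :
    leftEDist E N (a : G) (b : G) ≤ leftEDist F N' a b := by
  refine le_of_forall_gt fun r hr => ?_
  obtain ⟨γ, rfl, rfl, hγ, hlen⟩ := exists_curveLength_lt hN' hr
  refine lt_of_le_of_lt (leftEDist_le_curveLength hN (γ := fun s => (γ s : G)) fun t _ => ?_) ?_
  · exact (hL.smooth.of_le (by simp)).contMDiffAt.comp t (hγ t)
  · have h' : ∀ t, leftLogDeriv E (fun s => (γ s : G)) t = inclDeriv E F L (leftLogDeriv F γ t) :=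
      fun t => leftLogDeriv_coe hL (hγ.mdifferentiable (by simp) t)
    simpa only [curveLength, h', h] using hlen

/-- Points near the identity are close to it. -/
lemma eventually_leftEDist_lt (hN : IsLengthFunction N) {ε : ENNReal} (hε : 0 < ε) :
    ∀ᶠ u in 𝓝 (1 : G), leftEDist E N 1 u < ε := by
  have := isManifold_one (E := E) (G := G)
  obtain ⟨C, hC⟩ := hN.bounded
  set φ := extChartAt 𝓘(ℝ, E) (1 : G) with hφ
  set o := chartOne E G with ho
  set M := ‖fderiv ℝ (chartDiv E G) (o, o)‖ + 1
  have h1 : ContDiffAt ℝ 1 (chartDiv E G) (o, o) := contDiffAt_chartDiv.of_le (by simp)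
  have h2 : ∀ᶠ p in 𝓝 (o, o), DifferentiableAt ℝ (chartDiv E G) p ∧
      ‖fderiv ℝ (chartDiv E G) p‖ < M := by
    have h3 : ContinuousAt (fderiv ℝ (chartDiv E G)) (o, o) :=
      (h1.fderiv_right (m := 0) (by simp)).continuousAt
    filter_upwards [h1.eventually (by simp), h3.norm.eventually_lt_const (lt_add_one _)]
      with p hp hp' using ⟨hp.differentiableAt (by simp), hp'⟩
  have h3 : ∀ᶠ x in 𝓝 o, x ∈ φ.target ∧ DifferentiableAt ℝ (chartDiv E G) (x, x) ∧
      ‖fderiv ℝ (chartDiv E G) (x, x)‖ < M := by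
    have hc : Tendsto (fun x : E => (x, x)) (𝓝 o) (𝓝 (o, o)) :=
      (continuous_id.prodMk continuous_id).tendsto o
    exact (eventually_mem_target (E := E) (G := G)).and (hc.eventually h2)
  obtain ⟨ρ, hρ, hball⟩ := Metric.eventually_nhds_iff_ball.1 h3
  have hφc : Tendsto φ (𝓝 1) (𝓝 o) := continuousAt_extChartAt (1 : G)
  have h4 : Tendsto (fun u => ENNReal.ofReal (|C| * (M * ‖φ u - o‖))) (𝓝 (1 : G)) (𝓝 0) := by
    have h5 : Tendsto (fun u => |C| * (M * ‖φ u - o‖)) (𝓝 (1 : G)) (𝓝 (|C| * (M * ‖o - o‖))) :=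
      ((hφc.sub_const o).norm.const_mul M).const_mul |C|
    rw [sub_self, norm_zero, mul_zero, mul_zero] at h5
    simpa using ENNReal.tendsto_ofReal h5
  filter_upwards [h4.eventually_lt_const hε, hφc.eventually (Metric.ball_mem_nhds o hρ),
    extChartAt_source_mem_nhds (I := 𝓘(ℝ, E)) (1 : G)] with u hu1 hu2 hu3
  set v := φ u - o
  -- The straight segment in the chart. Its logarithmic derivative is a partial derivative of
  -- `chartDiv`, bounded by `M * ‖v‖` on the ball.
  set c : ℝ → E := fun s => o + s • v
  set γ : ℝ → G := fun s => φ.symm (c s)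
  have hγ0 : γ 0 = 1 := by simp only [γ, c, zero_smul, add_zero]; exact symm_chartOne
  have hγ1 : γ 1 = u := by
    simp only [γ, c, v, one_smul, add_sub_cancel]
    exact φ.left_inv hu3
  have hcb : ∀ t ∈ Icc (0 : ℝ) 1, c t ∈ Metric.ball o ρ := fun t ht => by
    rw [mem_ball_iff_norm, add_sub_cancel_left, norm_smul, Real.norm_of_nonneg ht.1]
    rw [dist_eq_norm] at hu2
    exact (mul_le_of_le_one_left (norm_nonneg _) ht.2).trans_lt hu2
  have hcd : ∀ t, HasDerivAt c v t := fun t => by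
    have := ((hasDerivAt_id t).smul_const v).const_add o
    simpa only [id, one_smul] using this
  have hγC : ∀ t ∈ Icc (0 : ℝ) 1, ContMDiffAt 𝓘(ℝ, ℝ) 𝓘(ℝ, E) 1 γ t := fun t ht => by
    have hs : ContMDiffAt 𝓘(ℝ, E) 𝓘(ℝ, E) 1 φ.symm (c t) :=
      (contMDiffOn_extChartAt_symm (1 : G)).contMDiffAt
        (extChartAt_target_mem_nhds' (hball _ (hcb t ht)).1)
    have hcC : ContDiff ℝ 1 c := contDiff_const.add (contDiff_id.smul contDiff_const)
    exact hs.comp t hcC.contMDiff.contMDiffAt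
  rw [← hγ0]
  conv_lhs => rw [← hγ1]
  refine (leftEDist_le_curveLength hN hγC).trans_lt (lt_of_le_of_lt ?_ hu1)
  have hbound : ∀ t ∈ Ioo (0 : ℝ) 1, ENNReal.ofReal (N (leftLogDeriv E γ t)) ≤
      ENNReal.ofReal (|C| * (M * ‖v‖)) := fun t ht => by
    obtain ⟨-, hd, hn⟩ := hball _ (hcb t (Ioo_subset_Icc_self ht))
    refine ENNReal.ofReal_le_ofReal ?_
    have h5 : (leftLogDeriv E γ t : E) = fderiv ℝ (chartDiv E G) (c t, c t) (0, v) :=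
      (leftLogDeriv_eq_fderiv ((hγC t (Ioo_subset_Icc_self ht)).mdifferentiableAt (by simp))).trans
        (fderiv_partial_right hd (hcd t))
    have h6 : ‖fderiv ℝ (chartDiv E G) (c t, c t) (0, v)‖ ≤ M * ‖v‖ := by
      refine (ContinuousLinearMap.le_opNorm _ _).trans ?_
      have h7 : ‖((0 : E), v)‖ = ‖v‖ := by simp [Prod.norm_def]
      rw [h7]
      gcongr
    rw [h5]
    exact (hC _).trans (mul_le_mul (le_abs_self C) h6 (norm_nonneg _) (abs_nonneg C))
  refine (MeasureTheory.setLIntegral_mono' measurableSet_Ioo hbound).trans ?_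
  simp

end Lengths

/-! ### Distances between cosets -/

section Cosets

variable {E : Type*} [NormedAddCommGroup E] [NormedSpace ℝ E]
  {G : Type*} [TopologicalSpace G] [ChartedSpace E G] [Group G]

/-- The extended distance of which `cosetDist` is the real part. -/
def cosetEDist (L : Subgroup G) (N : LieAlg E G → ℝ) (p q : G ⧸ L) : ENNReal :=
  ⨅ (a : G) (b : G) (_ : (a : G ⧸ L) = p) (_ : (b : G ⧸ L) = q), leftEDist E N a b

lemma cosetEDist_le (L : Subgroup G) (N : LieAlg E G → ℝ) {p q : G ⧸ L} {a b : G}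
    (ha : (a : G ⧸ L) = p) (hb : (b : G ⧸ L) = q) : cosetEDist L N p q ≤ leftEDist E N a b :=
  iInf₂_le_of_le a b (iInf₂_le ha hb)

lemma exists_of_cosetEDist_lt {L : Subgroup G} {N : LieAlg E G → ℝ} {p q : G ⧸ L} {r : ENNReal}
    (h : cosetEDist L N p q < r) : ∃ a b : G, (a : G ⧸ L) = p ∧ (b : G ⧸ L) = q ∧
      leftEDist E N a b < r := by
  simp only [cosetEDist, iInf_lt_iff] at h
  obtain ⟨a, b, ha, hb, h⟩ := h
  exact ⟨a, b, ha, hb, h⟩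

/-- The distance from the identity to a coset. -/
def toCosetEDist (L : Subgroup G) (N : LieAlg E G → ℝ) (g : G) : ENNReal :=
  ⨅ k : L, leftEDist E N 1 (g * k)

lemma toCosetEDist_le (L : Subgroup G) (N : LieAlg E G → ℝ) (g : G) {k : G} (hk : k ∈ L) :
    toCosetEDist L N g ≤ leftEDist E N 1 (g * k) :=
  iInf_le (fun k : L => leftEDist E N 1 (g * k)) ⟨k, hk⟩

lemma exists_of_toCosetEDist_lt {L : Subgroup G} {N : LieAlg E G → ℝ} {g : G} {r : ENNReal}
    (h : toCosetEDist L N g < r) : ∃ k ∈ L, leftEDist E N 1 (g * k) < r := by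
  simp only [toCosetEDist, iInf_lt_iff] at h
  obtain ⟨⟨k, hk⟩, h⟩ := h
  exact ⟨k, hk, h⟩

variable [LieGroup 𝓘(ℝ, E) ∞ G] {L : Subgroup G} {N : LieAlg E G → ℝ}

lemma toCosetEDist_mul_le (hN : IsLengthFunction N) (u g : G) :
    toCosetEDist L N (u * g) ≤ leftEDist E N 1 u + toCosetEDist L N g := by
  rw [toCosetEDist, toCosetEDist, ENNReal.add_iInf]
  refine iInf_mono fun k => ?_
  refine (leftEDist_triangle hN 1 u _).trans_eq ?_
  congr 1
  rw [leftEDist_eq_one hN]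
  congr 1
  group

lemma toCosetEDist_mul_right_le {g k : G} (hk : k ∈ L) :
    toCosetEDist L N (g * k) ≤ toCosetEDist L N g := by
  refine le_iInf fun k' => ?_
  have := toCosetEDist_le L N (g * k) (L.mul_mem (L.inv_mem hk) k'.2)
  rwa [mul_assoc, mul_inv_cancel_left] at this

lemma cosetEDist_le_toCosetEDist (hN : IsLengthFunction N) (a b : G) :
    cosetEDist L N (a : G ⧸ L) (b : G ⧸ L) ≤ toCosetEDist L N (a⁻¹ * b) := by
  refine le_iInf fun k => ?_
  refine (cosetEDist_le L N rfl (b := b * k) ?_).trans_eq ?_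
  · exact QuotientGroup.mk_mul_of_mem b k.2
  · rw [leftEDist_eq_one hN, mul_assoc]

lemma eventually_toCosetEDist_le (hN : IsLengthFunction N) (g : G) :
    ∀ᶠ g' in 𝓝 g, toCosetEDist L N g' ≤ 1 + toCosetEDist L N g ∧
      toCosetEDist L N g ≤ 1 + toCosetEDist L N g' := by
  have : IsTopologicalGroup G := topologicalGroup_of_lieGroup 𝓘(ℝ, E) ∞
  have h1 : Tendsto (fun g' => g' * g⁻¹) (𝓝 g) (𝓝 1) := by
    have : Continuous fun g' => g' * g⁻¹ := by fun_prop
    simpa using this.tendsto g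
  have h2 : Tendsto (fun g' => g * g'⁻¹) (𝓝 g) (𝓝 1) := by
    have : Continuous fun g' => g * g'⁻¹ := by fun_prop
    simpa using this.tendsto g
  filter_upwards [h1.eventually (eventually_leftEDist_lt hN one_pos),
    h2.eventually (eventually_leftEDist_lt hN one_pos)] with g' h1 h2
  constructor
  · have := toCosetEDist_mul_le (L := L) hN (g' * g⁻¹) g
    rw [inv_mul_cancel_right] at this
    exact this.trans (add_le_add_left h1.le _)
  · have := toCosetEDist_mul_le (L := L) hN (g * g'⁻¹) g'
    rw [inv_mul_cancel_right] at this
    exact this.trans (add_le_add_left h2.le _)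

/-- `G` itself may be disconnected, so the argument runs in the quotient: the cosets at finite
distance form an open and closed set containing the base point. -/
lemma toCosetEDist_lt_top (hN : IsLengthFunction N) [ConnectedSpace (G ⧸ L)] (g : G) :
    toCosetEDist L N g < ⊤ := by
  have : IsTopologicalGroup G := topologicalGroup_of_lieGroup 𝓘(ℝ, E) ∞
  have hsat : ∀ a b : G, (a : G ⧸ L) = b → toCosetEDist L N b ≤ toCosetEDist L N a := by
    intro a b h
    have := toCosetEDist_mul_right_le (N := N) (g := a) (QuotientGroup.eq.1 h)
    rwa [mul_inv_cancel_left] at this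
  set S : Set (G ⧸ L) := (QuotientGroup.mk : G → G ⧸ L) '' {g | toCosetEDist L N g < ⊤}
  have hopen : ∀ V : Set G, IsOpen V → IsOpen ((QuotientGroup.mk : G → G ⧸ L) '' V) :=
    QuotientGroup.isOpenMap_coe
  have hS : IsOpen S := by
    refine hopen _ (isOpen_iff_mem_nhds.2 fun g hg => ?_)
    filter_upwards [eventually_toCosetEDist_le (L := L) hN g] with g' h
    exact h.1.trans_lt (ENNReal.add_lt_top.2 ⟨ENNReal.one_lt_top, hg⟩)
  have hSc : IsOpen Sᶜ := by
    have : Sᶜ = (QuotientGroup.mk : G → G ⧸ L) '' {g | ¬ toCosetEDist L N g < ⊤} := by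
      ext p
      obtain ⟨a, rfl⟩ := QuotientGroup.mk_surjective p
      constructor
      · exact fun h => ⟨a, fun h' => h ⟨a, h', rfl⟩, rfl⟩
      · rintro ⟨b, hb, hba⟩ ⟨c, hc, hca⟩
        exact hb ((hsat c b (hca.trans hba.symm)).trans_lt hc)
    rw [this]
    refine hopen _ (isOpen_iff_mem_nhds.2 fun g hg => ?_)
    filter_upwards [eventually_toCosetEDist_le (L := L) hN g] with g' h h'
    exact hg (h.2.trans_lt (ENNReal.add_lt_top.2 ⟨ENNReal.one_lt_top, h'⟩))
  have huniv : S = univ := by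
    refine IsClopen.eq_univ ⟨⟨hSc⟩, hS⟩ ⟨((1 : G) : G ⧸ L), 1, ?_, rfl⟩
    refine (toCosetEDist_le L N 1 L.one_mem).trans_lt ?_
    rw [mul_one, leftEDist_self hN]
    exact ENNReal.zero_lt_top
  obtain ⟨a, ha, hag⟩ : (g : G ⧸ L) ∈ S := huniv ▸ mem_univ _
  exact (hsat a g hag).trans_lt ha

lemma exists_toCosetEDist_le (hN : IsLengthFunction N) [CompactSpace G] [ConnectedSpace (G ⧸ L)] :
    ∃ R : ℝ, 0 ≤ R ∧ ∀ g, toCosetEDist L N g ≤ ENNReal.ofReal R := by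
  have h : ∃ R : NNReal, ∀ g ∈ (univ : Set G), toCosetEDist L N g ≤ R := by
    refine isCompact_univ.induction_on (p := fun s => ∃ R : NNReal, ∀ g ∈ s, toCosetEDist L N g ≤ R)
      ⟨0, fun _ h => h.elim⟩ (fun s t hst ⟨R, hR⟩ => ⟨R, fun g hg => hR g (hst hg)⟩) ?_ ?_
    · rintro s t ⟨R, hR⟩ ⟨R', hR'⟩
      refine ⟨max R R', fun g hg => ?_⟩
      rcases hg with hg | hg
      · exact (hR g hg).trans (by exact_mod_cast le_max_left _ _)
      · exact (hR' g hg).trans (by exact_mod_cast le_max_right _ _)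
    · intro g _
      refine ⟨_, mem_nhdsWithin_of_mem_nhds (eventually_toCosetEDist_le (L := L) hN g),
        (1 + toCosetEDist L N g).toNNReal, fun g' hg' => ?_⟩
      rw [ENNReal.coe_toNNReal (ENNReal.add_lt_top.2
        ⟨ENNReal.one_lt_top, toCosetEDist_lt_top hN g⟩).ne]
      exact hg'.1
  obtain ⟨R, hR⟩ := h
  exact ⟨R, R.2, fun g => by simpa using hR g (mem_univ g)⟩

/-- Conjugates of points near the identity are close to it. -/
lemma eventually_forall_leftEDist_conj_lt [CompactSpace G] (hN : IsLengthFunction N) {ε : ENNReal}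
    (hε : 0 < ε) : ∀ᶠ u in 𝓝 (1 : G), ∀ g : G, leftEDist E N 1 (g⁻¹ * u * g) < ε := by
  have : IsTopologicalGroup G := topologicalGroup_of_lieGroup 𝓘(ℝ, E) ∞
  have h := isCompact_univ.eventually_forall_of_forall_eventually (x₀ := (1 : G))
    (P := fun u g : G => leftEDist E N 1 (g⁻¹ * u * g) < ε) fun g _ => by
      have hc : Tendsto (fun z : G × G => z.2⁻¹ * z.1 * z.2) (𝓝 (1, g)) (𝓝 1) := by
        have : Continuous fun z : G × G => z.2⁻¹ * z.1 * z.2 := by fun_prop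
        simpa using this.tendsto (1, g)
      exact hc.eventually (eventually_leftEDist_lt hN hε)
  simpa using h

end Cosets

/-! ### Length functions of bilinear forms. -/

section QuadraticLength

variable {E : Type*} [NormedAddCommGroup E] [NormedSpace ℝ E] [FiniteDimensional ℝ E]
  {G : Type*} [TopologicalSpace G] [ChartedSpace E G] [Group G]

lemma isLengthFunction_sqrt (T : LieAlg E G →ₗ[ℝ] LieAlg E G →ₗ[ℝ] ℝ) :
    IsLengthFunction (fun X => √(T X X)) where
  homogeneous c X := by
    rw [map_smul, map_smul, LinearMap.smul_apply, smul_smul, smul_eq_mul, ← sq,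
      Real.sqrt_mul (sq_nonneg c), Real.sqrt_sq_eq_abs]
  bounded := by
    let T' : E →ₗ[ℝ] E →ₗ[ℝ] ℝ := T
    obtain ⟨C, hC, h⟩ : ∃ C, 0 ≤ C ∧ ∀ X, T' X X ≤ C * ‖X‖ * ‖X‖ :=
      ⟨_, norm_nonneg T'.toContinuousBilinearMap, fun X =>
        (le_abs_self _).trans (T'.toContinuousBilinearMap.le_opNorm₂ X X)⟩
    refine ⟨√C, fun X => ?_⟩
    refine (Real.sqrt_le_sqrt (h X)).trans_eq ?_
    rw [mul_assoc, ← sq, Real.sqrt_mul hC, Real.sqrt_sq (norm_nonneg _)]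

end QuadraticLength

/-! ### Criteria for Hausdorff-Gromov convergence. -/

section Approximation

variable {A B : Type*}

lemma hgDist_le {dA : A → A → ℝ} {dB : B → B → ℝ} {ε : ℝ} {S : Set (A × B)}
    (h : IsApproximation dA dB ε S) : hgDist dA dB ≤ ENNReal.ofReal ε :=
  iInf₂_le ε ⟨S, h⟩

lemma tendsto_hgDist_zero {dA : ℝ → A → A → ℝ} {dB : B → B → ℝ} {f : Filter ℝ}
    (h : ∀ ε > 0, ∀ᶠ t in f, ∃ S, IsApproximation (dA t) dB ε S) :
    Tendsto (fun t => hgDist (dA t) dB) f (𝓝 0) := by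
  rw [ENNReal.tendsto_nhds_zero]
  intro ε hε
  obtain ⟨r, -, h0, hr⟩ := ENNReal.lt_iff_exists_real_btwn.1 hε
  filter_upwards [h r (ENNReal.ofReal_pos.1 h0)] with t ⟨S, hS⟩
  exact (hgDist_le hS).trans hr.le

/-- Collapse to a point. -/
lemma tendsto_hgDist_pointDist [Nonempty A] {dA : ℝ → A → A → ℝ} {f : Filter ℝ} {c : ℝ → ℝ}
    (hc : Tendsto c f (𝓝 0)) (h0 : ∀ t a b, 0 ≤ dA t a b)
    (h : ∀ᶠ t in f, ∀ a b, dA t a b ≤ c t) :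
    Tendsto (fun t => hgDist (dA t) pointDist) f (𝓝 0) := by
  refine tendsto_hgDist_zero fun ε hε => ?_
  filter_upwards [h, hc.eventually_lt_const hε] with t ht hct
  refine ⟨univ, fun a => ⟨(), mem_univ _⟩, fun b => ⟨Classical.arbitrary A, mem_univ _⟩, ?_⟩
  rintro ⟨a, -⟩ - ⟨b, -⟩ -
  rw [pointDist, sub_zero, abs_of_nonneg (h0 t a b)]
  exact (ht a b).trans_lt hct

end Approximation

namespace TwoSummands

/-! ### Collapse of the fibre and of the total space -/

section Distances

variable {E : Type*} [NormedAddCommGroup E] [NormedSpace ℝ E] [FiniteDimensional ℝ E]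
  {G : Type*} [TopologicalSpace G] [ChartedSpace E G] [Group G] [LieGroup 𝓘(ℝ, E) ∞ G]
  [CompleteSpace E]
  {EK : Type*} [NormedAddCommGroup EK] [NormedSpace ℝ EK]
  {EH : Type*} [NormedAddCommGroup EH] [NormedSpace ℝ EH] [FiniteDimensional ℝ EH]
  {K H : Subgroup G} [ChartedSpace EK K] [ChartedSpace EH H]
  (D : TwoSummands E EK EH K H) {x₁ x₂ l : ℝ}

omit [FiniteDimensional ℝ E] [FiniteDimensional ℝ EH] in
lemma negKilling_self_nonneg {X : LieAlg E G} (hX : X ∈ D.p₁ ⊔ D.p₂) : 0 ≤ negKilling E G X X := by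
  rw [D.negKilling_eq_sum X hX]
  exact Finset.sum_nonneg fun a _ => div_nonneg (mul_self_nonneg _)
    (D.weight_pos D.b₁_pos D.b₂_pos a).le

omit [FiniteDimensional ℝ E] [FiniteDimensional ℝ EH] in
lemma Q₁_nonneg (X : LieAlg E G) : 0 ≤ D.Q₁ X X :=
  div_nonneg (D.negKilling_self_nonneg (D.p₁_le (D.pr₁_mem X))) D.b₁_pos.le

omit [FiniteDimensional ℝ E] [FiniteDimensional ℝ EH] in
lemma Q₂_nonneg (X : LieAlg E G) : 0 ≤ D.Q₂ X X :=
  div_nonneg (D.negKilling_self_nonneg (D.p₂_le (D.pr₂_mem X))) D.b₂_pos.le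

/-- The length for the metric of the total space. -/
abbrev totalLength (x₁ x₂ : ℝ) (X : LieAlg E G) : ℝ := √(D.metric x₁ x₂ X X)

/-- The length for the metric of the base. -/
abbrev baseLength (l : ℝ) (X : LieAlg E G) : ℝ := √(l * D.Q₂ X X)

/-- The length for the metric of the fibre. -/
abbrev fibreLength (x₁ : ℝ) (X : LieAlg EH H) : ℝ :=
  √(x₁ * D.Q₁ (inclDeriv E EH H X) (inclDeriv E EH H X))

omit [FiniteDimensional ℝ EH] in
lemma isLengthFunction_total (x₁ x₂ : ℝ) : IsLengthFunction (D.totalLength x₁ x₂) := by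
  have := isLengthFunction_sqrt (D.metricForm x₁ x₂)
  simpa only [metricForm_apply] using this

omit [FiniteDimensional ℝ EH] in
lemma isLengthFunction_base (l : ℝ) : IsLengthFunction (D.baseLength l) := by
  have h : D.baseLength l = D.totalLength 0 l := by
    ext X
    rw [totalLength, metric, zero_mul, zero_add]
  rw [h]
  exact D.isLengthFunction_total 0 l

omit [FiniteDimensional ℝ E] in
lemma isLengthFunction_fibre (x₁ : ℝ) : IsLengthFunction (D.fibreLength x₁) := by
  have := isLengthFunction_sqrt ((D.metricForm x₁ 0).compl₁₂ (inclDeriv E EH H) (inclDeriv E EH H))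
  simpa only [LinearMap.compl₁₂_apply, metricForm_apply, metric, zero_mul, add_zero] using this

omit [FiniteDimensional ℝ E] [FiniteDimensional ℝ EH] in
lemma totalLength_Ad {k : G} (hk : k ∈ K) (X : LieAlg E G) :
    D.totalLength x₁ x₂ (Ad E k X) = D.totalLength x₁ x₂ X := by
  rw [totalLength, metric, D.Q₁_Ad k hk, D.Q₂_Ad k hk, ← metric]

omit [FiniteDimensional ℝ E] [FiniteDimensional ℝ EH] in
lemma totalLength_inclDeriv (X : LieAlg EH H) :
    D.totalLength x₁ x₂ (inclDeriv E EH H X) = D.fibreLength x₁ X := by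
  have h : inclDeriv E EH H X ∈ subLieAlg E EK K ⊔ D.p₁ := by
    rw [← D.lieAlg_H]
    exact ⟨X, rfl⟩
  have h2 : D.pr₂ (inclDeriv E EH H X) = 0 := (Submodule.projection_apply_eq_zero_iff _).2 h
  rw [totalLength, fibreLength, metric, D.Q₂_eq, h2, map_zero, LinearMap.zero_apply, zero_div,
    mul_zero, add_zero]

omit [FiniteDimensional ℝ E] [FiniteDimensional ℝ EH] in
lemma totalLength_le {m : ℝ} (h₁ : x₁ ≤ m) (h₂ : x₂ ≤ m) (hm : 0 ≤ m) (X : LieAlg E G) :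
    D.totalLength x₁ x₂ X ≤ √m * D.totalLength 1 1 X := by
  rw [totalLength, totalLength, ← Real.sqrt_mul hm]
  refine Real.sqrt_le_sqrt ?_
  have := mul_le_mul_of_nonneg_right h₁ (D.Q₁_nonneg X)
  have := mul_le_mul_of_nonneg_right h₂ (D.Q₂_nonneg X)
  rw [metric, metric]
  linarith

omit [FiniteDimensional ℝ E] [FiniteDimensional ℝ EH] in
lemma baseLength_le (h₁ : 0 ≤ x₁) (h₂ : 0 < x₂) (hl : 0 ≤ l) (X : LieAlg E G) :
    D.baseLength l X ≤ √(l / x₂) * D.totalLength x₁ x₂ X := by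
  rw [baseLength, totalLength, ← Real.sqrt_mul (div_nonneg hl h₂.le)]
  refine Real.sqrt_le_sqrt ?_
  have := mul_nonneg (div_nonneg hl h₂.le) (mul_nonneg h₁ (D.Q₁_nonneg X))
  have h3 : l / x₂ * (x₂ * D.Q₂ X X) = l * D.Q₂ X X := by field_simp
  rw [metric, mul_add, h3]
  linarith

omit [FiniteDimensional ℝ E] [FiniteDimensional ℝ EH] in
-- Subadditivity of the square root separates the vertical length, which `√x₁` makes small, from the
-- horizontal one.
lemma totalLength_le_add (h₁ : 0 ≤ x₁) (h₂ : 0 ≤ x₂) (hl : 0 < l) (X : LieAlg E G) :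
    D.totalLength x₁ x₂ X ≤ √x₁ * D.totalLength 1 0 X + √(x₂ / l) * D.baseLength l X := by
  rw [totalLength, totalLength, baseLength, ← Real.sqrt_mul h₁, ← Real.sqrt_mul (div_nonneg h₂ hl.le)]
  have h3 : x₂ / l * (l * D.Q₂ X X) = x₂ * D.Q₂ X X := by field_simp
  have h4 : x₁ * D.metric 1 0 X X = x₁ * D.Q₁ X X := by rw [metric]; ring
  rw [h3, h4, metric]
  have ha := mul_nonneg h₁ (D.Q₁_nonneg X)
  have hb := mul_nonneg h₂ (D.Q₂_nonneg X)
  refine Real.sqrt_le_iff.2 ⟨by positivity, ?_⟩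
  have := mul_nonneg (Real.sqrt_nonneg (x₁ * D.Q₁ X X)) (Real.sqrt_nonneg (x₂ * D.Q₂ X X))
  nlinarith [Real.sq_sqrt ha, Real.sq_sqrt hb]

omit [FiniteDimensional ℝ E] [FiniteDimensional ℝ EH] in
lemma fibreLength_eq (h₁ : 0 ≤ x₁) (X : LieAlg EH H) :
    D.fibreLength x₁ X = √x₁ * D.fibreLength 1 X := by
  rw [fibreLength, fibreLength, ← Real.sqrt_mul h₁, one_mul]

/-- Uniform smallness of the distances along the fibre. -/
lemma exists_fibre_bound [CompactSpace H] [LieGroup 𝓘(ℝ, EH) ∞ H]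
    [ConnectedSpace (H ⧸ K.subgroupOf H)] :
    ∃ R : ℝ, 0 ≤ R ∧ ∀ x₁ : ℝ, 0 < x₁ → ∀ h : H,
      toCosetEDist (K.subgroupOf H) (D.fibreLength x₁) h ≤ ENNReal.ofReal (√x₁ * R) := by
  obtain ⟨R, hR, h⟩ := exists_toCosetEDist_le (L := K.subgroupOf H) (D.isLengthFunction_fibre 1)
  refine ⟨R, hR, fun x₁ h₁ a => ?_⟩
  rw [ENNReal.ofReal_mul (Real.sqrt_nonneg _)]
  refine le_trans ?_ (mul_le_mul_right (h a) _)
  rw [toCosetEDist, toCosetEDist, ENNReal.mul_iInf_of_ne (by simpa using h₁) ENNReal.ofReal_ne_top]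
  exact iInf_mono fun k => leftEDist_le_mul (D.isLengthFunction_fibre x₁)
    (D.isLengthFunction_fibre 1) (Real.sqrt_pos.2 h₁) (fun X => (D.fibreLength_eq h₁.le X).le) _ _

omit [FiniteDimensional ℝ EH] in
-- `R` is found once for the metric `(1, 1)`; a metric with coefficients at most `m` has lengths at
-- most `√m` times as large.
lemma exists_total_bound [CompactSpace G] [ConnectedSpace (G ⧸ K)] :
    ∃ R : ℝ, 0 ≤ R ∧ ∀ x₁ x₂ m : ℝ, x₁ ≤ m → x₂ ≤ m → 0 < m → ∀ g : G,
      toCosetEDist K (D.totalLength x₁ x₂) g ≤ ENNReal.ofReal (√m * R) := by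
  obtain ⟨R, hR, h⟩ := exists_toCosetEDist_le (L := K) (D.isLengthFunction_total 1 1)
  refine ⟨R, hR, fun x₁ x₂ m h₁ h₂ hm a => ?_⟩
  rw [ENNReal.ofReal_mul (Real.sqrt_nonneg _)]
  refine le_trans ?_ (mul_le_mul_right (h a) _)
  rw [toCosetEDist, toCosetEDist, ENNReal.mul_iInf_of_ne (by simpa using hm) ENNReal.ofReal_ne_top]
  exact iInf_mono fun k => leftEDist_le_mul (D.isLengthFunction_total x₁ x₂)
    (D.isLengthFunction_total 1 1) (Real.sqrt_pos.2 hm) (D.totalLength_le h₁ h₂ hm.le) _ _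

lemma tendsto_fibreDist [CompactSpace H] [LieGroup 𝓘(ℝ, EH) ∞ H]
    [ConnectedSpace (H ⧸ K.subgroupOf H)] {x₁ : ℝ → ℝ} {f : Filter ℝ} (hx₁ : Tendsto x₁ f (𝓝 0))
    (hpos : ∀ᶠ t in f, 0 < x₁ t) :
    Tendsto (fun t => hgDist (D.fibreDist (x₁ t)) pointDist) f (𝓝 0) := by
  obtain ⟨R, hR, h⟩ := D.exists_fibre_bound
  refine tendsto_hgDist_pointDist (c := fun t => √(x₁ t) * R) ?_
    (fun t a b => ENNReal.toReal_nonneg) ?_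
  · simpa using ((Real.continuous_sqrt.tendsto 0).comp hx₁).mul_const R
  · filter_upwards [hpos] with t ht a b
    obtain ⟨a, rfl⟩ := QuotientGroup.mk_surjective a
    obtain ⟨b, rfl⟩ := QuotientGroup.mk_surjective b
    refine ENNReal.toReal_le_of_le_ofReal (by positivity) ?_
    exact (cosetEDist_le_toCosetEDist (D.isLengthFunction_fibre (x₁ t)) a b).trans (h _ ht _)

lemma tendsto_totalDist_pointDist [CompactSpace G] [ConnectedSpace (G ⧸ K)] {x₁ x₂ : ℝ → ℝ}
    {f : Filter ℝ} (hx₁ : Tendsto x₁ f (𝓝 0)) (hx₂ : Tendsto x₂ f (𝓝 0))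
    (hpos : ∀ᶠ t in f, 0 < x₁ t) :
    Tendsto (fun t => hgDist (D.totalDist (x₁ t) (x₂ t)) pointDist) f (𝓝 0) := by
  obtain ⟨R, hR, h⟩ := D.exists_total_bound
  refine tendsto_hgDist_pointDist (c := fun t => √(max (x₁ t) (x₂ t)) * R) ?_
    (fun t a b => ENNReal.toReal_nonneg) ?_
  · simpa using ((Real.continuous_sqrt.tendsto _).comp (hx₁.max hx₂)).mul_const R
  · filter_upwards [hpos] with t ht a b
    obtain ⟨a, rfl⟩ := QuotientGroup.mk_surjective a
    obtain ⟨b, rfl⟩ := QuotientGroup.mk_surjective b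
    refine ENNReal.toReal_le_of_le_ofReal (by positivity) ?_
    exact (cosetEDist_le_toCosetEDist (D.isLengthFunction_total _ _) a b).trans
      (h _ _ _ (le_max_left _ _) (le_max_right _ _) (lt_max_of_lt_left ht) _)

end Distances

end TwoSummands

namespace TwoSummands

/-! ### Convergence of the total space to the base -/

section BaseLimit

variable {E : Type*} [NormedAddCommGroup E] [NormedSpace ℝ E] [FiniteDimensional ℝ E]
  {G : Type*} [TopologicalSpace G] [ChartedSpace E G] [Group G] [LieGroup 𝓘(ℝ, E) ∞ G]
  [CompleteSpace E]
  {EK : Type*} [NormedAddCommGroup EK] [NormedSpace ℝ EK]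
  {EH : Type*} [NormedAddCommGroup EH] [NormedSpace ℝ EH] [FiniteDimensional ℝ EH]
  {K H : Subgroup G} [ChartedSpace EK K] [ChartedSpace EH H]
  (D : TwoSummands E EK EH K H) {x₁ x₂ l : ℝ}

omit [FiniteDimensional ℝ EH] in
/-- The projection to the base is Lipschitz. -/
lemma cosetEDist_base_le (hKH : K ≤ H) (h₁ : 0 ≤ x₁) (h₂ : 0 < x₂) (hl : 0 < l) (a b : G) :
    cosetEDist H (D.baseLength l) (a : G ⧸ H) (b : G ⧸ H) ≤
      ENNReal.ofReal √(l / x₂) * cosetEDist K (D.totalLength x₁ x₂) (a : G ⧸ K) (b : G ⧸ K) := by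
  have hc : 0 < √(l / x₂) := Real.sqrt_pos.2 (div_pos hl h₂)
  have hc0 : ENNReal.ofReal √(l / x₂) ≠ 0 := by simpa using hc
  refine le_of_forall_gt fun r hr => ?_
  rw [mul_comm, ← ENNReal.lt_div_iff_mul_lt (Or.inl hc0) (Or.inl ENNReal.ofReal_ne_top)] at hr
  obtain ⟨a', b', ha, hb, h⟩ := exists_of_cosetEDist_lt hr
  rw [ENNReal.lt_div_iff_mul_lt (Or.inl hc0) (Or.inl ENNReal.ofReal_ne_top), mul_comm] at h
  refine lt_of_le_of_lt (cosetEDist_le H _ (a := a') (b := b') ?_ ?_)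
    ((leftEDist_le_mul (D.isLengthFunction_base l) (D.isLengthFunction_total x₁ x₂) hc
      (D.baseLength_le h₁ h₂ hl.le) a' b').trans_lt h)
  · exact QuotientGroup.eq.2 (hKH (QuotientGroup.eq.1 ha))
  · exact QuotientGroup.eq.2 (hKH (QuotientGroup.eq.1 hb))

/-- Along the fibre the distances in the total space are bounded by those of the fibre. -/
lemma toCosetEDist_le_fibre [LieGroup 𝓘(ℝ, EH) ∞ H] (hH : IsClosedLieSubgroup E EH H) (h : H) :
    toCosetEDist K (D.totalLength x₁ x₂) (h : G) ≤
      toCosetEDist (K.subgroupOf H) (D.fibreLength x₁) h :=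
  le_iInf fun k => (toCosetEDist_le K _ (h : G) (k := ((k : H) : G)) k.2).trans
    (leftEDist_coe_le hH (D.isLengthFunction_total x₁ x₂) (D.isLengthFunction_fibre x₁)
      D.totalLength_inclDeriv 1 (h * k))

omit [FiniteDimensional ℝ EH] in
-- A short curve for the base may have large vertical velocity, but it is fixed before `x₁` and
-- `x₂`, so that velocity has a maximum `M` over the curve.
lemma exists_leftEDist_total_le {a b : G} {r : ℝ} (hl : 0 < l)
    (h : leftEDist E (D.baseLength l) a b < ENNReal.ofReal r) :
    ∃ M : ℝ, ∀ x₁ x₂ : ℝ, 0 ≤ x₁ → 0 ≤ x₂ →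
      leftEDist E (D.totalLength x₁ x₂) a b ≤ ENNReal.ofReal (√x₁ * M + √(x₂ / l) * r) := by
  have hr : 0 < r := by
    by_contra! hr
    rw [ENNReal.ofReal_of_nonpos hr] at h
    exact not_lt_zero h
  obtain ⟨γ, rfl, rfl, hγ, hlen⟩ := exists_curveLength_lt (D.isLengthFunction_base l) h
  obtain ⟨C, hC⟩ := (D.isLengthFunction_total 1 0).bounded
  let η : ℝ → E := leftLogDeriv E γ
  have hη : Continuous η := continuous_leftLogDeriv hγ
  obtain ⟨M, hM⟩ := isCompact_Icc.bddAbove_image (f := fun t => |C| * ‖η t‖)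
    (K := Icc (0 : ℝ) 1) (continuous_const.mul hη.norm).continuousOn
  have hM' : ∀ t ∈ Icc (0 : ℝ) 1, D.totalLength 1 0 (leftLogDeriv E γ t) ≤ M := fun t ht => by
    refine ((hC _).trans ?_).trans (hM ⟨t, ht, rfl⟩)
    exact mul_le_mul_of_nonneg_right (le_abs_self C) (norm_nonneg _)
  have hM0 : 0 ≤ M := (Real.sqrt_nonneg _).trans (hM' 0 (left_mem_Icc.2 zero_le_one))
  refine ⟨M, fun x₁ x₂ h₁ h₂ => ?_⟩
  refine (leftEDist_le_curveLength (D.isLengthFunction_total x₁ x₂) fun t _ => hγ t).trans ?_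
  rw [ENNReal.ofReal_add (by positivity) (by positivity), ENNReal.ofReal_mul (Real.sqrt_nonneg (x₂ / l))]
  have hb : ∀ t ∈ Ioo (0 : ℝ) 1, ENNReal.ofReal (D.totalLength x₁ x₂ (leftLogDeriv E γ t)) ≤
      ENNReal.ofReal (√x₁ * M) + ENNReal.ofReal √(x₂ / l) *
        ENNReal.ofReal (D.baseLength l (leftLogDeriv E γ t)) := fun t ht => by
    rw [← ENNReal.ofReal_mul (Real.sqrt_nonneg _), ← ENNReal.ofReal_add (by positivity)
      (by positivity)]
    refine ENNReal.ofReal_le_ofReal ((D.totalLength_le_add h₁ h₂ hl _).trans ?_)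
    gcongr
    exact hM' t (Ioo_subset_Icc_self ht)
  refine (MeasureTheory.setLIntegral_mono' measurableSet_Ioo hb).trans ?_
  rw [MeasureTheory.lintegral_add_left measurable_const,
    MeasureTheory.lintegral_const_mul' _ _ ENNReal.ofReal_ne_top]
  refine add_le_add (by simp) (mul_le_mul_right hlen.le _)

variable [CompactSpace G] [CompactSpace H] [ConnectedSpace (G ⧸ K)]
  [ConnectedSpace (H ⧸ K.subgroupOf H)] [LieGroup 𝓘(ℝ, EH) ∞ H]
  (hH : IsClosedLieSubgroup E EH H) (hKH : K ≤ H)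

include hKH in
omit [FiniteDimensional ℝ EH] [CompactSpace H] [ConnectedSpace (H ⧸ K.subgroupOf H)]
  [LieGroup 𝓘(ℝ, EH) ∞ H] in
lemma exists_base_bound (hl : 0 < l) : ∃ R : ℝ, 0 ≤ R ∧ ∀ a b : G,
    cosetEDist H (D.baseLength l) (a : G ⧸ H) (b : G ⧸ H) ≤ ENNReal.ofReal R := by
  obtain ⟨R, hR, h⟩ := D.exists_total_bound
  refine ⟨√(l / 1) * (√1 * R), by positivity, fun a b => ?_⟩
  refine (D.cosetEDist_base_le hKH zero_le_one one_pos hl a b).trans ?_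
  rw [ENNReal.ofReal_mul (Real.sqrt_nonneg _)]
  exact mul_le_mul_right ((cosetEDist_le_toCosetEDist (D.isLengthFunction_total 1 1) a b).trans
    (h 1 1 1 le_rfl le_rfl one_pos _)) _

include hH hKH in
omit [CompactSpace G] [ConnectedSpace (G ⧸ K)] in
/-- The bound for one coset. -/
lemma exists_toCosetEDist_total_le (hl : 0 < l) (g : G) {r : ℝ}
    (hr : cosetEDist H (D.baseLength l) ((1 : G) : G ⧸ H) (g : G ⧸ H) < ENNReal.ofReal r) :
    ∃ M : ℝ, ∀ x₁ x₂ : ℝ, 0 < x₁ → 0 ≤ x₂ →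
      toCosetEDist K (D.totalLength x₁ x₂) g ≤ ENNReal.ofReal (√x₁ * M + √(x₂ / l) * r) := by
  have hr0 : 0 < r := by
    by_contra! h
    rw [ENNReal.ofReal_of_nonpos h] at hr
    exact not_lt_zero hr
  obtain ⟨R, hR, hfib⟩ := D.exists_fibre_bound
  obtain ⟨a, b, ha, hb, hab⟩ := exists_of_cosetEDist_lt hr
  obtain ⟨M, hM⟩ := D.exists_leftEDist_total_le hl hab
  have haH : a ∈ H := by simpa using QuotientGroup.eq.1 ha.symm
  have hbH : b⁻¹ * g ∈ H := QuotientGroup.eq.1 hb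
  -- The path from `1` to the coset of `g` has three legs: along the fibre to `a k`, along the base
  -- curve translated by `k`, and along the fibre again. The `+ 1` gives the strict inequality
  -- needed to choose `k`.
  refine ⟨(R + 1) + max M 0 + R, fun x₁ x₂ h₁ h₂ => ?_⟩
  have hN := D.isLengthFunction_total x₁ x₂
  have hs : 0 < √x₁ := Real.sqrt_pos.2 h₁
  have hH' : ∀ h ∈ H, toCosetEDist K (D.totalLength x₁ x₂) h ≤ ENNReal.ofReal (√x₁ * R) :=
    fun h hh => (D.toCosetEDist_le_fibre hH ⟨h, hh⟩).trans (hfib x₁ h₁ ⟨h, hh⟩)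
  obtain ⟨k, hk, hak⟩ := exists_of_toCosetEDist_lt ((hH' a haH).trans_lt
    ((ENNReal.ofReal_lt_ofReal_iff (by positivity)).2
      (by nlinarith : √x₁ * R < √x₁ * (R + 1))))
  have h3 : leftEDist E (D.totalLength x₁ x₂) (a * k) (b * k) ≤
      ENNReal.ofReal (√x₁ * max M 0 + √(x₂ / l) * r) := by
    refine (leftEDist_mul_right_le hN (fun X => D.totalLength_Ad (K.inv_mem hk) X) a b).trans
      ((hM x₁ x₂ h₁.le h₂).trans (ENNReal.ofReal_le_ofReal ?_))
    gcongr
    exact le_max_left _ _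
  have h4 := toCosetEDist_mul_le (L := K) hN (b * k) ((b * k)⁻¹ * g)
  rw [mul_inv_cancel_left] at h4
  have h5 : (b * k)⁻¹ * g ∈ H := by
    rw [mul_inv_rev, mul_assoc]
    exact H.mul_mem (H.inv_mem (hKH hk)) hbH
  refine h4.trans ((add_le_add ((leftEDist_triangle hN 1 (a * k) (b * k)).trans
    (add_le_add hak.le h3)) (hH' _ h5)).trans ?_)
  rw [← ENNReal.ofReal_add (by positivity) (by positivity),
    ← ENNReal.ofReal_add (by positivity) (by positivity)]
  exact ENNReal.ofReal_le_ofReal (le_of_eq (by ring))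

omit [FiniteDimensional ℝ EH] [CompactSpace G] [CompactSpace H] [ConnectedSpace (G ⧸ K)]
  [ConnectedSpace (H ⧸ K.subgroupOf H)] [LieGroup 𝓘(ℝ, EH) ∞ H] in
-- Translating by `u⁻¹` a curve from `a` to the coset of `u g` makes it end at the coset of `g` but
-- start at `u⁻¹ a`. Correcting the start costs the distance from `1` to `a⁻¹ u a`, hence the
-- hypothesis on all conjugates.
lemma cosetEDist_base_mul_le {δ : ENNReal} {u : G}
    (hu : ∀ g : G, leftEDist E (D.baseLength l) 1 (g⁻¹ * u * g) < δ) (g : G) :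
    cosetEDist H (D.baseLength l) ((1 : G) : G ⧸ H) (g : G ⧸ H) ≤
      cosetEDist H (D.baseLength l) ((1 : G) : G ⧸ H) ((u * g : G) : G ⧸ H) + δ := by
  have hN := D.isLengthFunction_base l
  refine ENNReal.le_of_forall_pos_le_add fun ε hε hfin => ?_
  have hne : cosetEDist H (D.baseLength l) ((1 : G) : G ⧸ H) ((u * g : G) : G ⧸ H) ≠ ⊤ :=
    fun h => by simp [h] at hfin
  obtain ⟨a, b, ha, hb, hab⟩ := exists_of_cosetEDist_lt
    (ENNReal.lt_add_right hne (ENNReal.coe_ne_zero.2 hε.ne'))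
  have hb' : ((u⁻¹ * b : G) : G ⧸ H) = g := by
    refine QuotientGroup.eq.2 ?_
    have := QuotientGroup.eq.1 hb
    simpa [mul_assoc] using this
  refine (cosetEDist_le H _ ha hb').trans ?_
  rw [← leftEDist_mul_left hN u, mul_inv_cancel_left]
  have h1 : leftEDist E (D.baseLength l) (u * a) a < δ := by
    rw [leftEDist_comm hN, leftEDist_eq_one hN, ← mul_assoc]
    exact hu a
  calc leftEDist E (D.baseLength l) (u * a) b
      ≤ leftEDist E (D.baseLength l) (u * a) a + leftEDist E (D.baseLength l) a b :=
        leftEDist_triangle hN _ _ _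
    _ ≤ δ + (cosetEDist H (D.baseLength l) ((1 : G) : G ⧸ H) ((u * g : G) : G ⧸ H) + ε) :=
        add_le_add h1.le hab.le
    _ = _ := by ring

include hH hKH in
-- The bound for one coset has a constant depending on the coset. It extends to a neighbourhood at
-- small cost, and compactness leaves finitely many neighbourhoods.
lemma eventually_toCosetEDist_total_le (hl : 0 < l) {x₁ x₂ : ℝ → ℝ} {f : Filter ℝ}
    (hx₁ : Tendsto x₁ f (𝓝 0)) (hx₂ : Tendsto x₂ f (𝓝 l)) (hpos : ∀ᶠ t in f, 0 < x₁ t ∧ 0 < x₂ t)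
    {ε : ℝ} (hε : 0 < ε) : ∀ᶠ t in f, ∀ g : G, toCosetEDist K (D.totalLength (x₁ t) (x₂ t)) g ≤
      cosetEDist H (D.baseLength l) ((1 : G) : G ⧸ H) (g : G ⧸ H) + ENNReal.ofReal ε := by
  have : IsTopologicalGroup G := topologicalGroup_of_lieGroup 𝓘(ℝ, E) ∞
  set m := l + 1
  have hm : 0 < m := by positivity
  -- Three errors must add up to `ε`: `√m δ` for moving `g` in the total space, `√m δ` for moving it
  -- in the base, and `2 δ` for the estimate at the centre.
  set δ := ε / (√m + √m + 2)
  have hδ : 0 < δ := by positivity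
  have hN₀ := D.isLengthFunction_total 1 1
  have hδ' : 0 < ENNReal.ofReal δ := ENNReal.ofReal_pos.2 hδ
  have hm' : ∀ᶠ t in f, x₁ t ≤ m ∧ x₂ t ≤ m := by
    filter_upwards [hx₁.eventually_lt_const hm, hx₂.eventually_lt_const (lt_add_one l)]
      with t h1 h2 using ⟨h1.le, h2.le⟩
  obtain ⟨R, hR, hbase⟩ := D.exists_base_bound hKH hl
  have key : ∀ᶠ t in f, ∀ g ∈ (univ : Set G), toCosetEDist K (D.totalLength (x₁ t) (x₂ t)) g ≤
      cosetEDist H (D.baseLength l) ((1 : G) : G ⧸ H) (g : G ⧸ H) + ENNReal.ofReal ε := by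
    refine isCompact_univ.induction_on (p := fun s => ∀ᶠ t in f, ∀ g ∈ s,
      toCosetEDist K (D.totalLength (x₁ t) (x₂ t)) g ≤
        cosetEDist H (D.baseLength l) ((1 : G) : G ⧸ H) (g : G ⧸ H) + ENNReal.ofReal ε)
      (Eventually.of_forall fun _ _ h => h.elim) (fun s t hst h => ?_) (fun s t hs ht => ?_) ?_
    · filter_upwards [h] with τ h g hg using h g (hst hg)
    · filter_upwards [hs, ht] with τ hs ht g hg
      exact hg.elim (hs g) (ht g)
    · intro g₀ _
      set d := (cosetEDist H (D.baseLength l) ((1 : G) : G ⧸ H) (g₀ : G ⧸ H)).toReal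
      have hdtop : cosetEDist H (D.baseLength l) ((1 : G) : G ⧸ H) (g₀ : G ⧸ H) ≠ ⊤ :=
        ((hbase 1 g₀).trans_lt ENNReal.ofReal_lt_top).ne
      have hd0 : 0 ≤ d := ENNReal.toReal_nonneg
      have hd : cosetEDist H (D.baseLength l) ((1 : G) : G ⧸ H) (g₀ : G ⧸ H) = ENNReal.ofReal d :=
        (ENNReal.ofReal_toReal hdtop).symm
      obtain ⟨M, hM⟩ := D.exists_toCosetEDist_total_le hH hKH hl g₀ (r := d + δ) (by
        rw [hd]
        exact (ENNReal.ofReal_lt_ofReal_iff (by positivity)).2 (by linarith))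
      have hlim : Tendsto (fun t => √(x₁ t) * M + √(x₂ t / l) * (d + δ)) f (𝓝 (d + δ)) := by
        have h1 := ((Real.continuous_sqrt.tendsto 0).comp hx₁).mul_const M
        have h2 := ((Real.continuous_sqrt.tendsto (l / l)).comp (hx₂.div_const l)).mul_const (d + δ)
        have h3 := h1.add h2
        rw [Real.sqrt_zero, zero_mul, zero_add, div_self hl.ne', Real.sqrt_one, one_mul] at h3
        exact h3
      have hnhds : ∀ᶠ g in 𝓝 g₀, ∀ a : G,
          leftEDist E (D.totalLength 1 1) 1 (a⁻¹ * (g * g₀⁻¹) * a) < ENNReal.ofReal δ := by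
        have h1 : Tendsto (fun g => g * g₀⁻¹) (𝓝 g₀) (𝓝 1) := by
          have : Continuous fun g => g * g₀⁻¹ := by fun_prop
          simpa using this.tendsto g₀
        exact h1.eventually (eventually_forall_leftEDist_conj_lt hN₀ hδ')
      refine ⟨_, mem_nhdsWithin_of_mem_nhds hnhds, ?_⟩
      filter_upwards [hpos, hm', hlim.eventually_lt_const (by linarith : d + δ < d + 2 * δ)]
        with t ⟨ht₁, ht₂⟩ ⟨hm₁, hm₂⟩ ht g hg
      set u := g * g₀⁻¹
      have hug : u * g₀ = g := inv_mul_cancel_right g g₀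
      have hsm : 0 < √m := Real.sqrt_pos.2 hm
      have h1 : leftEDist E (D.totalLength (x₁ t) (x₂ t)) 1 u ≤ ENNReal.ofReal (√m * δ) := by
        rw [ENNReal.ofReal_mul hsm.le]
        refine (leftEDist_le_mul (D.isLengthFunction_total _ _) hN₀ hsm
          (D.totalLength_le hm₁ hm₂ hm.le) 1 u).trans (mul_le_mul_right ?_ _)
        simpa using (hg 1).le
      have h2 : ∀ a : G, leftEDist E (D.baseLength l) 1 (a⁻¹ * u * a) < ENNReal.ofReal (√m * δ) := by
        intro a
        rw [ENNReal.ofReal_mul hsm.le]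
        have hb : ∀ X : LieAlg E G, D.baseLength l X ≤ √m * D.totalLength 1 1 X := fun X => by
          refine (D.baseLength_le zero_le_one one_pos hl.le X).trans ?_
          gcongr
          rw [div_one]
          exact (lt_add_one l).le
        refine (leftEDist_le_mul (D.isLengthFunction_base l) hN₀ hsm hb 1 _).trans_lt ?_
        exact ENNReal.mul_lt_mul_right (by simpa using hm) ENNReal.ofReal_ne_top (hg a)
      have h3 := D.cosetEDist_base_mul_le h2 g₀
      rw [hug, hd] at h3
      have h4 := toCosetEDist_mul_le (L := K) (D.isLengthFunction_total (x₁ t) (x₂ t)) u g₀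
      rw [hug] at h4
      have h5 : toCosetEDist K (D.totalLength (x₁ t) (x₂ t)) g₀ ≤ ENNReal.ofReal (d + 2 * δ) :=
        (hM _ _ ht₁ ht₂.le).trans (ENNReal.ofReal_le_ofReal ht.le)
      refine (h4.trans (add_le_add h1 h5)).trans ?_
      rw [ENNReal.ofReal_add hd0 (by positivity)]
      calc ENNReal.ofReal (√m * δ) + (ENNReal.ofReal d + ENNReal.ofReal (2 * δ))
          ≤ ENNReal.ofReal (√m * δ) + ((cosetEDist H (D.baseLength l) ((1 : G) : G ⧸ H)
              (g : G ⧸ H) + ENNReal.ofReal (√m * δ)) + ENNReal.ofReal (2 * δ)) := by gcongr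
        _ = cosetEDist H (D.baseLength l) ((1 : G) : G ⧸ H) (g : G ⧸ H) +
              (ENNReal.ofReal (√m * δ) + ENNReal.ofReal (√m * δ) + ENNReal.ofReal (2 * δ)) := by ring
        _ = _ := by
          rw [← ENNReal.ofReal_add (by positivity) (by positivity),
            ← ENNReal.ofReal_add (by positivity) (by positivity)]
          congr 2
          simp only [δ]
          field_simp
  simpa using key

include hH hKH in
-- The graph of the projection `G ⧸ K → G ⧸ H` is the approximation: the Lipschitz bound controls
-- distances from one side and `eventually_toCosetEDist_total_le` from the other.
lemma tendsto_totalDist_baseDist (hl : 0 < l) {x₁ x₂ : ℝ → ℝ} {f : Filter ℝ}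
    (hx₁ : Tendsto x₁ f (𝓝 0)) (hx₂ : Tendsto x₂ f (𝓝 l))
    (hpos : ∀ᶠ t in f, 0 < x₁ t ∧ 0 < x₂ t) :
    Tendsto (fun t => hgDist (D.totalDist (x₁ t) (x₂ t)) (D.baseDist l)) f (𝓝 0) := by
  obtain ⟨R, hR, hbase⟩ := D.exists_base_bound hKH hl
  obtain ⟨R', hR', htot⟩ := D.exists_total_bound
  set m := l + 1
  have hm : 0 < m := by positivity
  refine tendsto_hgDist_zero fun ε hε => ?_
  -- The Lipschitz constant of the projection tends to `1`; multiplied by the bounded diameter of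
  -- the total space, its excess is an additive error.
  have hlim : Tendsto (fun t => |√(l / x₂ t) - 1| * (√m * R')) f (𝓝 0) := by
    have h1 := (Real.continuous_sqrt.tendsto (l / l)).comp ((tendsto_const_nhds (x := l)).div hx₂ hl.ne')
    rw [div_self hl.ne', Real.sqrt_one] at h1
    simpa using ((h1.sub_const 1).abs).mul_const (√m * R')
  filter_upwards [hpos, D.eventually_toCosetEDist_total_le hH hKH hl hx₁ hx₂ hpos (half_pos hε),
    hlim.eventually_lt_const hε, hx₁.eventually_lt_const hm,
    hx₂.eventually_lt_const (lt_add_one l)] with t ⟨ht₁, ht₂⟩ hup hlow hm₁ hm₂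
  have hmap : ∀ a b : G, (a : G ⧸ K) = b → (a : G ⧸ H) = b := fun a b h =>
    QuotientGroup.eq.2 (hKH (QuotientGroup.eq.1 h))
  refine ⟨{z | ∃ a : G, (a : G ⧸ K) = z.1 ∧ (a : G ⧸ H) = z.2}, fun p => ?_, fun q => ?_, ?_⟩
  · obtain ⟨a, rfl⟩ := QuotientGroup.mk_surjective p
    exact ⟨a, a, rfl, rfl⟩
  · obtain ⟨a, rfl⟩ := QuotientGroup.mk_surjective q
    exact ⟨a, a, rfl, rfl⟩
  · rintro ⟨-, -⟩ ⟨a, rfl, rfl⟩ ⟨-, -⟩ ⟨b, rfl, rfl⟩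
    set tot := cosetEDist K (D.totalLength (x₁ t) (x₂ t)) (a : G ⧸ K) (b : G ⧸ K)
    set bas := cosetEDist H (D.baseLength l) (a : G ⧸ H) (b : G ⧸ H)
    change |tot.toReal - bas.toReal| < ε
    have htot' : tot ≤ ENNReal.ofReal (√m * R') :=
      (cosetEDist_le_toCosetEDist (D.isLengthFunction_total _ _) a b).trans
        (htot _ _ m hm₁.le hm₂.le hm _)
    have htop : tot ≠ ⊤ := (htot'.trans_lt ENNReal.ofReal_lt_top).ne
    have hbtop : bas ≠ ⊤ := ((hbase a b).trans_lt ENNReal.ofReal_lt_top).ne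
    have htR : tot.toReal ≤ √m * R' := ENNReal.toReal_le_of_le_ofReal (by positivity) htot'
    have h1 : bas.toReal ≤ √(l / x₂ t) * tot.toReal := by
      have h := ENNReal.toReal_mono (ENNReal.mul_ne_top ENNReal.ofReal_ne_top htop)
        (D.cosetEDist_base_le hKH ht₁.le ht₂ hl a b)
      rwa [ENNReal.toReal_mul, ENNReal.toReal_ofReal (Real.sqrt_nonneg _)] at h
    -- Left translation by `a⁻¹` moves the first coset to the base point, where the uniform estimate
    -- applies.
    have h2 : tot ≤ bas + ENNReal.ofReal (ε / 2) := by
      refine ((cosetEDist_le_toCosetEDist (D.isLengthFunction_total _ _) a b).trans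
        (hup _)).trans (add_le_add_left ?_ _)
      refine le_of_forall_gt fun r hr => ?_
      obtain ⟨a', b', ha, hb, hab⟩ := exists_of_cosetEDist_lt hr
      refine (cosetEDist_le H _ (a := a⁻¹ * a') (b := a⁻¹ * b') ?_ ?_).trans_lt
        ((leftEDist_mul_left (D.isLengthFunction_base l) a⁻¹ a' b').trans_lt hab)
      · refine QuotientGroup.eq.2 ?_
        simpa using QuotientGroup.eq.1 ha
      · refine QuotientGroup.eq.2 ?_
        simpa [mul_assoc] using QuotientGroup.eq.1 hb
    have h3 : tot.toReal ≤ bas.toReal + ε / 2 := by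
      have h := ENNReal.toReal_mono (ENNReal.add_ne_top.2 ⟨hbtop, ENNReal.ofReal_ne_top⟩) h2
      rwa [ENNReal.toReal_add hbtop ENNReal.ofReal_ne_top, ENNReal.toReal_ofReal (by positivity)] at h
    rw [abs_lt]
    refine ⟨?_, by linarith⟩
    have h4 : (√(l / x₂ t) - 1) * tot.toReal ≤ |√(l / x₂ t) - 1| * (√m * R') :=
      mul_le_mul (le_abs_self _) htR ENNReal.toReal_nonneg (abs_nonneg _)
    linarith

end BaseLimit

end TwoSummands

end HomogeneousRicci

end

/-! ### Assembly of the flow, curvature and distance statements. -/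

theorem mainTheorem5
    {E : Type*} [NormedAddCommGroup E] [NormedSpace ℝ E] [FiniteDimensional ℝ E] [CompleteSpace E]
    {G : Type*} [TopologicalSpace G] [T2Space G] [CompactSpace G] [ChartedSpace E G] [Group G]
    [LieGroup 𝓘(ℝ, E) ∞ G]
    {EK : Type*} [NormedAddCommGroup EK] [NormedSpace ℝ EK] [FiniteDimensional ℝ EK]
    {EH : Type*} [NormedAddCommGroup EH] [NormedSpace ℝ EH] [FiniteDimensional ℝ EH]
    (K H : Subgroup G)
    [ChartedSpace EK K] [LieGroup 𝓘(ℝ, EK) ∞ K]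
    [ChartedSpace EH H] [LieGroup 𝓘(ℝ, EH) ∞ H]
    (hK : HomogeneousRicci.IsClosedLieSubgroup E EK K)
    (hH : HomogeneousRicci.IsClosedLieSubgroup E EH H)
    (hKH : K ≤ H)
    [ConnectedSpace (G ⧸ K)] [ConnectedSpace (H ⧸ K.subgroupOf H)]
    (heff : K.normalCore = ⊥)
    (D : HomogeneousRicci.TwoSummands E EK EH K H)
    (h122 : 0 < D.c122) (hC : 0 < D.constC)
    (ybar : ℝ) (hybar : 0 < ybar)
    (hEinstein : ∀ x₁ x₂ : ℝ, 0 < x₁ → 0 < x₂ → (D.IsEinstein x₁ x₂ ↔ x₁ / x₂ = ybar))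
    (a₁ a₂ : ℝ) (ha₁ : 0 < a₁) (ha₂ : 0 < a₂) :
    (a₁ / a₂ < ybar →
      ∃ T : ℝ, 0 < T ∧ ∃ x₁ x₂ : ℝ → ℝ,
        D.IsUniqueMaximalFlow univ a₁ a₂ x₁ x₂ (Iio T) ∧
        D.CurvatureUnbounded x₁ x₂ T ∧
        D.IsTypeIAncient x₁ x₂ ∧
        Tendsto x₁ (𝓝[<] T) (𝓝 0) ∧
        Tendsto (fun t => HomogeneousRicci.hgDist (D.fibreDist (x₁ t))
          HomogeneousRicci.pointDist) (𝓝[<] T) (𝓝 0) ∧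
        (∃ l : ℝ, 0 < l ∧ Tendsto x₂ (𝓝[<] T) (𝓝 l) ∧
          Tendsto (fun t => HomogeneousRicci.hgDist (D.totalDist (x₁ t) (x₂ t))
            (D.baseDist l)) (𝓝[<] T) (𝓝 0)) ∧
        Tendsto (fun t => x₁ t / x₂ t) atBot (𝓝 ybar)) ∧
    (ybar < a₁ / a₂ →
      (∃ T : ℝ, 0 < T ∧ ∃ x₁ x₂ : ℝ → ℝ,
        D.IsUniqueMaximalFlow (Ici 0) a₁ a₂ x₁ x₂ (Ico 0 T) ∧
        D.CurvatureUnbounded x₁ x₂ T ∧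
        Tendsto x₁ (𝓝[<] T) (𝓝 0) ∧
        Tendsto x₂ (𝓝[<] T) (𝓝 0) ∧
        Tendsto (fun t => HomogeneousRicci.hgDist (D.totalDist (x₁ t) (x₂ t))
          HomogeneousRicci.pointDist) (𝓝[<] T) (𝓝 0) ∧
        Tendsto (fun t => x₁ t / x₂ t) (𝓝[<] T) (𝓝 ybar)) ∧
      ¬ ∃ T : ℝ, 0 < T ∧ ∃ x₁ x₂ : ℝ → ℝ,
        D.IsRicciFlowOn x₁ x₂ (Iio T) ∧ x₁ 0 = a₁ ∧ x₂ 0 = a₂) := by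
  obtain ⟨β, δ, hβ, hδ, hric⟩ :=
    D.exists_ric_eq_of_einstein hH hK h122 hC hybar hEinstein
  have hiff := D.isRicciFlowOn_iff hric
  have : CompactSpace H := isCompact_iff_compactSpace.1 hH.isClosed.isCompact
  -- A lower bound independent of the metric; it drives the curvature blow-up in both cases.
  have hric₁ : ∀ x₁ x₂ : ℝ, 0 < x₁ → 0 < x₂ → ∀ i,
      (β + δ) * ybar ^ 2 ≤ D.ric x₁ x₂ (D.e₁ i) (D.e₁ i) := fun x₁ x₂ h₁ h₂ i => by
    rw [hric x₁ x₂ h₁ h₂ _ (D.p₁_le (D.e₁ i).2) _ (D.p₁_le (D.e₁ i).2),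
      D.Q₁_of_mem_p₁ (D.e₁ i).2, D.Q₂_of_mem_p₁ (D.e₁ i).2, D.negKilling_e₁, if_pos rfl, mul_one,
      div_self D.b₁_pos.ne', mul_zero, add_zero, mul_one]
    exact le_add_of_nonneg_right (by positivity)
  have hcurv : ∀ {x₁ x₂ : ℝ → ℝ} {T : ℝ}, (∀ᶠ t in 𝓝[<] T, 0 < x₁ t ∧ 0 < x₂ t) →
      Tendsto x₁ (𝓝[<] T) (𝓝 0) → D.CurvatureUnbounded x₁ x₂ T :=
    D.curvatureUnbounded_of_tendsto (by positivity) hric₁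
  constructor
  · intro h
    obtain ⟨T, hT, x₁, x₂, hx, rfl, rfl, hx₁, ⟨l, hl, hx₂⟩, hlim⟩ :=
      HomogeneousRicci.exists_reducedFlow_of_lt hβ hδ hybar ha₁ ha₂ h
    have hpos : ∀ᶠ t in 𝓝[<] T, 0 < x₁ t ∧ 0 < x₂ t := by
      filter_upwards [self_mem_nhdsWithin] with t ht
      exact ⟨(hx t ht).1, (hx t ht).2.1⟩
    refine ⟨T, hT, x₁, x₂, ⟨subset_univ _, ordConnected_Iio, hT, (hiff _ _ _).2 hx, rfl, rfl, ?_⟩,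
      hcurv hpos hx₁, ?_, hx₁, D.tendsto_fibreDist hx₁ (hpos.mono fun t ht => ht.1),
      ⟨l, hl, hx₂, D.tendsto_totalDist_baseDist hH hKH hl hx₁ hx₂ hpos⟩, hlim⟩
    · intro z₁ z₂ J hJS hJ h0 hz h₁ h₂
      have := HomogeneousRicci.IsReducedFlow.subset_and_eqOn (S := univ) hT
        (by rwa [univ_inter]) hx₁ hJS hJ h0 ((hiff _ _ _).1 hz) h₁ h₂
      rwa [univ_inter] at this
    · obtain ⟨L, hL⟩ := hx.exists_tendsto_abs_div hβ hδ hybar hlim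
      -- By scaling, `|t| |Rm|` is `|t|/x₂` times the norm at `(x₁/x₂, 1)`, and both factors
      -- converge.
      refine ⟨L * D.rmNorm ybar 1, (hL.mul ((D.continuousAt_rmNorm hybar).tendsto.comp
        hlim)).congr' ?_⟩
      filter_upwards [eventually_lt_atBot T] with t ht
      rw [D.rmNorm_eq (x₁ t) (hx t ht).2.1, Function.comp_apply, div_eq_mul_inv, mul_assoc]
  · intro h
    refine ⟨?_, ?_⟩
    · obtain ⟨T, hT, x₁, x₂, hx, rfl, rfl, hx₁, hx₂, hlim⟩ :=
        HomogeneousRicci.exists_reducedFlow_of_gt hβ hδ hybar ha₂ h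
      have hpos : ∀ᶠ t in 𝓝[<] T, 0 < x₁ t ∧ 0 < x₂ t := by
        filter_upwards [Ico_mem_nhdsLT hT] with t ht
        exact ⟨(hx t ht).1, (hx t ht).2.1⟩
      refine ⟨T, hT, x₁, x₂, ⟨Ico_subset_Ici_self, ordConnected_Ico, ⟨le_rfl, hT⟩,
        (hiff _ _ _).2 hx, rfl, rfl, ?_⟩, hcurv hpos hx₁, hx₁, hx₂,
        D.tendsto_totalDist_pointDist hx₁ hx₂ (hpos.mono fun t ht => ht.1), hlim⟩
      intro z₁ z₂ J hJS hJ h0 hz h₁ h₂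
      have := HomogeneousRicci.IsReducedFlow.subset_and_eqOn (S := Ici 0) hT
        (by rwa [Ici_inter_Iio]) hx₁ hJS hJ h0 ((hiff _ _ _).1 hz) h₁ h₂
      rwa [Ici_inter_Iio] at this
    · rintro ⟨T, hT, x₁, x₂, hx, rfl, rfl⟩
      exact ((hiff _ _ _).1 hx).not_ancient hβ hδ hybar hT h
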